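/- Let $(M^{2n},\omega)$ be a symplectic manifold (Hausdorff, second countable, without boundary), $n\ge 2$, with a Riemannian metric $g$ compatible with $\omega$, i.e. $g(u,v)=\omega(u,Jv)$ for an almost complex structure $J$. Let $G$ be a Lie group with an $\mathrm{Ad}$-invariant inner product on its Lie algebra, and let $P\to M$ be a principal $G$-bundle. These data give the $L^2$ inner product $\langle\alpha,\beta\rangle=\int_M \alpha\wedge *\beta$ on $\mathrm{Ad}\,P$-valued forms, where $*$ is the Hodge star of $g$ and of the orientation given by $\omega^n$. For a connection $A$ with curvature $F=dA+\tfrac12[A,A]$ (locally), let $F=F_p+\Phi\,\omega$ be the Lefschetz decomposition, with $F_p$ primitive; write $\Pi$ for the projection of 2-forms to their primitive part, $d_A^*=-*d_A*$, and $\partial_{+A}\eta=\Pi(d_A\eta)$ for $\eta\in\Omega^1(M,\mathrm{Ad}\,P)$. The primitive Yang–Mills functional is $S_{pYM}(A)=\|F_p(A)\|^2=\langle F_p,F_p\rangle$. Let $A$ be a smooth connection with $\|F_p(A)\|^2<\infty$ that is a critical point of $S_{pYM}$, i.e. $\frac{d}{dt}\big|_{t=0}S_{pYM}(A+t\eta)=0$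 for every smooth compactly supported $\eta\in\Omega^1(M,\mathrm{Ad}\,P)$. (Finiteness and compactness of supports are automatic when $M$ is compact.) Then for every smooth compactly supported $\eta\in\Omega^1(M,\mathrm{Ad}\,P)$ the function $t\mapsto S_{pYM}(A+t\eta)$ is finite and twice continuously differentiable, and the quadratic form defined by the Hessian, $Q_p(\eta,\eta):=\frac12\frac{d^2}{dt^2}\big|_{t=0}S_{pYM}(A+t\eta)$, is $$Q_p(\eta,\eta)=\big\langle d_A^*\partial_{+A}\eta+*[*F_p,\eta],\ \eta\big\rangle .$$ -/

import Mathlib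

open scoped Manifold ContDiff Topology
open MeasureTheory

noncomputable section

namespace PrimYM

/-! ### Exterior calculus on manifolds

The manifold `M` is modelled on a normed space `E`, without boundary. In Mathlib the tangent space
`TangentSpace 𝓘(ℝ, E) x` is the vector space `E`, identified by means of the preferred chart
`chartAt E x` at `x`; hence a `V`-valued `k`-form on `M` is a map `M → E [⋀^Fin k]→L[ℝ] V`. -/

section Forms

variable {E : Type*} [NormedAddCommGroup E] [NormedSpace ℝ E]
  {M : Type*} [TopologicalSpace M] [ChartedSpace E M]
  {V : Type*} [NormedAddCommGroup V] [NormedSpace ℝ V] {k : ℕ}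

/-- The derivative of the inverse of the preferred chart at `x₀`, at the coordinate point `y`: it
maps coordinate vectors to tangent vectors of `M`. -/
def chartSymmDeriv (x₀ : M) (y : E) : E →L[ℝ] E :=
  mfderiv 𝓘(ℝ, E) 𝓘(ℝ, E) ((chartAt E x₀).symm : E → M) y

/-- The coordinate expression of a form in the preferred chart at `x₀`: its pullback by the
inverse of the chart. Meaningful on the target of the chart. -/
def coordForm (α : M → E [⋀^Fin k]→L[ℝ] V) (x₀ : M) (y : E) : E [⋀^Fin k]→L[ℝ] V :=
  (α ((chartAt E x₀).symm y)).compContinuousLinearMap (chartSymmDeriv x₀ y)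

/-- A form is smooth on the open set `U` if all its coordinate expressions are smooth there. -/
def SmoothFormOn (α : M → E [⋀^Fin k]→L[ℝ] V) (U : Set M) : Prop :=
  ∀ x₀ : M, ContDiffOn ℝ ∞ (coordForm α x₀)
    ((chartAt E x₀).target ∩ (chartAt E x₀).symm ⁻¹' U)

/-- The exterior derivative of a form on a manifold, computed at `x` in the preferred chart
at `x`. -/
def extD (α : M → E [⋀^Fin k]→L[ℝ] V) (x : M) : E [⋀^Fin (k + 1)]→L[ℝ] V :=
  (extDeriv (coordForm α x) (chartAt E x x)).compContinuousLinearMap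
    (mfderiv 𝓘(ℝ, E) 𝓘(ℝ, E) (chartAt E x : M → E) x : E →L[ℝ] E)

end Forms

/-- The model space of a manifold of dimension `2 n`. -/
abbrev Model (n : ℕ) : Type := EuclideanSpace ℝ (Fin (2 * n))

/-- The standard basis of the model space; at each point of a manifold modelled on it this is a
basis of the tangent space. -/
def stdB {n : ℕ} (i : Fin (2 * n)) : Model n := EuclideanSpace.single i (1 : ℝ)

/-! ### Symplectic forms and compatible metrics -/

/-- A symplectic form: a smooth, closed, nondegenerate real 2-form. -/
structure SymplecticForm (n : ℕ) (M : Type*) [TopologicalSpace M] [ChartedSpace (Model n) M] where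
  form : M → (Model n) [⋀^Fin 2]→L[ℝ] ℝ
  smooth : SmoothFormOn form Set.univ
  closed : ∀ x, extD form x = 0
  nondegenerate : ∀ x u, (∀ v, form x ![u, v] = 0) → u = 0

/-- Smooth Riemannian metrics on `M`. -/
abbrev Metric (n : ℕ) (M : Type*) [TopologicalSpace M] [ChartedSpace (Model n) M]
    [IsManifold 𝓘(ℝ, Model n) ∞ M] :=
  Bundle.ContMDiffRiemannianMetric 𝓘(ℝ, Model n) ∞ (Model n)
    (fun x : M => TangentSpace 𝓘(ℝ, Model n) x)

section Geometry

variable {n : ℕ} {M : Type*} [TopologicalSpace M] [ChartedSpace (Model n) M]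
  [IsManifold 𝓘(ℝ, Model n) ∞ M]

/-- The scalar product of two tangent vectors at `x`. -/
def metricAt (g : Metric n M) (x : M) (u v : Model n) : ℝ := g.inner x u v

/-- The metric `g` is compatible with `Ω`: there is an almost complex structure `J` with
`g(u, v) = Ω(u, J v)`. -/
def IsCompatible (Ω : SymplecticForm n M) (g : Metric n M) : Prop :=
  ∃ J : M → Model n →L[ℝ] Model n,
    (∀ x u, J x (J x u) = -u) ∧ ∀ x u v, metricAt g x u v = Ω.form x ![u, J x v]

/-- The Gram matrix of the metric in the basis `stdB` of the tangent space at `x`. -/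
def gram (g : Metric n M) (x : M) : Matrix (Fin (2 * n)) (Fin (2 * n)) ℝ :=
  Matrix.of fun i j => metricAt g x (stdB i) (stdB j)

/-- The basis of the tangent space at `x` that is `g`-dual to `stdB`:
`g(dualB i, stdB j) = δ_ij`. -/
def dualB (g : Metric n M) (x : M) (i : Fin (2 * n)) : Model n :=
  ∑ j, (gram g x)⁻¹ i j • stdB j

/-- The Gram matrix of the coordinate vector fields of the preferred chart at `x₀`. -/
def coordGram (g : Metric n M) (x₀ : M) (y : Model n) : Matrix (Fin (2 * n)) (Fin (2 * n)) ℝ :=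
  Matrix.of fun i j => metricAt g ((chartAt (Model n) x₀).symm y)
    (chartSymmDeriv x₀ y (stdB i)) (chartSymmDeriv x₀ y (stdB j))

/-- The Riemannian measure on the domain of the preferred chart at `x₀` (extended by zero):
in coordinates it has the density `√(det g_ij)` with respect to Lebesgue measure. -/
def chartVolume [MeasurableSpace M] (g : Metric n M) (x₀ : M) : Measure M :=
  Measure.map ((chartAt (Model n) x₀).symm : Model n → M)
    (((volume : Measure (Model n)).restrict (chartAt (Model n) x₀).target).withDensity
      fun y => ENNReal.ofReal (Real.sqrt (coordGram g x₀ y).det))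

/-- The Riemannian volume measure of `g`. The measures `chartVolume g x₀` agree on the overlaps of
chart domains, and the volume measure is the measure obtained by gluing them, which is their
supremum in the lattice of measures. -/
def riemVolume [MeasurableSpace M] (g : Metric n M) : Measure M := ⨆ x₀ : M, chartVolume g x₀

/-- The determinant with respect to the basis `stdB`, as a form of top degree. -/
def detForm (n : ℕ) : (Model n) [⋀^Fin (2 * n)]→L[ℝ] ℝ where
  toFun v := (EuclideanSpace.basisFun (Fin (2 * n)) ℝ).toBasis.det v
  map_update_add' v i a b := AlternatingMap.map_update_add _ v i a b
  map_update_smul' v i c a := AlternatingMap.map_update_smul _ v i c a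
  map_eq_zero_of_eq' v _ _ h hij := AlternatingMap.map_eq_zero_of_eq _ v h hij
  cont := by
    have h : ∀ v : Fin (2 * n) → Model n,
        (EuclideanSpace.basisFun (Fin (2 * n)) ℝ).toBasis.det v
          = (Matrix.of fun i j => v j i).det := fun v => by
      rw [Module.Basis.det_apply]
      congr 1
    simp only [h]
    fun_prop

/-- The value of `Ω ^ n / n!` on the basis `stdB` (the Pfaffian of the matrix of `Ω`). -/
def pfaffian (Ω : SymplecticForm n M) (x : M) : ℝ :=
  (1 / (2 ^ n * (n.factorial : ℝ))) * ∑ σ : Equiv.Perm (Fin (2 * n)),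
    ((Equiv.Perm.sign σ : ℤ) : ℝ) * ∏ i : Fin n,
      Ω.form x ![stdB (σ ⟨2 * (i : ℕ), by omega⟩), stdB (σ ⟨2 * (i : ℕ) + 1, by omega⟩)]

/-- The volume form `Ω ^ n / n!`. For a compatible metric it is the Riemannian volume form for the
orientation defined by `Ω`. -/
def volForm (Ω : SymplecticForm n M) (x : M) : (Model n) [⋀^Fin (2 * n)]→L[ℝ] ℝ :=
  pfaffian Ω x • detForm n

end Geometry

/-! ### Pointwise operations on forms -/

section Pointwise

lemma append_update {X : Type*} {k l : ℕ} [DecidableEq (Fin l)] [DecidableEq (Fin (k + l))]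
    (u : Fin k → X) (v : Fin l → X) (i : Fin l) (a : X) :
    Fin.append u (Function.update v i a)
      = Function.update (Fin.append u v) (Fin.natAdd k i) a := by
  funext j
  refine Fin.addCases (fun j => ?_) (fun j => ?_) j
  · rw [Fin.append_left, Function.update_of_ne, Fin.append_left]
    intro h
    have := congrArg Fin.val h
    simp at this
    omega
  · rw [Fin.append_right]
    by_cases h : j = i
    · subst h; simp
    · rw [Function.update_of_ne h, Function.update_of_ne, Fin.append_right]
      intro h2
      apply h
      have := congrArg Fin.val h2
      simp at this
      exact Fin.ext this

/-- Insertion of the vectors `u` in the first `k` places of a form of degree `k + l`. -/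
def insertFirst {E : Type*} [NormedAddCommGroup E] [NormedSpace ℝ E] {k l m : ℕ} (h : k + l = m)
    (θ : E [⋀^Fin m]→L[ℝ] ℝ) (u : Fin k → E) : E [⋀^Fin l]→L[ℝ] ℝ where
  toFun v := θ (Fin.append u v ∘ Fin.cast h.symm)
  map_update_add' v i a b := by
    subst h
    simp only [Fin.cast_refl, Function.comp_id, append_update]
    exact θ.map_update_add (Fin.append u v) (Fin.natAdd k i) a b
  map_update_smul' v i c a := by
    subst h
    simp only [Fin.cast_refl, Function.comp_id, append_update]
    exact θ.map_update_smul (Fin.append u v) (Fin.natAdd k i) c a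
  map_eq_zero_of_eq' v i j hv hij := by
    subst h
    refine θ.map_eq_zero_of_eq _ (i := Fin.natAdd k i) (j := Fin.natAdd k j) ?_ ?_
    · simpa using hv
    · simpa using hij
  cont := by
    subst h
    refine θ.cont.comp (continuous_pi fun j => ?_)
    refine Fin.addCases (fun j => ?_) (fun j => ?_) j
    · simpa using continuous_const
    · simpa using continuous_apply j

variable {n : ℕ} {M : Type*} [TopologicalSpace M] [ChartedSpace (Model n) M]
  [IsManifold 𝓘(ℝ, Model n) ∞ M]
  {V : Type*} [NormedAddCommGroup V] [NormedSpace ℝ V]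

/-- The Hodge star of a `V`-valued `k`-form at `x`, `k + l = 2 n`:
`(⋆α)(v₁, …, v_l) = (1 / k!) ∑_{i₁, …, i_k} vol(e^{i₁}, …, e^{i_k}, v₁, …, v_l) α(e_{i₁}, …, e_{i_k})`
where `e = stdB` and `(e^i) = dualB` is the `g`-dual basis. This does not depend on the basis, and
`α ∧ ⋆β = ⟨α, β⟩ vol`. -/
def hodge (Ω : SymplecticForm n M) (g : Metric n M) {k l : ℕ} (h : k + l = 2 * n) (x : M)
    (α : (Model n) [⋀^Fin k]→L[ℝ] V) : (Model n) [⋀^Fin l]→L[ℝ] V :=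
  (1 / (k.factorial : ℝ)) • ∑ f : Fin k → Fin (2 * n),
    (insertFirst h (volForm Ω x) fun a => dualB g x (f a)).smulRight (α fun a => stdB (f a))

/-- The scalar product at `x` of two `V`-valued `k`-forms induced by `g` and by a bilinear form `κ`
on `V`: `(1 / k!) ∑_{i₁, …, i_k} κ(α(e_{i₁}, …, e_{i_k}), β(e^{i₁}, …, e^{i_k}))`. -/
def formInner (g : Metric n M) (κ : V →L[ℝ] V →L[ℝ] ℝ) {k : ℕ} (x : M)
    (α β : (Model n) [⋀^Fin k]→L[ℝ] V) : ℝ :=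
  (1 / (k.factorial : ℝ)) * ∑ f : Fin k → Fin (2 * n),
    κ (α fun a => stdB (f a)) (β fun a => dualB g x (f a))

/-- The dual Lefschetz operator `Λ` on 2-forms, i.e. the pointwise adjoint of `Φ ↦ Φ Ω`. -/
def lefschetzDual (Ω : SymplecticForm n M) (g : Metric n M) (x : M)
    (α : (Model n) [⋀^Fin 2]→L[ℝ] V) : V :=
  (1 / 2 : ℝ) • ∑ i, ∑ j, Ω.form x ![stdB i, stdB j] • α ![dualB g x i, dualB g x j]

/-- The component `Φ` in the Lefschetz decomposition `α = α_p + Φ Ω` of a 2-form, with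
`Λ α_p = 0`; it is `Λ α / n` because `Λ Ω = n`. -/
def lefschetzComponent (Ω : SymplecticForm n M) (g : Metric n M) (x : M)
    (α : (Model n) [⋀^Fin 2]→L[ℝ] V) : V :=
  (1 / (n : ℝ)) • lefschetzDual Ω g x α

/-- The projection `Π` of a 2-form to its primitive component `α_p = α - Φ Ω`. -/
def primPart (Ω : SymplecticForm n M) (g : Metric n M) (x : M)
    (α : (Model n) [⋀^Fin 2]→L[ℝ] V) : (Model n) [⋀^Fin 2]→L[ℝ] V :=
  α - (Ω.form x).smulRight (lefschetzComponent Ω g x α)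

end Pointwise

/-! ### The Lie algebra of the structure group

The Lie algebra `GroupLieAlgebra 𝓘(ℝ, 𝔤) G` of a Lie group `G` modelled on `𝔤`, the tangent space
of `G` at `1`, is the vector space `𝔤`. -/

section LieAlg

lemma oneForm_add {𝔤 : Type*} [NormedAddCommGroup 𝔤] [NormedSpace ℝ 𝔤] {E : Type*} [NormedAddCommGroup E] [NormedSpace ℝ E]
    (α : E [⋀^Fin 1]→L[ℝ] 𝔤) (v w : E) : α ![v + w] = α ![v] + α ![w] := by
  have h := α.map_update_add (fun _ => 0) 0 v w
  have e : ∀ u : E, Function.update (fun _ : Fin 1 => (0 : E)) 0 u = ![u] := fun u => by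
    funext i; fin_cases i; simp
  simpa only [e] using h

lemma oneForm_smul {𝔤 : Type*} [NormedAddCommGroup 𝔤] [NormedSpace ℝ 𝔤] {E : Type*} [NormedAddCommGroup E] [NormedSpace ℝ E]
    (α : E [⋀^Fin 1]→L[ℝ] 𝔤) (c : ℝ) (v : E) : α ![c • v] = c • α ![v] := by
  have h := α.map_update_smul (fun _ => 0) 0 c v
  have e : ∀ u : E, Function.update (fun _ : Fin 1 => (0 : E)) 0 u = ![u] := fun u => by
    funext i; fin_cases i; simp
  simpa only [e] using h

variable {𝔤 : Type*} [NormedAddCommGroup 𝔤] [NormedSpace ℝ 𝔤] [FiniteDimensional ℝ 𝔤]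
  (G : Type*) [TopologicalSpace G] [ChartedSpace 𝔤 G] [Group G] [LieGroup 𝓘(ℝ, 𝔤) ∞ G]

/-- The Lie bracket on the Lie algebra of `G`. -/
def lieBracket (v w : GroupLieAlgebra 𝓘(ℝ, 𝔤) G) : GroupLieAlgebra 𝓘(ℝ, 𝔤) G := ⁅v, w⁆

/-- The Lie bracket on the Lie algebra of `G`, as a continuous bilinear map. -/
def lieBr : 𝔤 →L[ℝ] 𝔤 →L[ℝ] 𝔤 :=
  haveI : LieGroup 𝓘(ℝ, 𝔤) (minSmoothness ℝ 3) G := by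
    rw [minSmoothness_of_isRCLikeNormedField]; infer_instance
  haveI : CompleteSpace 𝔤 := FiniteDimensional.complete ℝ 𝔤
  LinearMap.toContinuousLinearMap
    { toFun := fun v => LinearMap.toContinuousLinearMap
        { toFun := fun w => lieBracket G v w
          map_add' := fun a b => lie_add (L := GroupLieAlgebra 𝓘(ℝ, 𝔤) G)
            (M := GroupLieAlgebra 𝓘(ℝ, 𝔤) G) v a b
          map_smul' := fun c a => lie_smul (R := ℝ) (L := GroupLieAlgebra 𝓘(ℝ, 𝔤) G)
            (M := GroupLieAlgebra 𝓘(ℝ, 𝔤) G) c v a }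
      map_add' := fun a b => by
        ext w
        exact add_lie (L := GroupLieAlgebra 𝓘(ℝ, 𝔤) G) (M := GroupLieAlgebra 𝓘(ℝ, 𝔤) G) a b w
      map_smul' := fun c a => by
        ext w
        exact smul_lie (R := ℝ) (L := GroupLieAlgebra 𝓘(ℝ, 𝔤) G)
          (M := GroupLieAlgebra 𝓘(ℝ, 𝔤) G) c a w }

/-- The adjoint action of `a ∈ G` on the Lie algebra: the derivative of `h ↦ a h a⁻¹` at `1`. -/
def lieAd {G : Type*} [TopologicalSpace G] [ChartedSpace 𝔤 G] [Group G] (a : G) : 𝔤 →L[ℝ] 𝔤 :=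
  mfderiv 𝓘(ℝ, 𝔤) 𝓘(ℝ, 𝔤) (fun h : G => a * h * a⁻¹) (1 : G)

/-- An `Ad`-invariant inner product on the Lie algebra of `G`. -/
structure InvariantInner (𝔤 : Type*) [NormedAddCommGroup 𝔤] [NormedSpace ℝ 𝔤]
    (G : Type*) [TopologicalSpace G] [ChartedSpace 𝔤 G] [Group G] where
  form : 𝔤 →L[ℝ] 𝔤 →L[ℝ] ℝ
  symm : ∀ v w, form v w = form w v
  pos : ∀ v, v ≠ 0 → 0 < form v v
  invariant : ∀ (a : G) v w, form (lieAd a v) (lieAd a w) = form v w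

variable {E : Type*} [NormedAddCommGroup E] [NormedSpace ℝ E] [FiniteDimensional ℝ E]

/-- The bracket `[α, β]` of a `𝔤`-valued 1-form and a `𝔤`-valued `k`-form, at a point:
`[α, β](v₀, …, v_k) = ∑ᵢ (-1)ⁱ [α(vᵢ), β(v₀, …, v̂ᵢ, …, v_k)]`. -/
def bracketLeft {k : ℕ} (α : E [⋀^Fin 1]→L[ℝ] 𝔤) (β : E [⋀^Fin k]→L[ℝ] 𝔤) :
    E [⋀^Fin (k + 1)]→L[ℝ] 𝔤 :=
  ContinuousAlternatingMap.alternatizeUncurryFin <| LinearMap.toContinuousLinearMap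
    { toFun := fun v => (lieBr G (α ![v])).compContinuousAlternatingMap β
      map_add' := fun v w => by
        ext m
        simp [oneForm_add]
      map_smul' := fun c v => by
        ext m
        simp [oneForm_smul] }

/-- The bracket `[β, α]` of a `𝔤`-valued `k`-form and a `𝔤`-valued 1-form, at a point:
`[β, α](v₀, …, v_k) = (-1)ᵏ ∑ᵢ (-1)ⁱ [β(v₀, …, v̂ᵢ, …, v_k), α(vᵢ)]`. -/
def bracketRight {k : ℕ} (β : E [⋀^Fin k]→L[ℝ] 𝔤) (α : E [⋀^Fin 1]→L[ℝ] 𝔤) :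
    E [⋀^Fin (k + 1)]→L[ℝ] 𝔤 :=
  (-1 : ℝ) ^ k • (ContinuousAlternatingMap.alternatizeUncurryFin <| LinearMap.toContinuousLinearMap
    { toFun := fun v => ((lieBr G).flip (α ![v])).compContinuousAlternatingMap β
      map_add' := fun v w => by
        ext m
        simp [oneForm_add]
      map_smul' := fun c v => by
        ext m
        simp [oneForm_smul] })

end LieAlg

/-! ### Principal bundles, connections and `Ad P`-valued forms -/

/-- A smooth principal `G`-bundle `P` over `M`, given by trivializations over an open cover
`baseSet i`, i.e. by smooth local sections `s_i`, and by the smooth transition functions `g_ij`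
with `s_j = s_i g_ij`. -/
structure PrincipalBundle (ι : Type*) (E : Type*) [NormedAddCommGroup E] [NormedSpace ℝ E]
    (M : Type*) [TopologicalSpace M] [ChartedSpace E M]
    (𝔤 : Type*) [NormedAddCommGroup 𝔤] [NormedSpace ℝ 𝔤]
    (G : Type*) [TopologicalSpace G] [ChartedSpace 𝔤 G] [Group G] where
  baseSet : ι → Set M
  isOpen_baseSet : ∀ i, IsOpen (baseSet i)
  indexAt : M → ι
  mem_baseSet_at : ∀ x, x ∈ baseSet (indexAt x)
  transition : ι → ι → M → G
  smooth : ∀ i j, ContMDiffOn 𝓘(ℝ, E) 𝓘(ℝ, 𝔤) ∞ (transition i j) (baseSet i ∩ baseSet j)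
  cocycle : ∀ i j k, ∀ x ∈ baseSet i ∩ baseSet j ∩ baseSet k,
    transition i j x * transition j k x = transition i k x

namespace PrincipalBundle

variable {ι : Type*} {E : Type*} [NormedAddCommGroup E] [NormedSpace ℝ E]
  {M : Type*} [TopologicalSpace M] [ChartedSpace E M]
  {𝔤 : Type*} [NormedAddCommGroup 𝔤] [NormedSpace ℝ 𝔤]
  {G : Type*} [TopologicalSpace G] [ChartedSpace 𝔤 G] [Group G]

/-- The underlying fibre bundle: its total space is obtained by gluing the products
`baseSet i × G` along left multiplication by the transition functions. -/
def toFiberBundleCore [LieGroup 𝓘(ℝ, 𝔤) ∞ G] (P : PrincipalBundle ι E M 𝔤 G) :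
    FiberBundleCore ι M G where
  baseSet := P.baseSet
  isOpen_baseSet := P.isOpen_baseSet
  indexAt := P.indexAt
  mem_baseSet_at := P.mem_baseSet_at
  coordChange i j x h := P.transition j i x * h
  coordChange_self i x hx v := by
    have h := P.cocycle i i i x ⟨⟨hx, hx⟩, hx⟩
    rw [mul_eq_left.mp h, one_mul]
  continuousOn_coordChange i j := by
    have : IsTopologicalGroup G := topologicalGroup_of_lieGroup 𝓘(ℝ, 𝔤) ∞
    refine ContinuousOn.mul ?_ continuousOn_snd
    exact (P.smooth j i).continuousOn.comp continuousOn_fst fun p hp => ⟨hp.1.2, hp.1.1⟩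
  coordChange_comp i j k x hx v := by
    rw [← mul_assoc, P.cocycle k j i x ⟨⟨hx.2, hx.1.2⟩, hx.1.1⟩]

/-- Families of local `𝔤`-valued `k`-forms, one for each local section `s_i`. Only the values of
the `i`-th form on `baseSet i` are meaningful. -/
abbrev LocalForms (_P : PrincipalBundle ι E M 𝔤 G) (k : ℕ) : Type _ :=
  ι → M → E [⋀^Fin k]→L[ℝ] 𝔤

/-- The family `η` represents a smooth `k`-form with values in `Ad P`: in each trivialization it
is a smooth form, and `η_j = Ad(g_ij⁻¹) η_i` on overlaps. -/
def IsAdForm (P : PrincipalBundle ι E M 𝔤 G) {k : ℕ} (η : P.LocalForms k) : Prop :=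
  (∀ i, SmoothFormOn (η i) (P.baseSet i)) ∧
  ∀ i j, ∀ x ∈ P.baseSet i ∩ P.baseSet j, ∀ v,
    η j x v = lieAd (P.transition i j x)⁻¹ (η i x v)

/-- The `𝔤`-valued 1-form `f⁻¹ df` of a map `f : M → G`: the value at `x` is the derivative at `x`
of `y ↦ f(x)⁻¹ f(y)`. -/
def gaugeTerm (f : M → G) (x : M) : E →L[ℝ] 𝔤 :=
  mfderiv 𝓘(ℝ, E) 𝓘(ℝ, 𝔤) (fun y => (f x)⁻¹ * f y) x

/-- The family `A` represents a smooth connection: `A_i` is the pullback of the connection 1-form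
by `s_i`, and `A_j = Ad(g_ij⁻¹) A_i + g_ij⁻¹ d g_ij` on overlaps. -/
def IsConnection (P : PrincipalBundle ι E M 𝔤 G) (A : P.LocalForms 1) : Prop :=
  (∀ i, SmoothFormOn (A i) (P.baseSet i)) ∧
  ∀ i j, ∀ x ∈ P.baseSet i ∩ P.baseSet j, ∀ v : E,
    A j x ![v] = lieAd (P.transition i j x)⁻¹ (A i x ![v]) +
      gaugeTerm (P.transition i j) x v

/-- The form represented by `η` vanishes outside a compact set. (This holds automatically when `M`
is compact.) -/
def HasCompactSupport (P : PrincipalBundle ι E M 𝔤 G) {k : ℕ} (η : P.LocalForms k) : Prop :=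
  ∃ K : Set M, IsCompact K ∧ ∀ x ∉ K, ∀ i, x ∈ P.baseSet i → η i x = 0

variable [FiniteDimensional ℝ E] [FiniteDimensional ℝ 𝔤] [LieGroup 𝓘(ℝ, 𝔤) ∞ G]

/-- The exterior covariant derivative `d_A η`, locally `dη_i + [A_i, η_i]`. -/
def covD (P : PrincipalBundle ι E M 𝔤 G) (A : P.LocalForms 1) {k : ℕ} (η : P.LocalForms k) :
    P.LocalForms (k + 1) :=
  fun i x => extD (η i) x + bracketLeft G (A i x) (η i x)

/-- The curvature `F(A)`, locally `dA_i + ½ [A_i, A_i]`. -/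
def curvature (P : PrincipalBundle ι E M 𝔤 G) (A : P.LocalForms 1) : P.LocalForms 2 :=
  fun i x => extD (A i) x + (1 / 2 : ℝ) • bracketLeft G (A i x) (A i x)

/-- The bracket `[β, η]` of an `Ad P`-valued `k`-form and an `Ad P`-valued 1-form. -/
def bracket (P : PrincipalBundle ι E M 𝔤 G) {k : ℕ} (β : P.LocalForms k) (η : P.LocalForms 1) :
    P.LocalForms (k + 1) :=
  fun i x => bracketRight G (β i x) (η i x)

end PrincipalBundle

/-! ### The primitive Yang-Mills functional -/

namespace PrincipalBundle

variable {n : ℕ} {M : Type*} [TopologicalSpace M] [ChartedSpace (Model n) M]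
  [IsManifold 𝓘(ℝ, Model n) ∞ M]
  {ι : Type*} {𝔤 : Type*} [NormedAddCommGroup 𝔤] [NormedSpace ℝ 𝔤]
  {G : Type*} [TopologicalSpace G] [ChartedSpace 𝔤 G] [Group G]
  (P : PrincipalBundle ι (Model n) M 𝔤 G) (Ω : SymplecticForm n M) (g : Metric n M)
  (κ : InvariantInner 𝔤 G)

/-- The Hodge star of an `Ad P`-valued `k`-form, an `Ad P`-valued `l`-form with `k + l = 2 n`. -/
def star {k l : ℕ} (h : k + l = 2 * n) (η : P.LocalForms k) : P.LocalForms l :=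
  fun i x => hodge Ω g h x (η i x)

/-- The pointwise scalar product of two `Ad P`-valued forms, as a function on `M`. It does not
depend on the local section used, because `κ` is `Ad`-invariant. -/
def innerAt {k : ℕ} (α β : P.LocalForms k) (x : M) : ℝ :=
  formInner g κ.form x (α (P.indexAt x) x) (β (P.indexAt x) x)

/-- The scalar product `⟨α, β⟩ = ∫_M α ∧ ⋆β` of two `Ad P`-valued forms, i.e. the integral of their
pointwise scalar product. -/
def innerL2 [MeasurableSpace M] {k : ℕ} (α β : P.LocalForms k) : ℝ :=
  ∫ x, P.innerAt g κ α β x ∂(riemVolume g)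

/-- The primitive component of an `Ad P`-valued 2-form. -/
def prim (α : P.LocalForms 2) : P.LocalForms 2 := fun i x => primPart Ω g x (α i x)

variable [FiniteDimensional ℝ 𝔤] [LieGroup 𝓘(ℝ, 𝔤) ∞ G]

/-- The covariant codifferential `d_A^* = -⋆ d_A ⋆`, from `(k+1)`-forms to `k`-forms, on a manifold
of even dimension `2 n = (k + 1) + l`. -/
def covCodiff {k l : ℕ} (h : k + 1 + l = 2 * n) (A : P.LocalForms 1) (β : P.LocalForms (k + 1)) :
    P.LocalForms k :=
  -P.star Ω g (show l + 1 + k = 2 * n by omega) (P.covD A (P.star Ω g h β))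

/-- `∂_{+A} η = Π (d_A η)` for an `Ad P`-valued 1-form `η`. -/
def dPlus (A : P.LocalForms 1) (η : P.LocalForms 1) : P.LocalForms 2 :=
  P.prim Ω g (P.covD A η)

/-- The primitive part `F_p(A)` of the curvature. -/
def curvaturePrim (A : P.LocalForms 1) : P.LocalForms 2 := P.prim Ω g (P.curvature A)

/-- `F_p(A)` is square integrable. (This holds automatically when `M` is compact.) -/
def FiniteAction [MeasurableSpace M] (A : P.LocalForms 1) : Prop :=
  Integrable (P.innerAt g κ (P.curvaturePrim Ω g A) (P.curvaturePrim Ω g A)) (riemVolume g)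

/-- The primitive Yang-Mills functional `S(A) = ‖F_p(A)‖²`. -/
def action [MeasurableSpace M] (A : P.LocalForms 1) : ℝ :=
  P.innerL2 g κ (P.curvaturePrim Ω g A) (P.curvaturePrim Ω g A)

/-- `A` is a critical point of the primitive Yang-Mills functional: the derivative of the functional
at `A` vanishes in the direction of each compactly supported `Ad P`-valued 1-form. -/
def IsCriticalPoint [MeasurableSpace M] (A : P.LocalForms 1) : Prop :=
  ∀ η : P.LocalForms 1, P.IsAdForm η → P.HasCompactSupport η →
    HasDerivAt (fun t : ℝ => P.action Ω g κ (A + t • η)) 0 0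

/-- The quadratic form defined by the Hessian of the functional `S` at `A`, i.e. the second order
term of `S` at `A`: `Q_p(η, η) = ½ (d²/dt²) S(A + t η)` at `t = 0`. -/
def hessianForm [MeasurableSpace M] (A : P.LocalForms 1) (η : P.LocalForms 1) : ℝ :=
  (1 / 2) * iteratedDeriv 2 (fun t : ℝ => P.action Ω g κ (A + t • η)) 0

/-- The operator `η ↦ d_A^* ∂_{+A} η + ⋆[⋆F_p(A), η]` on `Ad P`-valued 1-forms. -/
def hessianOp (hn : 2 ≤ n) (A : P.LocalForms 1) (η : P.LocalForms 1) : P.LocalForms 1 :=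
  P.covCodiff Ω g (show 1 + 1 + (2 * n - 2) = 2 * n by omega) A (P.dPlus Ω g A η) +
    P.star Ω g (show 2 * n - 2 + 1 + 1 = 2 * n by omega)
      (P.bracket (P.star Ω g (show 2 + (2 * n - 2) = 2 * n by omega) (P.curvaturePrim Ω g A)) η)

end PrincipalBundle

end PrimYM

end

open PrimYM

/-!
The identity compares two expressions for the second order term of the functional along the line
`A + t η`.

The curvature is quadratic along the line: `F(A + t η) = F(A) + t d_A η + t² ½ [η, η]`
(`IsConnection.curvature_add_smul`). Since `Π` is linear, the density `|F_p(A + t η)|²` is a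
polynomial of degree four in `t` (`innerAt_curvaturePrim_add_smul`), and its coefficients other than
`|F_p(A)|²` are continuous functions of compact support. Hence the functional is a polynomial in
`t`, and half its second derivative at `0` is the integral of `|∂_{+A} η|² + 2 ⟨F_p, Π(½ [η, η])⟩`.

On the other side, `Π` is an orthogonal projection (`IsCompatible.formInner_primPart_right`, from
`Λ ω = n`), so that `2 ⟨F_p, Π(½ [η, η])⟩ = ⟨F_p, [η, η]⟩`, and the latter is `⟨⋆[⋆F_p, η], η⟩`
pointwise, by the invariance of the inner product under the bracket
(`formInner_hodge_bracketRight`).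
Likewise `|∂_{+A} η|² = ⟨∂_{+A} η, d_A η⟩`, which differs from `⟨d_A^* ∂_{+A} η, η⟩` by a divergence
(`innerAt_covCodiff`): the exterior derivative of the contraction of the volume form with the vector
field `⟨∂_{+A} η, η⟩` (`fluxForm`). Its integral vanishes by Stokes' theorem
(`integral_topDiv_eq_zero`).

The computations with the Hodge star use dual frames: contractions with a frame and its `g`-dual do
not depend on the frame (`IsDualFrame.sum_sum_bilin`), so the same formulas hold in the basis of a
tangent space and in the coordinate frame of a chart. All signs and factors enter through
`IsCompatible.formInner_hodge`, which evaluates `⋆` on alternated expressions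
`½ ∑ det(eᵢ, eⱼ, ·) ⊗ C_ij`;
it needs that the square of the Pfaffian of `ω` is the determinant of the metric
(`IsCompatible.pfaffian_sq`), which is read off from a unitary basis.

Two facts make the objects global. The integrands do not depend on the local sections: the
curvature is `Ad`-covariant by the Maurer-Cartan equation (`IsConnection.isAdForm_curvature`), and,
as `F(A + t η)` is covariant for all `t`, so are `d_A η` and `½ [η, η]`. The Riemannian measure
restricts to each chart domain as the measure with density `√(det g_ij)` (`restrict_riemVolume`), by
the change of variables formula; this reduces Stokes' theorem, through a partition of unity, to the
vanishing of integrals of derivatives on the model space.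
-/

namespace PrimYM

/-! ### Charts and coordinate expressions -/

section Charts

variable {E : Type*} [NormedAddCommGroup E] [NormedSpace ℝ E]
  {M : Type*} [TopologicalSpace M] [ChartedSpace E M]
  {E' : Type*} [NormedAddCommGroup E'] [NormedSpace ℝ E']
  {M' : Type*} [TopologicalSpace M'] [ChartedSpace E' M']
  {V : Type*} [NormedAddCommGroup V] [NormedSpace ℝ V] {k : ℕ}

/-- Without boundary, the manifold derivative is the derivative of the expression in the preferred
charts. -/
lemma mfderiv_eq_fderiv_chart {f : M → M'} {x : M} (hf : MDifferentiableAt 𝓘(ℝ, E) 𝓘(ℝ, E') f x) :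
    (mfderiv 𝓘(ℝ, E) 𝓘(ℝ, E') f x : E →L[ℝ] E') =
      fderiv ℝ (fun y => chartAt E' (f x) (f ((chartAt E x).symm y))) (chartAt E x x) := by
  refine hf.mfderiv.trans ?_
  simp only [modelWithCornersSelf_coe, Set.range_id, fderivWithin_univ]
  rfl

lemma mfderiv_eq_fderiv_chart_left {f : E → M'} {y : E}
    (hf : MDifferentiableAt 𝓘(ℝ, E) 𝓘(ℝ, E') f y) :
    (mfderiv 𝓘(ℝ, E) 𝓘(ℝ, E') f y : E →L[ℝ] E') =
      fderiv ℝ (fun z => chartAt E' (f y) (f z)) y := by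
  rw [mfderiv_eq_fderiv_chart hf]
  rfl

lemma SmoothFormOn.contDiffAt {α : M → E [⋀^Fin k]→L[ℝ] V} {U : Set M} (h : SmoothFormOn α U)
    (hU : IsOpen U) (x₀ : M) {y : E} (hy : y ∈ (chartAt E x₀).target)
    (hyU : (chartAt E x₀).symm y ∈ U) : ContDiffAt ℝ ∞ (coordForm α x₀) y := by
  refine (h x₀).contDiffAt (Filter.inter_mem ((chartAt E x₀).open_target.mem_nhds hy) ?_)
  exact ((chartAt E x₀).continuousAt_symm hy).preimage_mem_nhds (hU.mem_nhds hyU)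

lemma smoothFormOn_of_contDiffAt {α : M → E [⋀^Fin k]→L[ℝ] V} {U : Set M}
    (h : ∀ x₀ : M, ∀ y ∈ (chartAt E x₀).target, (chartAt E x₀).symm y ∈ U →
      ContDiffAt ℝ ∞ (coordForm α x₀) y) : SmoothFormOn α U :=
  fun x₀ y hy => (h x₀ y hy.1 hy.2).contDiffWithinAt

variable [IsManifold 𝓘(ℝ, E) ∞ M]

lemma mdifferentiableAt_chart_symm (x₀ : M) {y : E} (hy : y ∈ (chartAt E x₀).target) :
    MDifferentiableAt 𝓘(ℝ, E) 𝓘(ℝ, E) ((chartAt E x₀).symm : E → M) y :=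
  haveI : IsManifold 𝓘(ℝ, E) 1 M := IsManifold.of_le (n := ∞) (by simp)
  mdifferentiableAt_atlas_symm (chart_mem_atlas E x₀) hy

lemma mdifferentiableAt_chart (x₀ : M) {x : M} (hx : x ∈ (chartAt E x₀).source) :
    MDifferentiableAt 𝓘(ℝ, E) 𝓘(ℝ, E) (chartAt E x₀ : M → E) x :=
  haveI : IsManifold 𝓘(ℝ, E) 1 M := IsManifold.of_le (n := ∞) (by simp)
  mdifferentiableAt_atlas (chart_mem_atlas E x₀) hx

lemma contDiffAt_chart_transition (x₀ x₁ : M) {y : E} (hy : y ∈ (chartAt E x₀).target)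
    (hy' : (chartAt E x₀).symm y ∈ (chartAt E x₁).source) :
    ContDiffAt ℝ ∞ (fun z => chartAt E x₁ ((chartAt E x₀).symm z)) y := by
  rw [← contMDiffAt_iff_contDiffAt]
  have h1 : ContMDiffAt 𝓘(ℝ, E) 𝓘(ℝ, E) ∞ ((chartAt E x₀).symm : E → M) y :=
    (contMDiffOn_chart_symm (I := 𝓘(ℝ, E)) (n := ∞)).contMDiffAt
      ((chartAt E x₀).open_target.mem_nhds hy)
  have h2 : ContMDiffAt 𝓘(ℝ, E) 𝓘(ℝ, E) ∞ (chartAt E x₁ : M → E) ((chartAt E x₀).symm y) :=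
    (contMDiffOn_chart (I := 𝓘(ℝ, E)) (n := ∞)).contMDiffAt
      ((chartAt E x₁).open_source.mem_nhds hy')
  exact h2.comp y h1

lemma mfderiv_chart_self (x : M) :
    (mfderiv 𝓘(ℝ, E) 𝓘(ℝ, E) (chartAt E x : M → E) x : E →L[ℝ] E) = .id ℝ E := by
  rw [mfderiv_eq_fderiv_chart (mdifferentiableAt_chart x (mem_chart_source E x))]
  have : (fun y => chartAt E (chartAt E x x) (chartAt E x ((chartAt E x).symm y)))
      =ᶠ[𝓝 (chartAt E x x)] id := by
    filter_upwards [(chartAt E x).open_target.mem_nhds (mem_chart_target E x)] with y hy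
    exact (chartAt E x).right_inv hy
  rw [this.fderiv_eq, fderiv_id]

lemma chartSymmDeriv_eq_fderiv (x₀ : M) {y : E} (hy : y ∈ (chartAt E x₀).target) :
    chartSymmDeriv x₀ y =
      fderiv ℝ (fun z => chartAt E ((chartAt E x₀).symm y) ((chartAt E x₀).symm z)) y :=
  mfderiv_eq_fderiv_chart_left (mdifferentiableAt_chart_symm x₀ hy)

lemma chartSymmDeriv_self (x : M) : chartSymmDeriv x (chartAt E x x) = .id ℝ E := by
  rw [chartSymmDeriv_eq_fderiv x (mem_chart_target E x)]
  have : (fun z => chartAt E ((chartAt E x).symm (chartAt E x x)) ((chartAt E x).symm z))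
      =ᶠ[𝓝 (chartAt E x x)] id := by
    filter_upwards [(chartAt E x).open_target.mem_nhds (mem_chart_target E x)] with y hy
    simp [(chartAt E x).right_inv hy]
  rw [this.fderiv_eq, fderiv_id]

/-- Chain rule for a change of charts. -/
lemma chartSymmDeriv_comp_transition (x₀ x₁ : M) {y : E} (hy : y ∈ (chartAt E x₀).target)
    (hy' : (chartAt E x₀).symm y ∈ (chartAt E x₁).source) :
    chartSymmDeriv x₀ y =
      (chartSymmDeriv x₁ (chartAt E x₁ ((chartAt E x₀).symm y))).comp
        (fderiv ℝ (fun z => chartAt E x₁ ((chartAt E x₀).symm z)) y) := by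
  set p := (chartAt E x₀).symm y with hp
  have hp1 : chartAt E x₁ p ∈ (chartAt E x₁).target := (chartAt E x₁).map_source hy'
  rw [chartSymmDeriv_eq_fderiv x₀ hy, chartSymmDeriv_eq_fderiv x₁ hp1, (chartAt E x₁).left_inv hy',
    ← hp, ← fderiv_comp (𝕜 := ℝ) y
      (g := fun z => chartAt E p ((chartAt E x₁).symm z))
      (f := fun z => chartAt E x₁ ((chartAt E x₀).symm z))]
  · apply Filter.EventuallyEq.fderiv_eq
    have hc : ContinuousAt (chartAt E x₀).symm y := (chartAt E x₀).continuousAt_symm hy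
    filter_upwards [hc.preimage_mem_nhds ((chartAt E x₁).open_source.mem_nhds hy')] with z hz
    have hz' : (chartAt E x₀).symm z ∈ (chartAt E x₁).source := hz
    simp [(chartAt E x₁).left_inv hz']
  · refine (contDiffAt_chart_transition x₁ p hp1 ?_).differentiableAt (by simp)
    rw [(chartAt E x₁).left_inv hy']
    exact mem_chart_source E p
  · exact (contDiffAt_chart_transition x₀ x₁ hy hy').differentiableAt (by simp)

/-- The derivative of the inverse of a chart is invertible. -/
lemma exists_inverse_chartSymmDeriv (x₀ : M) {y : E} (hy : y ∈ (chartAt E x₀).target) :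
    ∃ S : E →L[ℝ] E, (chartSymmDeriv x₀ y).comp S = .id ℝ E ∧ S.comp (chartSymmDeriv x₀ y) =
      .id ℝ E := by
  set p := (chartAt E x₀).symm y with hp
  have hps : p ∈ (chartAt E x₀).source := (chartAt E x₀).map_target hy
  have h1 := chartSymmDeriv_comp_transition p x₀ (mem_chart_target E p)
    (by rw [(chartAt E p).left_inv (mem_chart_source E p)]; exact hps)
  rw [(chartAt E p).left_inv (mem_chart_source E p), chartSymmDeriv_self,
    (chartAt E x₀).right_inv hy] at h1
  refine ⟨_, h1.symm, ?_⟩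
  rw [chartSymmDeriv_eq_fderiv x₀ hy, ← hp, ← fderiv_comp (𝕜 := ℝ) y
    (g := fun z => chartAt E x₀ ((chartAt E p).symm z))
    (f := fun z => chartAt E p ((chartAt E x₀).symm z))]
  · have : ((fun z => chartAt E x₀ ((chartAt E p).symm z)) ∘
        fun z => chartAt E p ((chartAt E x₀).symm z)) =ᶠ[𝓝 y] id := by
      have hc : ContinuousAt (chartAt E x₀).symm y := (chartAt E x₀).continuousAt_symm hy
      filter_upwards [hc.preimage_mem_nhds ((chartAt E p).open_source.mem_nhds
        (mem_chart_source E p)), (chartAt E x₀).open_target.mem_nhds hy] with z hz hz2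
      have hz' : (chartAt E x₀).symm z ∈ (chartAt E p).source := hz
      simp [(chartAt E p).left_inv hz', (chartAt E x₀).right_inv hz2]
    rw [this.fderiv_eq, fderiv_id]
  · refine (contDiffAt_chart_transition p x₀ (mem_chart_target E p) ?_).differentiableAt (by simp)
    rw [(chartAt E p).left_inv (mem_chart_source E p)]
    exact hps
  · exact (contDiffAt_chart_transition x₀ p hy (mem_chart_source E p)).differentiableAt (by simp)

lemma coordForm_self (α : M → E [⋀^Fin k]→L[ℝ] V) (x : M) :
    coordForm α x (chartAt E x x) = α x := by
  rw [coordForm, chartSymmDeriv_self, (chartAt E x).left_inv (mem_chart_source E x)]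
  ext v; rfl

lemma extD_eq_extDeriv (α : M → E [⋀^Fin k]→L[ℝ] V) (x : M) :
    extD α x = extDeriv (coordForm α x) (chartAt E x x) := by
  rw [extD, mfderiv_chart_self]
  ext v; rfl

lemma coordForm_eventuallyEq_pullback (α : M → E [⋀^Fin k]→L[ℝ] V) (x₀ x₁ : M) {y : E}
    (hy : y ∈ (chartAt E x₀).target) (hy' : (chartAt E x₀).symm y ∈ (chartAt E x₁).source) :
    coordForm α x₀ =ᶠ[𝓝 y] fun z =>
      (coordForm α x₁ (chartAt E x₁ ((chartAt E x₀).symm z))).compContinuousLinearMap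
        (fderiv ℝ (fun z => chartAt E x₁ ((chartAt E x₀).symm z)) z) := by
  have hc : ContinuousAt (chartAt E x₀).symm y := (chartAt E x₀).continuousAt_symm hy
  filter_upwards [hc.preimage_mem_nhds ((chartAt E x₁).open_source.mem_nhds hy'),
    (chartAt E x₀).open_target.mem_nhds hy] with z hz hz2
  have hz' : (chartAt E x₀).symm z ∈ (chartAt E x₁).source := hz
  rw [coordForm, coordForm, (chartAt E x₁).left_inv hz',
    chartSymmDeriv_comp_transition x₀ x₁ hz2 hz']
  ext v; rfl

/-- The exterior derivative may be computed in any chart. -/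
lemma coordForm_extD {α : M → E [⋀^Fin k]→L[ℝ] V} (x₀ : M) {y : E}
    (hy : y ∈ (chartAt E x₀).target)
    (h : DifferentiableAt ℝ (coordForm α ((chartAt E x₀).symm y))
      (chartAt E ((chartAt E x₀).symm y) ((chartAt E x₀).symm y))) :
    coordForm (extD α) x₀ y = extDeriv (coordForm α x₀) y := by
  set p := (chartAt E x₀).symm y with hp
  rw [(coordForm_eventuallyEq_pullback α x₀ p hy (mem_chart_source E p)).extDeriv_eq,
    extDeriv_pullback (r := ∞)
      (f := fun z => chartAt E p ((chartAt E x₀).symm z)) h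
      (contDiffAt_chart_transition x₀ p hy (mem_chart_source E p))
      (by rw [minSmoothness_of_isRCLikeNormedField]; exact ENat.LEInfty.out), coordForm, ← hp,
    extD_eq_extDeriv, chartSymmDeriv_eq_fderiv x₀ hy]

lemma SmoothFormOn.coordForm_extD {α : M → E [⋀^Fin k]→L[ℝ] V} {U : Set M}
    (h : SmoothFormOn α U) (hU : IsOpen U) (x₀ : M) {y : E} (hy : y ∈ (chartAt E x₀).target)
    (hyU : (chartAt E x₀).symm y ∈ U) :
    coordForm (extD α) x₀ y = extDeriv (coordForm α x₀) y :=
  PrimYM.coordForm_extD x₀ hy <| (h.contDiffAt hU _ (mem_chart_target E _) (by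
    rwa [(chartAt E _).left_inv (mem_chart_source E _)])).differentiableAt (by simp)

lemma contDiffAt_extDeriv {α : E → E [⋀^Fin k]→L[ℝ] V} {y : E} (h : ContDiffAt ℝ ∞ α y) :
    ContDiffAt ℝ ∞ (extDeriv α) y := by
  have h1 : ContDiffAt ℝ ∞ (fderiv ℝ α) y := h.fderiv_right (by simp)
  exact (ContinuousAlternatingMap.alternatizeUncurryFinCLM ℝ E V).contDiff.contDiffAt.comp y h1

lemma SmoothFormOn.extD {α : M → E [⋀^Fin k]→L[ℝ] V} {U : Set M}
    (h : SmoothFormOn α U) (hU : IsOpen U) : SmoothFormOn (extD α) U := by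
  refine smoothFormOn_of_contDiffAt fun x₀ y hy hyU => ?_
  refine (contDiffAt_extDeriv (h.contDiffAt hU x₀ hy hyU)).congr_of_eventuallyEq ?_
  filter_upwards [(chartAt E x₀).open_target.mem_nhds hy,
    ((chartAt E x₀).continuousAt_symm hy).preimage_mem_nhds (hU.mem_nhds hyU)] with z hz hzU
  exact h.coordForm_extD hU x₀ hz hzU

end Charts

end PrimYM

noncomputable section

namespace PrimYM

/-! ### Lie groups in the chart at the identity -/

section LieGroupChart

variable {𝔤 : Type*} [NormedAddCommGroup 𝔤] [NormedSpace ℝ 𝔤]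
  (G : Type*) [TopologicalSpace G] [ChartedSpace 𝔤 G] [Group G]

/-- The coordinates of the identity in the preferred chart there. -/
def chartOne : 𝔤 := chartAt 𝔤 (1 : G) 1

/-- The multiplication of `G` in the preferred chart at `1`. -/
def mulChart (p : 𝔤 × 𝔤) : 𝔤 :=
  chartAt 𝔤 (1 : G) ((chartAt 𝔤 (1 : G)).symm p.1 * (chartAt 𝔤 (1 : G)).symm p.2)

/-- The inversion of `G` in the preferred chart at `1`. -/
def invChart (a : 𝔤) : 𝔤 := chartAt 𝔤 (1 : G) ((chartAt 𝔤 (1 : G)).symm a)⁻¹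

lemma chartOne_mem : chartOne G ∈ (chartAt 𝔤 (1 : G)).target := mem_chart_target 𝔤 (1 : G)

@[simp] lemma chart_symm_chartOne : (chartAt 𝔤 (1 : G)).symm (chartOne G) = 1 :=
  (chartAt 𝔤 (1 : G)).left_inv (mem_chart_source 𝔤 (1 : G))

lemma eventually_chart_symm_right_inv :
    ∀ᶠ a in 𝓝 (chartOne G : 𝔤), chartAt 𝔤 (1 : G) ((chartAt 𝔤 (1 : G)).symm a) = a := by
  filter_upwards [(chartAt 𝔤 (1 : G)).open_target.mem_nhds (chartOne_mem G)] with a ha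
  exact (chartAt 𝔤 (1 : G)).right_inv ha

lemma mulChart_chartOne_right {a : 𝔤} (ha : a ∈ (chartAt 𝔤 (1 : G)).target) :
    mulChart G (a, chartOne G) = a := by
  simp [mulChart, (chartAt 𝔤 (1 : G)).right_inv ha]

lemma mulChart_chartOne_left {a : 𝔤} (ha : a ∈ (chartAt 𝔤 (1 : G)).target) :
    mulChart G (chartOne G, a) = a := by
  simp [mulChart, (chartAt 𝔤 (1 : G)).right_inv ha]

@[simp] lemma invChart_chartOne : invChart G (chartOne G) = (chartOne G : 𝔤) := by
  simp [invChart]; rfl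

variable [LieGroup 𝓘(ℝ, 𝔤) ∞ G]

lemma contMDiffAt_chart_symm_one :
    ContMDiffAt 𝓘(ℝ, 𝔤) 𝓘(ℝ, 𝔤) ∞ ((chartAt 𝔤 (1 : G)).symm : 𝔤 → G) (chartOne G) :=
  (contMDiffOn_chart_symm (I := 𝓘(ℝ, 𝔤)) (n := ∞)).contMDiffAt
      ((chartAt 𝔤 (1 : G)).open_target.mem_nhds (chartOne_mem G))

lemma contMDiffAt_chart_one {a : G} (ha : a ∈ (chartAt 𝔤 (1 : G)).source) :
    ContMDiffAt 𝓘(ℝ, 𝔤) 𝓘(ℝ, 𝔤) ∞ (chartAt 𝔤 (1 : G) : G → 𝔤) a :=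
  (contMDiffOn_chart (I := 𝓘(ℝ, 𝔤)) (n := ∞)).contMDiffAt
      ((chartAt 𝔤 (1 : G)).open_source.mem_nhds ha)

lemma contDiffAt_mulChart : ContDiffAt ℝ ∞ (mulChart G) ((chartOne G, chartOne G) : 𝔤 × 𝔤) := by
  rw [← contMDiffAt_iff_contDiffAt]
  have h1 := contMDiffAt_chart_symm_one (𝔤 := 𝔤) G
  have h2 : ContMDiffAt 𝓘(ℝ, 𝔤 × 𝔤) 𝓘(ℝ, 𝔤) ∞
      (fun p : 𝔤 × 𝔤 => (chartAt 𝔤 (1 : G)).symm p.1 * (chartAt 𝔤 (1 : G)).symm p.2)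
      (chartOne G, chartOne G) :=
    (h1.comp (x := ((chartOne G, chartOne G) : 𝔤 × 𝔤))
      (contMDiffAt_iff_contDiffAt.2 contDiff_fst.contDiffAt)).mul
      (h1.comp (x := ((chartOne G, chartOne G) : 𝔤 × 𝔤))
      (contMDiffAt_iff_contDiffAt.2 contDiff_snd.contDiffAt))
  refine ContMDiffAt.comp (x := ((chartOne G, chartOne G) : 𝔤 × 𝔤))
    (contMDiffAt_chart_one G ?_) h2
  simp

lemma contDiffAt_invChart : ContDiffAt ℝ ∞ (invChart G) (chartOne G : 𝔤) := by
  rw [← contMDiffAt_iff_contDiffAt]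
  have h1 := contMDiffAt_chart_symm_one (𝔤 := 𝔤) G
  refine ContMDiffAt.comp (chartOne G : 𝔤) (contMDiffAt_chart_one G ?_) h1.inv
  simp

/-- The part of the second derivative of the multiplication at the identity that is linear in each
factor. Its antisymmetrization is the Lie bracket. -/
def mulHess (v w : 𝔤) : 𝔤 :=
  fderiv ℝ (fderiv ℝ (mulChart G)) (chartOne G, chartOne G) (v, 0) (0, w)

lemma eventually_differentiableAt_mulChart :
    ∀ᶠ p in 𝓝 ((chartOne G, chartOne G) : 𝔤 × 𝔤), DifferentiableAt ℝ (mulChart G) p := by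
  have h := ((contDiffAt_mulChart (𝔤 := 𝔤) G).of_le (m := 1) (by simp)).eventually (by simp)
  exact h.mono fun p hp => hp.differentiableAt (by simp)

lemma hasFDerivAt_fderiv_mulChart :
    HasFDerivAt (fderiv ℝ (mulChart G)) (fderiv ℝ (fderiv ℝ (mulChart G)) (chartOne G, chartOne G))
      ((chartOne G, chartOne G) : 𝔤 × 𝔤) :=
  (((contDiffAt_mulChart G).fderiv_right (m := ∞) (by simp)).differentiableAt
    (by simp)).hasFDerivAt

/-- The derivatives of left translations at the identity, in the chart. -/
def leftTrans (a : 𝔤) : 𝔤 →L[ℝ] 𝔤 := fderiv ℝ (fun b => mulChart G (a, b)) (chartOne G)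

/-- The derivatives of right translations at the identity, in the chart. -/
def rightTrans (a : 𝔤) : 𝔤 →L[ℝ] 𝔤 := fderiv ℝ (fun b => mulChart G (b, a)) (chartOne G)

lemma leftTrans_eventuallyEq : leftTrans G =ᶠ[𝓝 (chartOne G : 𝔤)]
    fun a => (fderiv ℝ (mulChart G) (a, chartOne G)).comp (.inr ℝ 𝔤 𝔤) := by
  have hc : ContinuousAt (fun a : 𝔤 => (a, (chartOne G : 𝔤))) (chartOne G) := by fun_prop
  filter_upwards [hc.eventually (eventually_differentiableAt_mulChart G)] with a ha
  exact (ha.hasFDerivAt.comp (chartOne G) (hasFDerivAt_prodMk_right a (chartOne G))).fderiv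

lemma rightTrans_eventuallyEq : rightTrans G =ᶠ[𝓝 (chartOne G : 𝔤)]
    fun a => (fderiv ℝ (mulChart G) (chartOne G, a)).comp (.inl ℝ 𝔤 𝔤) := by
  have hc : ContinuousAt (fun a : 𝔤 => ((chartOne G : 𝔤), a)) (chartOne G) := by fun_prop
  filter_upwards [hc.eventually (eventually_differentiableAt_mulChart G)] with a ha
  exact (HasFDerivAt.comp (g := mulChart G) (f := fun b : 𝔤 => (b, a)) (chartOne G)
    ha.hasFDerivAt (hasFDerivAt_prodMk_left (chartOne G) a)).fderiv

lemma hasFDerivAt_leftTrans : ∃ B : 𝔤 →L[ℝ] 𝔤 →L[ℝ] 𝔤, (∀ v w, B v w = mulHess G v w) ∧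
    HasFDerivAt (leftTrans G) B (chartOne G : 𝔤) := by
  have h := HasFDerivAt.comp (g := fderiv ℝ (mulChart G)) (f := fun a : 𝔤 => (a, (chartOne G : 𝔤)))
    (chartOne G) (hasFDerivAt_fderiv_mulChart (𝔤 := 𝔤) G)
    (hasFDerivAt_prodMk_left (chartOne G) (chartOne G))
  have h2 := h.clm_comp (hasFDerivAt_const (ContinuousLinearMap.inr ℝ 𝔤 𝔤) (chartOne G : 𝔤))
  refine ⟨_, ?_, h2.congr_of_eventuallyEq (leftTrans_eventuallyEq G)⟩
  intro v w
  simp [mulHess]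

lemma hasFDerivAt_rightTrans : ∃ B : 𝔤 →L[ℝ] 𝔤 →L[ℝ] 𝔤, (∀ v w, B v w = mulHess G w v) ∧
    HasFDerivAt (rightTrans G) B (chartOne G : 𝔤) := by
  have h := HasFDerivAt.comp (g := fderiv ℝ (mulChart G)) (f := fun a : 𝔤 => ((chartOne G : 𝔤), a))
    (chartOne G) (hasFDerivAt_fderiv_mulChart (𝔤 := 𝔤) G)
    (hasFDerivAt_prodMk_right (chartOne G) (chartOne G))
  have h2 := h.clm_comp (hasFDerivAt_const (ContinuousLinearMap.inl ℝ 𝔤 𝔤) (chartOne G : 𝔤))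
  refine ⟨_, ?_, h2.congr_of_eventuallyEq (rightTrans_eventuallyEq G)⟩
  intro v w
  have hs : IsSymmSndFDerivAt ℝ (mulChart G) ((chartOne G, chartOne G) : 𝔤 × 𝔤) :=
    (contDiffAt_mulChart G).isSymmSndFDerivAt
      (by rw [minSmoothness_of_isRCLikeNormedField]; exact ENat.LEInfty.out)
  simpa [mulHess] using hs.eq (0, v) (w, 0)

lemma leftTrans_chartOne : leftTrans G (chartOne G : 𝔤) = .id ℝ 𝔤 := by
  have : (fun b => mulChart G ((chartOne G : 𝔤), b)) =ᶠ[𝓝 (chartOne G : 𝔤)] id := by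
    filter_upwards [(chartAt 𝔤 (1 : G)).open_target.mem_nhds (chartOne_mem G)] with a ha
    exact mulChart_chartOne_left G ha
  rw [leftTrans, this.fderiv_eq, fderiv_id]

lemma rightTrans_chartOne : rightTrans G (chartOne G : 𝔤) = .id ℝ 𝔤 := by
  have : (fun b => mulChart G (b, (chartOne G : 𝔤))) =ᶠ[𝓝 (chartOne G : 𝔤)] id := by
    filter_upwards [(chartAt 𝔤 (1 : G)).open_target.mem_nhds (chartOne_mem G)] with a ha
    exact mulChart_chartOne_right G ha
  rw [rightTrans, this.fderiv_eq, fderiv_id]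

lemma mdifferentiableAt_mul_left (a b : G) :
    MDifferentiableAt 𝓘(ℝ, 𝔤) 𝓘(ℝ, 𝔤) (fun x : G => a * x) b :=
  (contMDiff_mul_left (I := 𝓘(ℝ, 𝔤)) (n := ∞)).contMDiffAt.mdifferentiableAt (by simp)

/-- In the chart at `1`, the left invariant vector field through `v` is `a ↦ leftTrans a v`. -/
lemma chartSymmDeriv_leftTrans {a : 𝔤} (ha : a ∈ (chartAt 𝔤 (1 : G)).target) :
    (chartSymmDeriv (1 : G) a).comp (leftTrans G a) =
      (mfderiv 𝓘(ℝ, 𝔤) 𝓘(ℝ, 𝔤) (fun x : G => (chartAt 𝔤 (1 : G)).symm a * x) 1 : 𝔤 →L[ℝ] 𝔤) := by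
  set g := (chartAt 𝔤 (1 : G)).symm a with hg
  have hgs : g ∈ (chartAt 𝔤 (1 : G)).source := (chartAt 𝔤 (1 : G)).map_target ha
  have h1 : MDifferentiableAt 𝓘(ℝ, 𝔤) 𝓘(ℝ, 𝔤) ((chartAt 𝔤 (1 : G)).symm : 𝔤 → G) (chartOne G) :=
    mdifferentiableAt_chart_symm 1 (chartOne_mem G)
  have h2 : MDifferentiableAt 𝓘(ℝ, 𝔤) 𝓘(ℝ, 𝔤)
      ((fun x : G => g * x) ∘ ((chartAt 𝔤 (1 : G)).symm : 𝔤 → G)) (chartOne G) :=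
    (mdifferentiableAt_mul_left G g _).comp (chartOne G : 𝔤) h1
  have hval : mulChart G (a, chartOne G) = a := mulChart_chartOne_right G ha
  have h3 : MDifferentiableAt 𝓘(ℝ, 𝔤) 𝓘(ℝ, 𝔤) (fun b => mulChart G (a, b)) (chartOne G : 𝔤) := by
    refine MDifferentiableAt.comp (chartOne G : 𝔤) (mdifferentiableAt_chart 1 ?_) h2
    simpa using hgs
  have h4 : MDifferentiableAt 𝓘(ℝ, 𝔤) 𝓘(ℝ, 𝔤) ((chartAt 𝔤 (1 : G)).symm : 𝔤 → G)
      (mulChart G (a, chartOne G)) := by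
    rw [hval]; exact mdifferentiableAt_chart_symm 1 ha
  have e1 := mfderiv_comp (chartOne G : 𝔤) h4 h3
  have e2 := mfderiv_comp (chartOne G : 𝔤) (mdifferentiableAt_mul_left G g _) h1
  have e3 : ((chartAt 𝔤 (1 : G)).symm ∘ fun b => mulChart G (a, b)) =ᶠ[𝓝 (chartOne G : 𝔤)]
      ((fun x : G => g * x) ∘ ((chartAt 𝔤 (1 : G)).symm : 𝔤 → G)) := by
    have hc : ContinuousAt ((fun x : G => g * x) ∘ ((chartAt 𝔤 (1 : G)).symm : 𝔤 → G))
        (chartOne G : 𝔤) := h2.continuousAt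
    filter_upwards [hc.preimage_mem_nhds ((chartAt 𝔤 (1 : G)).open_source.mem_nhds
      (by simpa using hgs))] with b hb
    exact (chartAt 𝔤 (1 : G)).left_inv hb
  have e4 := e3.mfderiv_eq (I := 𝓘(ℝ, 𝔤)) (I' := 𝓘(ℝ, 𝔤))
  have e5 : (mfderiv 𝓘(ℝ, 𝔤) 𝓘(ℝ, 𝔤) ((chartAt 𝔤 (1 : G)).symm : 𝔤 → G) (chartOne G : 𝔤) :
      𝔤 →L[ℝ] 𝔤) = .id ℝ 𝔤 := chartSymmDeriv_self (1 : G)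
  have e6 := (e1.symm.trans e4).trans e2
  have e7 : (chartSymmDeriv (1 : G) (mulChart G (a, chartOne G))).comp (leftTrans G a) =
    (mfderiv 𝓘(ℝ, 𝔤) 𝓘(ℝ, 𝔤) (fun x : G => g * x) ((chartAt 𝔤 (1 : G)).symm (chartOne G)) :
      𝔤 →L[ℝ] 𝔤).comp
      (mfderiv 𝓘(ℝ, 𝔤) 𝓘(ℝ, 𝔤) ((chartAt 𝔤 (1 : G)).symm : 𝔤 → G) (chartOne G : 𝔤) :
        𝔤 →L[ℝ] 𝔤) := by
    rw [leftTrans, ← mfderiv_eq_fderiv]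
    exact e6
  rw [hval, e5, chart_symm_chartOne] at e7
  exact e7

variable [FiniteDimensional ℝ 𝔤]

/-- The Lie bracket is the antisymmetrized second derivative of the multiplication: in the chart the
bracket of left invariant vector fields at `1` is the bracket of the fields `a ↦ leftTrans a v`. -/
lemma lieBr_eq (v w : 𝔤) : lieBr G v w = mulHess G v w - mulHess G w v := by
  let X : 𝔤 → 𝔤 → 𝔤 := fun u => VectorField.mpullbackWithin 𝓘(ℝ, 𝔤) 𝓘(ℝ, 𝔤)
      (extChartAt 𝓘(ℝ, 𝔤) (1 : G)).symm
      (mulInvariantVectorField (I := 𝓘(ℝ, 𝔤)) (G := G) u) (Set.range 𝓘(ℝ, 𝔤))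
  have key : ∀ u : 𝔤, X u =ᶠ[𝓝 (chartOne G : 𝔤)] fun a => leftTrans G a u := by
    intro u
    filter_upwards [(chartAt 𝔤 (1 : G)).open_target.mem_nhds (chartOne_mem G)] with a ha
    obtain ⟨S, hS1, hS2⟩ := exists_inverse_chartSymmDeriv (1 : G) ha
    have h1 := congrArg (fun f => f u) (chartSymmDeriv_leftTrans G ha)
    have h2 : (chartSymmDeriv (1 : G) a).inverse = S := ContinuousLinearMap.inverse_eq hS1 hS2
    let D : 𝔤 →L[ℝ] 𝔤 := mfderivWithin 𝓘(ℝ, 𝔤) 𝓘(ℝ, 𝔤) ((chartAt 𝔤 (1 : G)).symm : 𝔤 → G)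
      (Set.range 𝓘(ℝ, 𝔤)) a
    let Y : 𝔤 →L[ℝ] 𝔤 := mfderiv 𝓘(ℝ, 𝔤) 𝓘(ℝ, 𝔤)
        (fun x : G => (chartAt 𝔤 (1 : G)).symm a * x) 1
    have h3 : X u a = D.inverse (Y u) := rfl
    have h4 : D = chartSymmDeriv (1 : G) a := by
      simp only [D]
      rw [modelWithCornersSelf_coe, Set.range_id, mfderivWithin_univ]
      rfl
    rw [h4, h2] at h3
    refine h3.trans ((congrArg S h1.symm).trans ?_)
    exact congrArg (fun f : 𝔤 →L[ℝ] 𝔤 => f (leftTrans G a u)) hS2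
  let D : 𝔤 →L[ℝ] 𝔤 := mfderiv 𝓘(ℝ, 𝔤) 𝓘(ℝ, 𝔤) (chartAt 𝔤 (1 : G) : G → 𝔤) 1
  have hD : D = .id ℝ 𝔤 := mfderiv_chart_self (1 : G)
  have hb : lieBr G v w = D.inverse (VectorField.lieBracketWithin ℝ (X v) (X w)
        ((extChartAt 𝓘(ℝ, 𝔤) (1 : G)).symm ⁻¹' Set.univ ∩ Set.range 𝓘(ℝ, 𝔤))
        (chartOne G : 𝔤)) := rfl
  obtain ⟨B, hB, hB'⟩ := hasFDerivAt_leftTrans (𝔤 := 𝔤) G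
  have hd : ∀ u : 𝔤, HasFDerivAt (fun a => leftTrans G a u) (B.flip u) (chartOne G) := fun u => by
    have := hB'.clm_apply (hasFDerivAt_const u (chartOne G))
    convert this using 1
    ext x; simp
  have hset : ((extChartAt 𝓘(ℝ, 𝔤) (1 : G)).symm ⁻¹' Set.univ ∩ Set.range 𝓘(ℝ, 𝔤)) = Set.univ := by
    simp
  rw [hb, hD, ContinuousLinearMap.inverse_id, hset,
    VectorField.lieBracketWithin_univ,
    Filter.EventuallyEq.lieBracket_vectorField_eq (key v) (key w), VectorField.lieBracket,
    (hd v).fderiv, (hd w).fderiv, leftTrans_chartOne]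
  simp [hB]

end LieGroupChart

end PrimYM

end

noncomputable section

namespace PrimYM

/-! ### The adjoint action and the Maurer-Cartan equation -/

section Adjoint

variable {𝔤 : Type*} [NormedAddCommGroup 𝔤] [NormedSpace ℝ 𝔤]
  {G : Type*} [TopologicalSpace G] [ChartedSpace 𝔤 G] [Group G] [LieGroup 𝓘(ℝ, 𝔤) ∞ G]

lemma contMDiff_conj (a : G) :
    ContMDiff 𝓘(ℝ, 𝔤) 𝓘(ℝ, 𝔤) ∞ (fun h : G => a * h * a⁻¹) :=
  (contMDiff_mul_right (I := 𝓘(ℝ, 𝔤)) (n := ∞) (a := a⁻¹)).comp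
    (contMDiff_mul_left (I := 𝓘(ℝ, 𝔤)) (n := ∞) (a := a))

/-- Conjugation by `a` in the chart at `1`. -/
def conjChart (a : G) (b : 𝔤) : 𝔤 :=
  chartAt 𝔤 (1 : G) (a * (chartAt 𝔤 (1 : G)).symm b * a⁻¹)

lemma conjChart_chartOne (a : G) : conjChart a (chartOne G : 𝔤) = chartOne G := by
  simp [conjChart]; rfl

lemma lieAd_eq_fderiv (a : G) : (lieAd a : 𝔤 →L[ℝ] 𝔤) = fderiv ℝ (conjChart a) (chartOne G) := by
  have h := mfderiv_eq_fderiv_chart (((contMDiff_conj (𝔤 := 𝔤) a).contMDiffAt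
    (x := (1 : G))).mdifferentiableAt (by simp))
  rw [lieAd]
  refine h.trans ?_
  have : a * 1 * a⁻¹ = 1 := by simp
  rw [this]
  rfl

lemma differentiableAt_conjChart (a : G) :
    DifferentiableAt ℝ (conjChart a) (chartOne G : 𝔤) := by
  rw [← mdifferentiableAt_iff_differentiableAt]
  have h1 := (contMDiffAt_chart_symm_one (𝔤 := 𝔤) G)
  have h2 := (contMDiff_conj (𝔤 := 𝔤) a).contMDiffAt.comp (chartOne G : 𝔤) h1
  refine (ContMDiffAt.comp (chartOne G : 𝔤) (contMDiffAt_chart_one G ?_) h2).mdifferentiableAt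
    (by simp)
  simp

lemma lieAd_mul (a b : G) : (lieAd (a * b) : 𝔤 →L[ℝ] 𝔤) = (lieAd a).comp (lieAd b) := by
  rw [lieAd_eq_fderiv, lieAd_eq_fderiv a, lieAd_eq_fderiv b]
  have h := fderiv_comp (𝕜 := ℝ) (chartOne G : 𝔤) (g := conjChart a) (f := conjChart b)
    (by rw [conjChart_chartOne]; exact differentiableAt_conjChart a) (differentiableAt_conjChart b)
  rw [conjChart_chartOne] at h
  rw [← h]
  apply Filter.EventuallyEq.fderiv_eq
  have h1 := (contMDiffAt_chart_symm_one (𝔤 := 𝔤) G)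
  have h2 := ((contMDiff_conj (𝔤 := 𝔤) b).contMDiffAt.comp (chartOne G : 𝔤) h1).continuousAt
  filter_upwards [h2.preimage_mem_nhds ((chartAt 𝔤 (1 : G)).open_source.mem_nhds (by simp))]
    with y hy
  have hy' : b * (chartAt 𝔤 (1 : G)).symm y * b⁻¹ ∈ (chartAt 𝔤 (1 : G)).source := hy
  simp only [conjChart, Function.comp, (chartAt 𝔤 (1 : G)).left_inv hy']
  simp [mul_assoc]

lemma lieAd_one : (lieAd (1 : G) : 𝔤 →L[ℝ] 𝔤) = .id ℝ 𝔤 := by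
  rw [lieAd_eq_fderiv]
  have : conjChart (1 : G) =ᶠ[𝓝 (chartOne G : 𝔤)] id := by
    filter_upwards [eventually_chart_symm_right_inv (𝔤 := 𝔤) G] with y hy
    simp [conjChart, hy]
  rw [this.fderiv_eq, fderiv_id]

variable [FiniteDimensional ℝ 𝔤]

/-- The derivative of the adjoint action at the identity is the Lie bracket: this follows by
differentiating `rightTrans a ∘ Ad a = leftTrans a`. -/
lemma hasFDerivAt_lieAd :
    HasFDerivAt (fun a : 𝔤 => (lieAd ((chartAt 𝔤 (1 : G)).symm a) : 𝔤 →L[ℝ] 𝔤)) (lieBr G)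
      (chartOne G) := by
  set o : 𝔤 := chartOne G with ho
  have hs := contMDiffAt_chart_symm_one (𝔤 := 𝔤) G
  have hsm : ContDiffAt ℝ ∞ (Function.uncurry fun a b : 𝔤 =>
      conjChart ((chartAt 𝔤 (1 : G)).symm a) b) (o, o) := by
    rw [← contMDiffAt_iff_contDiffAt]
    have hfst : ContMDiffAt 𝓘(ℝ, 𝔤 × 𝔤) 𝓘(ℝ, 𝔤) ∞
        (fun p : 𝔤 × 𝔤 => (chartAt 𝔤 (1 : G)).symm p.1) (o, o) :=
      hs.comp (x := (o, o)) (contMDiffAt_iff_contDiffAt.2 contDiff_fst.contDiffAt)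
    have hsnd : ContMDiffAt 𝓘(ℝ, 𝔤 × 𝔤) 𝓘(ℝ, 𝔤) ∞
        (fun p : 𝔤 × 𝔤 => (chartAt 𝔤 (1 : G)).symm p.2) (o, o) :=
      hs.comp (x := (o, o)) (contMDiffAt_iff_contDiffAt.2 contDiff_snd.contDiffAt)
    refine ContMDiffAt.comp (x := (o, o)) (contMDiffAt_chart_one G ?_)
      ((hfst.mul hsnd).mul hfst.inv)
    simp [ho]
  have hdiff : DifferentiableAt ℝ
      (fun a : 𝔤 => (lieAd ((chartAt 𝔤 (1 : G)).symm a) : 𝔤 →L[ℝ] 𝔤)) o := by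
    simp only [lieAd_eq_fderiv]
    exact (ContDiffAt.fderiv (m := ∞) (n := ∞) hsm contDiffAt_const
      (by simp)).differentiableAt (by simp)
  have hrel : (fun a => (rightTrans G a).comp
      (lieAd ((chartAt 𝔤 (1 : G)).symm a) : 𝔤 →L[ℝ] 𝔤)) =ᶠ[𝓝 o] leftTrans G := by
    have hc1 : ContinuousAt (fun a : 𝔤 => ((chartOne G : 𝔤), a)) (chartOne G) := by fun_prop
    filter_upwards [hc1.eventually (eventually_differentiableAt_mulChart G)] with a ha
    set g := (chartAt 𝔤 (1 : G)).symm a with hg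
    have h := fderiv_comp (𝕜 := ℝ) o (g := fun b => mulChart G (b, a)) (f := conjChart g)
      (by
        rw [ho, conjChart_chartOne]
        exact DifferentiableAt.comp (g := mulChart G) (f := fun b : 𝔤 => (b, a)) o ha
          (hasFDerivAt_prodMk_left o a).differentiableAt)
      (differentiableAt_conjChart g)
    rw [ho, conjChart_chartOne] at h
    rw [lieAd_eq_fderiv, rightTrans, ← h, leftTrans]
    apply Filter.EventuallyEq.fderiv_eq
    have h2 := ((contMDiff_conj (𝔤 := 𝔤) g).contMDiffAt.comp o hs).continuousAt
    filter_upwards [h2.preimage_mem_nhds ((chartAt 𝔤 (1 : G)).open_source.mem_nhds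
      (by simp [ho]))] with y hy
    have hy' : g * (chartAt 𝔤 (1 : G)).symm y * g⁻¹ ∈ (chartAt 𝔤 (1 : G)).source := hy
    simp only [mulChart, conjChart, Function.comp, (chartAt 𝔤 (1 : G)).left_inv hy', ← hg]
    simp
  obtain ⟨R, hR, hR'⟩ := hasFDerivAt_rightTrans (𝔤 := 𝔤) G
  obtain ⟨L, hL, hL'⟩ := hasFDerivAt_leftTrans (𝔤 := 𝔤) G
  have h1 := ((hR'.clm_comp hdiff.hasFDerivAt).congr_of_eventuallyEq hrel.symm).unique hL'
  have h2 : fderiv ℝ (fun a : 𝔤 => (lieAd ((chartAt 𝔤 (1 : G)).symm a) : 𝔤 →L[ℝ] 𝔤)) o =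
      lieBr G := by
    ext v w
    have h3 := congrArg (fun f => f v w) h1
    simp only [ho, rightTrans_chartOne, chart_symm_chartOne, lieAd_one] at h3
    simp [hR, hL] at h3
    rw [lieBr_eq, ← h3]
    simp [ho]
  rw [← h2]
  exact hdiff.hasFDerivAt

/-- `Ad(a)` is an automorphism of the Lie algebra: differentiate `Ad(a h a⁻¹)` at `h = 1`. -/
lemma lieAd_lieBr (a : G) (v w : 𝔤) : lieAd a (lieBr G v w) = lieBr G (lieAd a v) (lieAd a w) := by
  have h0 := hasFDerivAt_lieAd (𝔤 := 𝔤) (G := G)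
  have h1 : HasFDerivAt (fun b => (lieAd ((chartAt 𝔤 (1 : G)).symm (conjChart a b)) : 𝔤 →L[ℝ] 𝔤))
      ((lieBr G).comp (lieAd a)) (chartOne G) := by
    rw [lieAd_eq_fderiv a]
    refine HasFDerivAt.comp (g := fun b => (lieAd ((chartAt 𝔤 (1 : G)).symm b) : 𝔤 →L[ℝ] 𝔤))
      (chartOne G : 𝔤) ?_ (differentiableAt_conjChart a).hasFDerivAt
    rwa [conjChart_chartOne]
  have h2 := h1.clm_apply (hasFDerivAt_const (lieAd a w) (chartOne G : 𝔤))
  have h3 := (lieAd a : 𝔤 →L[ℝ] 𝔤).hasFDerivAt.comp (chartOne G : 𝔤)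
    (h0.clm_apply (hasFDerivAt_const w (chartOne G : 𝔤)))
  have h4 : (fun b => (lieAd ((chartAt 𝔤 (1 : G)).symm (conjChart a b)) : 𝔤 →L[ℝ] 𝔤) (lieAd a w))
      =ᶠ[𝓝 (chartOne G : 𝔤)] fun b => lieAd a (lieAd ((chartAt 𝔤 (1 : G)).symm b) w) := by
    have hs := contMDiffAt_chart_symm_one (𝔤 := 𝔤) G
    have hc := ((contMDiff_conj (𝔤 := 𝔤) a).contMDiffAt.comp (chartOne G : 𝔤) hs).continuousAt
    filter_upwards [hc.preimage_mem_nhds ((chartAt 𝔤 (1 : G)).open_source.mem_nhds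
      (by simp))] with y hy
    have hy' : a * (chartAt 𝔤 (1 : G)).symm y * a⁻¹ ∈ (chartAt 𝔤 (1 : G)).source := hy
    have e := lieAd_mul (𝔤 := 𝔤) a ((chartAt 𝔤 (1 : G)).symm y)
    have e2 := lieAd_mul (𝔤 := 𝔤) (a * (chartAt 𝔤 (1 : G)).symm y * a⁻¹) a
    rw [inv_mul_cancel_right, e] at e2
    rw [conjChart, (chartAt 𝔤 (1 : G)).left_inv hy']
    exact (congrArg (fun f => f w) e2).symm
  have h5 := congrArg (fun f => f v) ((h3.congr_of_eventuallyEq h4).unique h2)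
  simpa using h5

/-- The infinitesimal form of the `Ad`-invariance of the inner product. -/
lemma InvariantInner.form_lieBr (κ : InvariantInner 𝔤 G) (u v w : 𝔤) :
    κ.form (lieBr G u v) w = -κ.form v (lieBr G u w) := by
  have h0 := hasFDerivAt_lieAd (𝔤 := 𝔤) (G := G)
  have hv := h0.clm_apply (hasFDerivAt_const v (chartOne G : 𝔤))
  have hw := h0.clm_apply (hasFDerivAt_const w (chartOne G : 𝔤))
  have h1 := (κ.form.hasFDerivAt.comp (chartOne G : 𝔤) hv).clm_apply hw
  have h2 : HasFDerivAt (fun _ : 𝔤 => κ.form v w) (0 : 𝔤 →L[ℝ] ℝ) (chartOne G : 𝔤) :=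
    hasFDerivAt_const _ _
  have h3 := congrArg (fun f => f u) (h1.unique (h2.congr_of_eventuallyEq
    (Filter.Eventually.of_forall fun a => κ.invariant ((chartAt 𝔤 (1 : G)).symm a) v w)))
  simp [lieAd_one] at h3
  linarith

lemma lieBr_skew (v w : 𝔤) : lieBr G v w = -lieBr G w v := by
  rw [lieBr_eq, lieBr_eq, neg_sub]

end Adjoint

end PrimYM

end

noncomputable section

namespace PrimYM

section MaurerCartan

variable {𝔤 : Type*} [NormedAddCommGroup 𝔤] [NormedSpace ℝ 𝔤]
  {G : Type*} [TopologicalSpace G] [ChartedSpace 𝔤 G] [Group G]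
  {E : Type*} [NormedAddCommGroup E] [NormedSpace ℝ E]

/-- The left logarithmic derivative `F⁻¹ dF` of a map `F : E → G`. -/
def logDeriv (F : E → G) (y : E) : E →L[ℝ] 𝔤 :=
  fderiv ℝ (fun z => chartAt 𝔤 (1 : G) ((F y)⁻¹ * F z)) y

variable (G) in
/-- The left logarithmic derivative of the inverse of the chart at `1`, i.e. the left invariant
Maurer-Cartan form in that chart. -/
def logTrans (a : 𝔤) : 𝔤 →L[ℝ] 𝔤 := fderiv ℝ (fun b => mulChart G (invChart G a, b)) a

variable [LieGroup 𝓘(ℝ, 𝔤) ∞ G]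

/-- The Maurer-Cartan form inverts the left translations: `a⁻¹ (a b) = b`. -/
lemma logTrans_comp_leftTrans :
    (fun a : 𝔤 => (logTrans G a).comp (leftTrans G a)) =ᶠ[𝓝 (chartOne G : 𝔤)]
      fun _ => .id ℝ 𝔤 := by
  set o : 𝔤 := chartOne G with ho
  have hs := contMDiffAt_chart_symm_one (𝔤 := 𝔤) G
  have hc1 : ContinuousAt (fun a : 𝔤 => (a, o)) o := by fun_prop
  have hc2 : ContinuousAt (fun a : 𝔤 => (invChart G a, a)) o :=
    (contDiffAt_invChart G).continuousAt.prodMk continuousAt_id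
  have hd := eventually_differentiableAt_mulChart (𝔤 := 𝔤) G
  filter_upwards [hc1.eventually hd, hc2.eventually (by simpa [ho] using hd),
    (chartAt 𝔤 (1 : G)).open_target.mem_nhds (chartOne_mem G),
    hs.inv.continuousAt.preimage_mem_nhds ((chartAt 𝔤 (1 : G)).open_source.mem_nhds (by simp))]
    with a h1 h2 ha hai
  have hai' : ((chartAt 𝔤 (1 : G)).symm a)⁻¹ ∈ (chartAt 𝔤 (1 : G)).source := hai
  have hval : mulChart G (a, o) = a := mulChart_chartOne_right G ha
  have h3 : DifferentiableAt ℝ (fun b => mulChart G (a, b)) o :=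
    DifferentiableAt.comp (g := mulChart G) (f := fun b : 𝔤 => (a, b)) o h1
      (hasFDerivAt_prodMk_right a o).differentiableAt
  have h4 : DifferentiableAt ℝ (fun b => mulChart G (invChart G a, b)) a :=
    DifferentiableAt.comp (g := mulChart G) (f := fun b : 𝔤 => (invChart G a, b)) a h2
      (hasFDerivAt_prodMk_right _ a).differentiableAt
  have h := fderiv_comp (𝕜 := ℝ) o (g := fun b => mulChart G (invChart G a, b))
    (f := fun b => mulChart G (a, b)) (by rwa [hval]) h3
  rw [hval] at h
  rw [logTrans, leftTrans, ← ho, ← h]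
  have : ((fun b => mulChart G (invChart G a, b)) ∘ fun b => mulChart G (a, b)) =ᶠ[𝓝 o] id := by
    have hc : ContinuousAt (fun b : 𝔤 => (chartAt 𝔤 (1 : G)).symm a *
        (chartAt 𝔤 (1 : G)).symm b) o :=
      ((mdifferentiableAt_mul_left (𝔤 := 𝔤) G _ _).comp o
        (hs.mdifferentiableAt (by simp))).continuousAt
    filter_upwards [eventually_chart_symm_right_inv (𝔤 := 𝔤) G,
      hc.preimage_mem_nhds ((chartAt 𝔤 (1 : G)).open_source.mem_nhds
        (by simpa [ho] using (chartAt 𝔤 (1 : G)).map_target ha))] with b hb hb2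
    have hb2' : (chartAt 𝔤 (1 : G)).symm a * (chartAt 𝔤 (1 : G)).symm b ∈
      (chartAt 𝔤 (1 : G)).source := hb2
    simp only [mulChart, invChart, Function.comp, (chartAt 𝔤 (1 : G)).left_inv hb2',
      (chartAt 𝔤 (1 : G)).left_inv hai']
    simpa using hb
  rw [this.fderiv_eq, fderiv_id]

lemma differentiableAt_logTrans : DifferentiableAt ℝ (logTrans G) (chartOne G : 𝔤) := by
  refine (ContDiffAt.fderiv (m := ∞) (n := ∞) (f := fun a b => mulChart G (invChart G a, b))
    (g := id) ?_ contDiffAt_id (by simp)).differentiableAt (by simp)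
  have h1 : ContDiffAt ℝ ∞ (fun p : 𝔤 × 𝔤 => (invChart G p.1, p.2)) (chartOne G, chartOne G) :=
    ((contDiffAt_invChart G).comp (chartOne G, chartOne G) contDiffAt_fst).prodMk contDiffAt_snd
  refine ContDiffAt.comp (g := mulChart G) (chartOne G, chartOne G) ?_ h1
  simpa using contDiffAt_mulChart (𝔤 := 𝔤) G

lemma logTrans_chartOne : logTrans G (chartOne G : 𝔤) = .id ℝ 𝔤 := by
  have : (logTrans G (chartOne G)).comp (leftTrans G (chartOne G)) = .id ℝ 𝔤 :=
    (logTrans_comp_leftTrans (𝔤 := 𝔤) (G := G)).self_of_nhds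
  rwa [leftTrans_chartOne, ContinuousLinearMap.comp_id] at this

lemma fderiv_logTrans (v w : 𝔤) :
    fderiv ℝ (logTrans G) (chartOne G : 𝔤) v w = -mulHess G v w := by
  obtain ⟨L, hL, hL'⟩ := hasFDerivAt_leftTrans (𝔤 := 𝔤) G
  have h1 := (differentiableAt_logTrans (𝔤 := 𝔤) (G := G)).hasFDerivAt.clm_comp hL'
  have h2 := congrArg (fun f => f v w)
    (h1.unique ((hasFDerivAt_const _ _).congr_of_eventuallyEq logTrans_comp_leftTrans))
  simp [logTrans_chartOne, leftTrans_chartOne, hL] at h2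
  rw [← hL] at h2 ⊢
  exact eq_neg_of_add_eq_zero_right h2

variable {F : E → G} {y₀ : E}

lemma contDiffAt_chart_translate (hF : ContMDiffAt 𝓘(ℝ, E) 𝓘(ℝ, 𝔤) ∞ F y₀) :
    ContDiffAt ℝ ∞ (fun z => chartAt 𝔤 (1 : G) ((F y₀)⁻¹ * F z)) y₀ := by
  rw [← contMDiffAt_iff_contDiffAt]
  exact ContMDiffAt.comp y₀ (contMDiffAt_chart_one G (by simp))
    ((contMDiff_mul_left (I := 𝓘(ℝ, 𝔤)) (n := ∞) (a := (F y₀)⁻¹)).contMDiffAt.comp y₀ hF)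

lemma eventually_translate_mem (hF : ContMDiffAt 𝓘(ℝ, E) 𝓘(ℝ, 𝔤) ∞ F y₀) :
    ∀ᶠ z in 𝓝 y₀, (F y₀)⁻¹ * F z ∈ (chartAt 𝔤 (1 : G)).source :=
  ((contMDiff_mul_left (I := 𝓘(ℝ, 𝔤)) (n := ∞) (a := (F y₀)⁻¹)).contMDiffAt.comp
    y₀ hF).continuousAt.preimage_mem_nhds
    ((chartAt 𝔤 (1 : G)).open_source.mem_nhds (by simp))

lemma logDeriv_eventuallyEq (hF : ContMDiffAt 𝓘(ℝ, E) 𝓘(ℝ, 𝔤) ∞ F y₀) :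
    logDeriv F =ᶠ[𝓝 y₀] fun y => (logTrans G (chartAt 𝔤 (1 : G) ((F y₀)⁻¹ * F y))).comp
      (fderiv ℝ (fun z => chartAt 𝔤 (1 : G) ((F y₀)⁻¹ * F z)) y) := by
  set u : E → 𝔤 := fun z => chartAt 𝔤 (1 : G) ((F y₀)⁻¹ * F z) with hu
  have hud : ContDiffAt ℝ ∞ u y₀ := contDiffAt_chart_translate hF
  have hu0 : u y₀ = chartOne G := by simp [hu]; rfl
  have hc : ContinuousAt (fun a : 𝔤 => (invChart G a, a)) (u y₀) := by
    rw [hu0]; exact (contDiffAt_invChart G).continuousAt.prodMk continuousAt_id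
  have hc2 : ContinuousAt (fun y => (invChart G (u y), u y)) y₀ :=
    ContinuousAt.comp (g := fun a : 𝔤 => (invChart G a, a)) hc hud.continuousAt
  have hd := eventually_differentiableAt_mulChart (𝔤 := 𝔤) G
  have hi : ContinuousAt (fun y => ((F y₀)⁻¹ * F y)⁻¹) y₀ :=
    ((contMDiff_mul_left (I := 𝓘(ℝ, 𝔤)) (n := ∞) (a := (F y₀)⁻¹)).contMDiffAt.comp
      y₀ hF).inv.continuousAt
  filter_upwards [eventually_eventually_nhds.2 (eventually_translate_mem hF),
    (hud.of_le (m := 1) (by simp)).eventually (by simp),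
    hc2.eventually (by simpa [hu0] using hd),
    hi.preimage_mem_nhds ((chartAt 𝔤 (1 : G)).open_source.mem_nhds (by simp))] with y h1 h2 h3 h4
  have h4' : ((F y₀)⁻¹ * F y)⁻¹ ∈ (chartAt 𝔤 (1 : G)).source := h4
  have h5 : DifferentiableAt ℝ (fun b => mulChart G (invChart G (u y), b)) (u y) :=
    DifferentiableAt.comp (g := mulChart G) (f := fun b : 𝔤 => (invChart G (u y), b)) (u y) h3
      (hasFDerivAt_prodMk_right _ _).differentiableAt
  rw [logTrans, ← fderiv_comp (𝕜 := ℝ) y (g := fun b => mulChart G (invChart G (u y), b)) (f := u)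
    h5 (h2.differentiableAt (by simp)), logDeriv]
  apply Filter.EventuallyEq.fderiv_eq
  filter_upwards [h1] with z hz
  simp only [Function.comp, mulChart, invChart, hu, (chartAt 𝔤 (1 : G)).left_inv hz,
    (chartAt 𝔤 (1 : G)).left_inv h1.self_of_nhds, (chartAt 𝔤 (1 : G)).left_inv h4']
  congr 1
  group

lemma differentiableAt_logDeriv (hF : ContMDiffAt 𝓘(ℝ, E) 𝓘(ℝ, 𝔤) ∞ F y₀) :
    DifferentiableAt ℝ (logDeriv F : E → E →L[ℝ] 𝔤) y₀ := by
  have hud := contDiffAt_chart_translate hF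
  have hu0 : chartAt 𝔤 (1 : G) ((F y₀)⁻¹ * F y₀) = chartOne G := by simp; rfl
  refine DifferentiableAt.congr_of_eventuallyEq ?_ (logDeriv_eventuallyEq hF)
  refine DifferentiableAt.clm_comp ?_ ((hud.fderiv_right (m := ∞) (by simp)).differentiableAt
    (by simp))
  exact DifferentiableAt.comp (g := logTrans G) y₀ (by rw [hu0]; exact differentiableAt_logTrans)
    (hud.differentiableAt (by simp))

variable [FiniteDimensional ℝ 𝔤]

/-- The Maurer-Cartan equation `dθ = -½ [θ, θ]` for `θ = F⁻¹ dF`. -/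
lemma fderiv_logDeriv_sub (hF : ContMDiffAt 𝓘(ℝ, E) 𝓘(ℝ, 𝔤) ∞ F y₀) (v w : E) :
    fderiv ℝ (logDeriv F : E → E →L[ℝ] 𝔤) y₀ v w -
        fderiv ℝ (logDeriv F : E → E →L[ℝ] 𝔤) y₀ w v =
      -lieBr G (logDeriv F y₀ v) (logDeriv F y₀ w) := by
  set u : E → 𝔤 := fun z => chartAt 𝔤 (1 : G) ((F y₀)⁻¹ * F z) with hu
  have hud : ContDiffAt ℝ ∞ u y₀ := contDiffAt_chart_translate hF
  have hu0 : u y₀ = chartOne G := by simp [hu]; rfl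
  have h1 : HasFDerivAt (fun y => logTrans G (u y))
      ((fderiv ℝ (logTrans G) (chartOne G)).comp (fderiv ℝ u y₀)) y₀ := by
    refine HasFDerivAt.comp (g := logTrans G) y₀ ?_ (hud.differentiableAt (by simp)).hasFDerivAt
    rw [hu0]; exact differentiableAt_logTrans.hasFDerivAt
  have h2 := ((hud.fderiv_right (m := ∞) (by simp)).differentiableAt (by simp)).hasFDerivAt
  have h3 := (h1.clm_comp h2).congr_of_eventuallyEq (logDeriv_eventuallyEq hF)
  have hs : IsSymmSndFDerivAt ℝ u y₀ := hud.isSymmSndFDerivAt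
      (by rw [minSmoothness_of_isRCLikeNormedField]; exact ENat.LEInfty.out)
  have h4 : logDeriv F y₀ = fderiv ℝ u y₀ := rfl
  rw [h3.fderiv, h4, lieBr_eq]
  simp [hu0, logTrans_chartOne, fderiv_logTrans, hs.eq v w]
  abel

/-- `d(Ad F⁻¹) = -ad(F⁻¹ dF) ∘ Ad F⁻¹`. -/
lemma hasFDerivAt_lieAd_inv (hF : ContMDiffAt 𝓘(ℝ, E) 𝓘(ℝ, 𝔤) ∞ F y₀) :
    ∃ D : E →L[ℝ] 𝔤 →L[ℝ] 𝔤,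
      (∀ v c, D v c = -lieBr G (logDeriv F y₀ v) (lieAd (F y₀)⁻¹ c)) ∧
      HasFDerivAt (fun y => (lieAd (F y)⁻¹ : 𝔤 →L[ℝ] 𝔤)) D y₀ := by
  set u : E → 𝔤 := fun z => chartAt 𝔤 (1 : G) ((F y₀)⁻¹ * F z) with hu
  have hud : ContDiffAt ℝ ∞ u y₀ := contDiffAt_chart_translate hF
  have hu0 : u y₀ = chartOne G := by simp [hu]; rfl
  set a : E → (𝔤 →L[ℝ] 𝔤) := fun y => lieAd ((chartAt 𝔤 (1 : G)).symm (u y)) with ha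
  have ha1 : HasFDerivAt a ((lieBr G).comp (logDeriv F y₀)) y₀ := by
    refine HasFDerivAt.comp (g := fun b => (lieAd ((chartAt 𝔤 (1 : G)).symm b) : 𝔤 →L[ℝ] 𝔤))
      y₀ ?_ (hud.differentiableAt (by simp)).hasFDerivAt
    rw [hu0]; exact hasFDerivAt_lieAd
  have hi : ContDiffAt ℝ ∞ (fun y => invChart G (u y)) y₀ :=
    ContDiffAt.comp (g := invChart G) y₀ (by rw [hu0]; exact contDiffAt_invChart G) hud
  set b : E → (𝔤 →L[ℝ] 𝔤) := fun y => lieAd ((chartAt 𝔤 (1 : G)).symm (invChart G (u y))) with hb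
  have hb1 : DifferentiableAt ℝ b y₀ := by
    refine DifferentiableAt.comp
      (g := fun b => (lieAd ((chartAt 𝔤 (1 : G)).symm b) : 𝔤 →L[ℝ] 𝔤)) y₀ ?_
      (hi.differentiableAt (by simp))
    rw [hu0, invChart_chartOne]; exact hasFDerivAt_lieAd.differentiableAt
  have hic : ContinuousAt (fun y => ((F y₀)⁻¹ * F y)⁻¹) y₀ :=
    ((contMDiff_mul_left (I := 𝓘(ℝ, 𝔤)) (n := ∞) (a := (F y₀)⁻¹)).contMDiffAt.comp
      y₀ hF).inv.continuousAt
  have hev : ∀ᶠ y in 𝓝 y₀, (chartAt 𝔤 (1 : G)).symm (u y) = (F y₀)⁻¹ * F y ∧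
      (chartAt 𝔤 (1 : G)).symm (invChart G (u y)) = ((F y₀)⁻¹ * F y)⁻¹ := by
    filter_upwards [eventually_translate_mem hF, hic.preimage_mem_nhds
      ((chartAt 𝔤 (1 : G)).open_source.mem_nhds (by simp))] with y h1 h2
    have h2' : ((F y₀)⁻¹ * F y)⁻¹ ∈ (chartAt 𝔤 (1 : G)).source := h2
    simp only [hu, invChart, (chartAt 𝔤 (1 : G)).left_inv h1, (chartAt 𝔤 (1 : G)).left_inv h2',
      and_self]
  -- The derivative of `Ad u⁻¹` at `u = 1` follows from that of `Ad u` and from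
  -- `Ad u ∘ Ad u⁻¹ = id`.
  have hab : (fun y => (a y).comp (b y)) =ᶠ[𝓝 y₀] fun _ => .id ℝ 𝔤 := by
    filter_upwards [hev] with y hy
    simp only [ha, hb, hy.1, hy.2]
    rw [← lieAd_mul, mul_inv_cancel, lieAd_one]
  have ha0 : a y₀ = .id ℝ 𝔤 := by simp [ha, hu0, lieAd_one]
  have hb0 : b y₀ = .id ℝ 𝔤 := by simp [hb, hu0, lieAd_one]
  have hb2 := (ha1.clm_comp hb1.hasFDerivAt).unique
    ((hasFDerivAt_const _ _).congr_of_eventuallyEq hab)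
  have hb3 : ∀ v w, fderiv ℝ b y₀ v w = -lieBr G (logDeriv F y₀ v) w := fun v w => by
    have h := congrArg (fun f => f v w) hb2
    simp [ha0, hb0] at h
    exact eq_neg_of_add_eq_zero_left h
  have hfin := hb1.hasFDerivAt.clm_comp (hasFDerivAt_const (lieAd (F y₀)⁻¹ : 𝔤 →L[ℝ] 𝔤) y₀)
  refine ⟨_, fun v c => ?_, hfin.congr_of_eventuallyEq ?_⟩
  · simp [hb3]
  · filter_upwards [hev] with y hy
    have h := lieAd_mul (𝔤 := 𝔤) ((F y₀)⁻¹ * F y)⁻¹ (F y₀)⁻¹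
    simp only [mul_inv_rev, inv_inv, mul_assoc, mul_inv_cancel, mul_one] at h
    simp only [hb, hy.2]
    rw [h]
    simp [mul_inv_rev]

end MaurerCartan

end PrimYM

end

noncomputable section

namespace PrimYM

/-! ### Covariance of the curvature -/

section FormCalculus

variable {E : Type*} [NormedAddCommGroup E] [NormedSpace ℝ E]
  {V : Type*} [NormedAddCommGroup V] [NormedSpace ℝ V] {k : ℕ}

lemma twoForm_ext {α β : E [⋀^Fin 2]→L[ℝ] V} (h : ∀ v w, α ![v, w] = β ![v, w]) : α = β := by
  ext m
  have : m = ![m 0, m 1] := by ext i; fin_cases i <;> rfl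
  rw [this, h]

lemma twoForm_swap (α : E [⋀^Fin 2]→L[ℝ] V) (v w : E) : α ![w, v] = -α ![v, w] := by
  have h := α.toAlternatingMap.map_swap ![v, w] (i := 0) (j := 1) (by simp)
  have e : (![v, w] ∘ Equiv.swap (0 : Fin 2) 1) = ![w, v] := by
    ext i; fin_cases i <;> simp
  rw [e] at h
  exact h

lemma alternatizeUncurryFin_one (f : E →L[ℝ] E [⋀^Fin 1]→L[ℝ] V) (v w : E) :
    ContinuousAlternatingMap.alternatizeUncurryFin f ![v, w] = f v ![w] - f w ![v] := by
  rw [ContinuousAlternatingMap.alternatizeUncurryFin_apply, Fin.sum_univ_two]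
  have h0 : Fin.removeNth 0 ![v, w] = ![w] := by ext i; fin_cases i; rfl
  have h1 : Fin.removeNth 1 ![v, w] = ![v] := by ext i; fin_cases i; rfl
  simp [h0, h1, sub_eq_add_neg]

lemma extDeriv_one (α : E → E [⋀^Fin 1]→L[ℝ] V) (y v w : E) :
    extDeriv α y ![v, w] = fderiv ℝ α y v ![w] - fderiv ℝ α y w ![v] :=
  alternatizeUncurryFin_one _ v w

/-- Evaluation of forms at vectors, as a continuous linear map. -/
def evalForm (m : Fin k → E) : (E [⋀^Fin k]→L[ℝ] V) →L[ℝ] V where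
  toFun α := α m
  map_add' _ _ := rfl
  map_smul' _ _ := rfl
  cont := (ContinuousMultilinearMap.apply ℝ (fun _ : Fin k => E) V m).continuous.comp
    (ContinuousAlternatingMap.toContinuousMultilinearMapCLM ℝ).continuous

lemma fderiv_apply_form {X : Type*} [NormedAddCommGroup X] [NormedSpace ℝ X]
    {α : X → E [⋀^Fin k]→L[ℝ] V} {y : X} (h : DifferentiableAt ℝ α y)
    (m : Fin k → E) (v : X) : fderiv ℝ α y v m = fderiv ℝ (fun z => α z m) y v := by
  have := ((evalForm (V := V) m).hasFDerivAt.comp y h.hasFDerivAt).fderiv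
  exact (congrArg (fun f => f v) this).symm

lemma differentiableAt_apply_form {X : Type*} [NormedAddCommGroup X] [NormedSpace ℝ X]
    {α : X → E [⋀^Fin k]→L[ℝ] V} {y : X} (h : DifferentiableAt ℝ α y)
    (m : Fin k → E) : DifferentiableAt ℝ (fun z => α z m) y :=
  (evalForm (V := V) m).differentiableAt.comp y h

lemma ContDiffAt.apply_form {X : Type*} [NormedAddCommGroup X] [NormedSpace ℝ X]
    {α : X → E [⋀^Fin k]→L[ℝ] V} {y : X} {r : ℕ∞ω} (h : ContDiffAt ℝ r α y)
    (m : Fin k → E) : ContDiffAt ℝ r (fun z => α z m) y :=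
  (evalForm (V := V) m).contDiff.contDiffAt.comp y h

variable [FiniteDimensional ℝ E] [FiniteDimensional ℝ V]

/-- In finite dimensions a family of forms is smooth if its values on all vectors are. -/
lemma contDiffAt_form {X : Type*} [NormedAddCommGroup X] [NormedSpace ℝ X]
    {α : X → E [⋀^Fin k]→L[ℝ] V} {y : X} {r : ℕ∞ω}
    (h : ∀ m : Fin k → E, ContDiffAt ℝ r (fun z => α z m) y) : ContDiffAt ℝ r α y := by
  let b := Module.finBasis ℝ E
  let T : (E [⋀^Fin k]→L[ℝ] V) →ₗ[ℝ] ((Fin k → Fin (Module.finrank ℝ E)) → V) :=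
    { toFun := fun α f => α fun a => b (f a)
      map_add' := fun _ _ => rfl
      map_smul' := fun _ _ => rfl }
  have hT : Function.Injective T := by
    intro α β h
    apply ContinuousAlternatingMap.toAlternatingMap_injective
    apply Module.Basis.ext_alternating b
    intro f _
    exact congrFun h f
  obtain ⟨S, hS⟩ := T.exists_leftInverse_of_injective (LinearMap.ker_eq_bot.2 hT)
  let S' := LinearMap.toContinuousLinearMap S
  have hα : α = fun z => S' (T (α z)) := by
    ext1 z
    exact (congrArg (fun f => f (α z)) hS).symm
  rw [hα]
  refine S'.contDiff.contDiffAt.comp y ?_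
  rw [contDiffAt_pi]
  exact fun f => h _

end FormCalculus

section Bracket

variable {𝔤 : Type*} [NormedAddCommGroup 𝔤] [NormedSpace ℝ 𝔤] [FiniteDimensional ℝ 𝔤]
  {G : Type*} [TopologicalSpace G] [ChartedSpace 𝔤 G] [Group G] [LieGroup 𝓘(ℝ, 𝔤) ∞ G]
  {E : Type*} [NormedAddCommGroup E] [NormedSpace ℝ E] [FiniteDimensional ℝ E] {k : ℕ}

lemma bracketLeft_apply (α : E [⋀^Fin 1]→L[ℝ] 𝔤) (β : E [⋀^Fin k]→L[ℝ] 𝔤) (v : Fin (k + 1) → E) :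
    bracketLeft G α β v =
      ∑ i : Fin (k + 1), (-1 : ℤ) ^ (i : ℕ) • lieBr G (α ![v i]) (β (Fin.removeNth i v)) := by
  rw [bracketLeft, ContinuousAlternatingMap.alternatizeUncurryFin_apply]
  rfl

lemma bracketLeft_apply_two (α β : E [⋀^Fin 1]→L[ℝ] 𝔤) (v w : E) :
    bracketLeft G α β ![v, w] = lieBr G (α ![v]) (β ![w]) - lieBr G (α ![w]) (β ![v]) := by
  rw [bracketLeft, alternatizeUncurryFin_one]
  rfl

lemma comp_singleton (T : E →L[ℝ] E) (v : E) : (T ∘ ![v]) = ![T v] := by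
  ext i; fin_cases i; rfl

lemma bracketLeft_compContinuousLinearMap (α : E [⋀^Fin 1]→L[ℝ] 𝔤) (β : E [⋀^Fin k]→L[ℝ] 𝔤)
    (T : E →L[ℝ] E) : (bracketLeft G α β).compContinuousLinearMap T =
      bracketLeft G (α.compContinuousLinearMap T) (β.compContinuousLinearMap T) := by
  ext v
  simp only [ContinuousAlternatingMap.compContinuousLinearMap_apply, bracketLeft_apply,
    comp_singleton]
  rfl

lemma contDiffAt_bracketLeft {X : Type*} [NormedAddCommGroup X] [NormedSpace ℝ X]
    {α : X → E [⋀^Fin 1]→L[ℝ] 𝔤} {β : X → E [⋀^Fin k]→L[ℝ] 𝔤} {y : X} {r : ℕ∞ω}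
    (hα : ContDiffAt ℝ r α y) (hβ : ContDiffAt ℝ r β y) :
    ContDiffAt ℝ r (fun z => bracketLeft G (α z) (β z)) y := by
  refine contDiffAt_form fun m => ?_
  simp only [bracketLeft_apply]
  refine ContDiffAt.sum fun i _ => ContDiffAt.const_smul _ ?_
  exact ((lieBr G).contDiff.contDiffAt.comp y (hα.apply_form _)).clm_apply (hβ.apply_form _)

end Bracket

end PrimYM

end

noncomputable section

namespace PrimYM

section SmoothForms

variable {E : Type*} [NormedAddCommGroup E] [NormedSpace ℝ E]
  {M : Type*} [TopologicalSpace M] [ChartedSpace E M]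
  {V : Type*} [NormedAddCommGroup V] [NormedSpace ℝ V] {k : ℕ}

lemma coordForm_apply (α : M → E [⋀^Fin k]→L[ℝ] V) (x₀ : M) (y : E) (m : Fin k → E) :
    coordForm α x₀ y m = α ((chartAt E x₀).symm y) (fun a => chartSymmDeriv x₀ y (m a)) := rfl

lemma coordForm_add (α β : M → E [⋀^Fin k]→L[ℝ] V) (x₀ : M) :
    coordForm (α + β) x₀ = coordForm α x₀ + coordForm β x₀ := rfl

lemma coordForm_smul (c : ℝ) (α : M → E [⋀^Fin k]→L[ℝ] V) (x₀ : M) :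
    coordForm (c • α) x₀ = c • coordForm α x₀ := rfl

lemma SmoothFormOn.add {α β : M → E [⋀^Fin k]→L[ℝ] V} {U : Set M} (hα : SmoothFormOn α U)
    (hβ : SmoothFormOn β U) : SmoothFormOn (α + β) U :=
  fun x₀ => (hα x₀).add (hβ x₀)

lemma SmoothFormOn.const_smul {α : M → E [⋀^Fin k]→L[ℝ] V} {U : Set M} (c : ℝ)
    (hα : SmoothFormOn α U) : SmoothFormOn (c • α) U :=
  fun x₀ => (hα x₀).const_smul c

lemma SmoothFormOn.congr {α β : M → E [⋀^Fin k]→L[ℝ] V} {U : Set M} (hα : SmoothFormOn α U)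
    (h : ∀ x ∈ U, β x = α x) : SmoothFormOn β U := fun x₀ => (hα x₀).congr fun y hy => by
  rw [coordForm, coordForm, h _ hy.2]

variable [IsManifold 𝓘(ℝ, E) ∞ M]

lemma SmoothFormOn.differentiableAt_coordForm_self {α : M → E [⋀^Fin k]→L[ℝ] V} {U : Set M}
    (h : SmoothFormOn α U) (hU : IsOpen U) {x : M} (hx : x ∈ U) :
    DifferentiableAt ℝ (coordForm α x) (chartAt E x x) :=
  (h.contDiffAt hU x (mem_chart_target E x) (by
    rwa [(chartAt E x).left_inv (mem_chart_source E x)])).differentiableAt (by simp)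

lemma extD_add {α β : M → E [⋀^Fin k]→L[ℝ] V} {U : Set M} (hα : SmoothFormOn α U)
    (hβ : SmoothFormOn β U) (hU : IsOpen U) {x : M} (hx : x ∈ U) :
    extD (α + β) x = extD α x + extD β x := by
  rw [extD_eq_extDeriv, extD_eq_extDeriv, extD_eq_extDeriv, coordForm_add]
  exact extDeriv_add (hα.differentiableAt_coordForm_self hU hx)
    (hβ.differentiableAt_coordForm_self hU hx)

lemma extD_const_smul (c : ℝ) (α : M → E [⋀^Fin k]→L[ℝ] V) (x : M) :
    extD (c • α) x = c • extD α x := by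
  rw [extD_eq_extDeriv, extD_eq_extDeriv, coordForm_smul, extDeriv_smul]

lemma extD_congr_of_eventuallyEq {α β : M → E [⋀^Fin k]→L[ℝ] V} {x : M} (h : α =ᶠ[𝓝 x] β) :
    extD α x = extD β x := by
  rw [extD_eq_extDeriv, extD_eq_extDeriv]
  apply Filter.EventuallyEq.extDeriv_eq
  have hc := (chartAt E x).continuousAt_symm (mem_chart_target E x)
  rw [ContinuousAt, (chartAt E x).left_inv (mem_chart_source E x)] at hc
  filter_upwards [hc.eventually h] with y hy
  rw [coordForm, coordForm, hy]

lemma extD_zero (x : M) : extD (0 : M → E [⋀^Fin k]→L[ℝ] V) x = 0 := by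
  simpa using extD_const_smul 0 (0 : M → E [⋀^Fin k]→L[ℝ] V) x

end SmoothForms

namespace PrincipalBundle

variable {ι : Type*} {E : Type*} [NormedAddCommGroup E] [NormedSpace ℝ E]
  {M : Type*} [TopologicalSpace M] [ChartedSpace E M]
  {𝔤 : Type*} [NormedAddCommGroup 𝔤] [NormedSpace ℝ 𝔤]
  {G : Type*} [TopologicalSpace G] [ChartedSpace 𝔤 G] [Group G]
  {P : PrincipalBundle ι E M 𝔤 G} {k : ℕ}

lemma IsAdForm.add {α β : P.LocalForms k} (hα : P.IsAdForm α) (hβ : P.IsAdForm β) :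
    P.IsAdForm (α + β) := by
  refine ⟨fun i => (hα.1 i).add (hβ.1 i), fun i j x hx v => ?_⟩
  have h1 := hα.2 i j x hx v
  have h2 := hβ.2 i j x hx v
  simp [h1, h2]

lemma IsAdForm.const_smul {α : P.LocalForms k} (c : ℝ) (hα : P.IsAdForm α) :
    P.IsAdForm (c • α) := by
  refine ⟨fun i => (hα.1 i).const_smul c, fun i j x hx v => ?_⟩
  have h1 := hα.2 i j x hx v
  simp [h1]

lemma IsAdForm.congr {α β : P.LocalForms k} (hα : P.IsAdForm α)
    (h : ∀ i, ∀ x ∈ P.baseSet i, β i x = α i x) : P.IsAdForm β := by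
  refine ⟨fun i => (hα.1 i).congr (h i), fun i j x hx v => ?_⟩
  rw [h i x hx.1, h j x hx.2, hα.2 i j x hx v]

lemma IsConnection.add_smul {A η : P.LocalForms 1} (hA : P.IsConnection A) (hη : P.IsAdForm η)
    (t : ℝ) : P.IsConnection (A + t • η) := by
  refine ⟨fun i => (hA.1 i).add ((hη.1 i).const_smul t), fun i j x hx v => ?_⟩
  have h1 := hA.2 i j x hx v
  have h2 := hη.2 i j x hx ![v]
  simp only [Pi.add_apply, Pi.smul_apply, ContinuousAlternatingMap.add_apply,
    ContinuousAlternatingMap.smul_apply, h1, h2, map_add, map_smul]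
  abel

variable [IsManifold 𝓘(ℝ, E) ∞ M] [LieGroup 𝓘(ℝ, 𝔤) ∞ G]

lemma contMDiffAt_transition_chart (i j : ι) (x₀ : M) {y : E}
    (hy : y ∈ (chartAt E x₀).target)
    (hyU : (chartAt E x₀).symm y ∈ P.baseSet i ∩ P.baseSet j) :
    ContMDiffAt 𝓘(ℝ, E) 𝓘(ℝ, 𝔤) ∞ (fun z => P.transition i j ((chartAt E x₀).symm z)) y :=
  ((P.smooth i j).contMDiffAt (((P.isOpen_baseSet i).inter (P.isOpen_baseSet j)).mem_nhds
    hyU)).comp y ((contMDiffOn_chart_symm (I := 𝓘(ℝ, E)) (n := ∞)).contMDiffAt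
      ((chartAt E x₀).open_target.mem_nhds hy))

/-- In a chart, the gauge term is the logarithmic derivative of the transition function. -/
lemma gaugeTerm_chartSymmDeriv (i j : ι) (x₀ : M) {y : E}
    (hy : y ∈ (chartAt E x₀).target)
    (hyU : (chartAt E x₀).symm y ∈ P.baseSet i ∩ P.baseSet j) (v : E) :
    gaugeTerm (P.transition i j) ((chartAt E x₀).symm y) (chartSymmDeriv x₀ y v) =
      (logDeriv (fun z => P.transition i j ((chartAt E x₀).symm z)) y : E →L[ℝ] 𝔤) v := by
  set f := P.transition i j
  set p := (chartAt E x₀).symm y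
  have hf : ContMDiffAt 𝓘(ℝ, E) 𝓘(ℝ, 𝔤) ∞ f p :=
    (P.smooth i j).contMDiffAt (((P.isOpen_baseSet i).inter (P.isOpen_baseSet j)).mem_nhds hyU)
  have h1 : MDifferentiableAt 𝓘(ℝ, E) 𝓘(ℝ, 𝔤) (fun q => (f p)⁻¹ * f q) p :=
    ((contMDiff_mul_left (I := 𝓘(ℝ, 𝔤)) (n := ∞) (a := (f p)⁻¹)).contMDiffAt.comp p
      hf).mdifferentiableAt (by simp)
  have h2 := mdifferentiableAt_chart_symm x₀ hy
  have h3 := mfderiv_comp y h1 h2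
  have h4 := mfderiv_eq_fderiv_chart_left (h1.comp y h2)
  have h5 : (f p)⁻¹ * f p = 1 := by simp
  have h6 : (logDeriv (fun z => f ((chartAt E x₀).symm z)) y : E →L[ℝ] 𝔤) =
      fderiv ℝ (fun z => chartAt 𝔤 ((f p)⁻¹ * f p) ((f p)⁻¹ * f ((chartAt E x₀).symm z))) y := by
    rw [h5]; rfl
  rw [h6]
  exact (congrArg (fun T : E →L[ℝ] 𝔤 => T v) (h3.symm.trans h4) :)

variable [FiniteDimensional ℝ E] [FiniteDimensional ℝ 𝔤]

lemma IsConnection.smooth_curvature {A : P.LocalForms 1} (hA : P.IsConnection A) (i : ι) :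
    SmoothFormOn (P.curvature A i) (P.baseSet i) := by
  have h1 := (hA.1 i).extD (P.isOpen_baseSet i)
  refine h1.add (SmoothFormOn.const_smul (1 / 2 : ℝ) ?_)
  refine smoothFormOn_of_contDiffAt fun x₀ y hy hyU => ?_
  have h := (hA.1 i).contDiffAt (P.isOpen_baseSet i) x₀ hy hyU
  refine (contDiffAt_bracketLeft (G := G) h h).congr_of_eventuallyEq
    (Filter.Eventually.of_forall fun z => ?_)
  simp only [coordForm, bracketLeft_compContinuousLinearMap]

/-- The curvature is covariant: the inhomogeneous terms cancel by the Maurer-Cartan equation. -/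
lemma IsConnection.curvature_covariant {A : P.LocalForms 1} (hA : P.IsConnection A) (i j : ι)
    {x : M} (hx : x ∈ P.baseSet i ∩ P.baseSet j) (v : Fin 2 → E) :
    P.curvature A j x v = lieAd (P.transition i j x)⁻¹ (P.curvature A i x v) := by
  set F : E → G := fun z => P.transition i j ((chartAt E x).symm z) with hF
  set y₀ := chartAt E x x with hy₀
  have hxs : (chartAt E x).symm y₀ = x := (chartAt E x).left_inv (mem_chart_source E x)
  have hyt : y₀ ∈ (chartAt E x).target := mem_chart_target E x
  have hFs : ContMDiffAt 𝓘(ℝ, E) 𝓘(ℝ, 𝔤) ∞ F y₀ :=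
    contMDiffAt_transition_chart i j x hyt (by rwa [hxs])
  obtain ⟨D, hD, hD'⟩ := hasFDerivAt_lieAd_inv (𝔤 := 𝔤) hFs
  have hci : coordForm (A i) x y₀ = A i x := coordForm_self _ x
  have hi : DifferentiableAt ℝ (coordForm (A i) x) y₀ :=
    (hA.1 i).differentiableAt_coordForm_self (P.isOpen_baseSet i) hx.1
  have hj : DifferentiableAt ℝ (coordForm (A j) x) y₀ :=
    (hA.1 j).differentiableAt_coordForm_self (P.isOpen_baseSet j) hx.2
  have hFx : F y₀ = P.transition i j x := by simp only [hF, hxs]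
  -- The derivative of the gauge transformation law of the connection.
  have key : ∀ u w : E, fderiv ℝ (coordForm (A j) x) y₀ u ![w] =
      lieAd (P.transition i j x)⁻¹ (fderiv ℝ (coordForm (A i) x) y₀ u ![w])
      - lieBr G (logDeriv F y₀ u) (lieAd (P.transition i j x)⁻¹ (A i x ![w])) +
      fderiv ℝ (logDeriv F : E → E →L[ℝ] 𝔤) y₀ u w := by
    intro u w
    rw [fderiv_apply_form hj, fderiv_apply_form hi]
    have he : (fun z => coordForm (A j) x z ![w]) =ᶠ[𝓝 y₀] fun z =>
        lieAd (F z)⁻¹ (coordForm (A i) x z ![w]) + logDeriv F z w := by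
      have hc := (chartAt E x).continuousAt_symm hyt
      filter_upwards [(chartAt E x).open_target.mem_nhds hyt, hc.preimage_mem_nhds
        (((P.isOpen_baseSet i).inter (P.isOpen_baseSet j)).mem_nhds (by rwa [hxs]))] with z hz hz2
      have h := hA.2 i j _ hz2 (chartSymmDeriv x z w)
      rw [gaugeTerm_chartSymmDeriv i j x hz hz2] at h
      simp only [coordForm, ContinuousAlternatingMap.compContinuousLinearMap_apply, comp_singleton]
      exact h
    have h1 := (hD'.clm_apply (differentiableAt_apply_form hi ![w]).hasFDerivAt).add
      ((differentiableAt_logDeriv hFs).hasFDerivAt.clm_apply (hasFDerivAt_const w y₀))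
    rw [(h1.congr_of_eventuallyEq he).fderiv]
    simp only [hFx, hci, hD, add_apply, ContinuousLinearMap.comp_apply,
      ContinuousLinearMap.flip_apply, ContinuousLinearMap.comp_zero, zero_add]
    abel
  have hAj : ∀ w, A j x ![w] = lieAd (P.transition i j x)⁻¹ (A i x ![w]) + logDeriv F y₀ w := by
    intro w
    have h := gaugeTerm_chartSymmDeriv i j x hyt (by rwa [hxs]) w
    rw [chartSymmDeriv_self, hxs] at h
    rw [hA.2 i j x hx w]
    exact congrArg _ h
  have hv : v = ![v 0, v 1] := by ext i; fin_cases i <;> rfl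
  have hMC := fderiv_logDeriv_sub hFs (v 0) (v 1)
  rw [hv]
  have hs := fun a b : 𝔤 => lieBr_skew (G := G) a b
  simp only [curvature, extD_eq_extDeriv, ContinuousAlternatingMap.add_apply,
    ContinuousAlternatingMap.smul_apply, extDeriv_one, bracketLeft_apply_two, ← hy₀, key, hAj,
    map_add, map_sub, map_smul, lieAd_lieBr, add_apply]
  generalize fderiv ℝ (logDeriv F : E → E →L[ℝ] 𝔤) y₀ (v 0) (v 1) = p at hMC ⊢
  generalize fderiv ℝ (logDeriv F : E → E →L[ℝ] 𝔤) y₀ (v 1) (v 0) = q at hMC ⊢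
  obtain rfl := sub_eq_iff_eq_add.1 hMC
  generalize (logDeriv F y₀ : E →L[ℝ] 𝔤) (v 0) = θv
  generalize (logDeriv F y₀ : E →L[ℝ] 𝔤) (v 1) = θw
  generalize lieAd (P.transition i j x)⁻¹ (A i x ![v 0]) = av
  generalize lieAd (P.transition i j x)⁻¹ (A i x ![v 1]) = aw
  -- What remains is bilinear in `av`, `aw`, `θv`, `θw` once the brackets are put in a fixed order.
  rw [hs aw av, hs θw θv, hs aw θv, hs θw av]
  module

lemma IsConnection.isAdForm_curvature {A : P.LocalForms 1} (hA : P.IsConnection A) :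
    P.IsAdForm (P.curvature A) :=
  ⟨hA.smooth_curvature, fun i j _ hx v => hA.curvature_covariant i j hx v⟩

end PrincipalBundle

end PrimYM

end

noncomputable section

namespace PrimYM

/-! ### Dual frames -/

section Frames

variable {E : Type*} [AddCommGroup E] [Module ℝ E] {ι ι' : Type*} [Fintype ι] [Fintype ι']
  {W : Type*} [AddCommGroup W] [Module ℝ W]

/-- Two families `a`, `d` of vectors are dual frames for the bilinear form `q`: every vector has the
two expansions `u = ∑ q(dᵢ, u) aᵢ = ∑ q(u, aᵢ) dᵢ`. -/
structure IsDualFrame (q : E →ₗ[ℝ] E →ₗ[ℝ] ℝ) (a d : ι → E) : Prop where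
  expand : ∀ u, ∑ i, q (d i) u • a i = u
  expand_dual : ∀ u, ∑ i, q u (a i) • d i = u

/-- The contraction of a bilinear map with dual frames does not depend on the frames. -/
lemma IsDualFrame.sum_eq {q : E →ₗ[ℝ] E →ₗ[ℝ] ℝ} {a d : ι → E} {a' d' : ι' → E}
    (h : IsDualFrame q a d) (h' : IsDualFrame q a' d') (B : E →ₗ[ℝ] E →ₗ[ℝ] W) :
    ∑ i, B (a i) (d i) = ∑ i, B (a' i) (d' i) := by
  have h1 : ∀ i, B (a' i) (d' i) = ∑ j, q (d j) (a' i) • B (a j) (d' i) := fun i => by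
    conv_lhs => rw [← h.expand (a' i)]
    simp
  have h2 : ∀ j, B (a j) (d j) = ∑ i, q (d j) (a' i) • B (a j) (d' i) := fun j => by
    conv_lhs => rw [← h'.expand_dual (d j)]
    simp
  simp only [h1, h2]
  rw [Finset.sum_comm]

/-- The contraction of two pairs of arguments with dual frames does not depend on the frames. -/
lemma IsDualFrame.sum_sum_eq {q : E →ₗ[ℝ] E →ₗ[ℝ] ℝ} {a d : ι → E} {a' d' : ι' → E}
    (h : IsDualFrame q a d) (h' : IsDualFrame q a' d')
    (B : E →ₗ[ℝ] E →ₗ[ℝ] E →ₗ[ℝ] E →ₗ[ℝ] W) :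
    ∑ i, ∑ j, B (a i) (d i) (a j) (d j) = ∑ i, ∑ j, B (a' i) (d' i) (a' j) (d' j) := by
  have h1 : ∀ i, ∑ j, B (a i) (d i) (a j) (d j) = ∑ j, B (a i) (d i) (a' j) (d' j) :=
    fun i => h.sum_eq h' (B (a i) (d i))
  simp only [h1]
  rw [Finset.sum_comm]
  refine Eq.trans ?_ Finset.sum_comm
  refine Finset.sum_congr rfl fun j _ => ?_
  let B' : E →ₗ[ℝ] E →ₗ[ℝ] W := LinearMap.mk₂ ℝ (fun u v => B u v (a' j) (d' j)) (by simp) (by simp)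
    (by simp) (by simp)
  exact h.sum_eq h' B'

/-- Dual frames are transported by an isomorphism. -/
lemma IsDualFrame.map {E' : Type*} [AddCommGroup E'] [Module ℝ E'] {q : E →ₗ[ℝ] E →ₗ[ℝ] ℝ}
    {q' : E' →ₗ[ℝ] E' →ₗ[ℝ] ℝ} {a d : ι → E} (h : IsDualFrame q a d) (T : E →ₗ[ℝ] E')
    (S : E' →ₗ[ℝ] E) (hTS : ∀ v, T (S v) = v) (hq : ∀ u v, q' (T u) (T v) = q u v) :
    IsDualFrame q' (fun i => T (a i)) (fun i => T (d i)) := by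
  constructor
  · intro u
    conv_rhs => rw [← hTS u, ← h.expand (S u)]
    rw [map_sum]
    refine Finset.sum_congr rfl fun i _ => ?_
    rw [map_smul, ← hq, hTS]
  · intro u
    conv_rhs => rw [← hTS u, ← h.expand_dual (S u)]
    rw [map_sum]
    refine Finset.sum_congr rfl fun i _ => ?_
    rw [map_smul, ← hq, hTS]

lemma update_pair_zero {E : Type*} (u u' v : E) : Function.update ![u', v] 0 u = ![u, v] := by
  ext i; fin_cases i <;> simp

lemma update_pair_one {E : Type*} (u v v' : E) : Function.update ![u, v'] 1 v = ![u, v] := by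
  ext i; fin_cases i <;> simp

/-- A 2-form as a bilinear map. -/
def twoFormBilin {E V : Type*} [NormedAddCommGroup E] [NormedSpace ℝ E] [NormedAddCommGroup V]
    [NormedSpace ℝ V] (α : E [⋀^Fin 2]→L[ℝ] V) : E →ₗ[ℝ] E →ₗ[ℝ] V :=
  LinearMap.mk₂ ℝ (fun u v => α ![u, v])
    (fun u u' v => by
      simpa only [update_pair_zero] using α.map_update_add ![0, v] 0 u u')
    (fun c u v => by
      simpa only [update_pair_zero] using α.map_update_smul ![0, v] 0 c u)
    (fun u v v' => by
      simpa only [update_pair_one] using α.map_update_add ![u, 0] 1 v v')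
    (fun c u v => by
      simpa only [update_pair_one] using α.map_update_smul ![u, 0] 1 c v)

@[simp] lemma twoFormBilin_apply {E V : Type*} [NormedAddCommGroup E] [NormedSpace ℝ E]
    [NormedAddCommGroup V] [NormedSpace ℝ V] (α : E [⋀^Fin 2]→L[ℝ] V) (u v : E) :
    twoFormBilin α u v = α ![u, v] := rfl

/-- A 1-form as a linear map. -/
def oneFormLin {E V : Type*} [NormedAddCommGroup E] [NormedSpace ℝ E] [NormedAddCommGroup V]
    [NormedSpace ℝ V] (α : E [⋀^Fin 1]→L[ℝ] V) : E →ₗ[ℝ] V where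
  toFun u := α ![u]
  map_add' := oneForm_add α
  map_smul' := oneForm_smul α

@[simp] lemma oneFormLin_apply {E V : Type*} [NormedAddCommGroup E] [NormedSpace ℝ E]
    [NormedAddCommGroup V] [NormedSpace ℝ V] (α : E [⋀^Fin 1]→L[ℝ] V) (u : E) :
    oneFormLin α u = α ![u] := rfl

end Frames

section StdFrame

variable {n : ℕ}

lemma sum_coord_smul_stdB (u : Model n) : ∑ i, u i • stdB i = u := by
  ext j
  simp [stdB, Pi.single_apply]

lemma stdB_eq_basisFun (i : Fin (2 * n)) :
    (stdB i : Model n) = (EuclideanSpace.basisFun (Fin (2 * n)) ℝ).toBasis i := by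
  simp [stdB]

lemma linearIndependent_stdB : LinearIndependent ℝ (stdB : Fin (2 * n) → Model n) := by
  have h := (EuclideanSpace.basisFun (Fin (2 * n)) ℝ).toBasis.linearIndependent
  rwa [← (funext stdB_eq_basisFun : (stdB : Fin (2 * n) → Model n) = _)] at h

/-- The Gram matrix in the standard basis of a bilinear form. -/
def gramOf (q : Model n →ₗ[ℝ] Model n →ₗ[ℝ] ℝ) : Matrix (Fin (2 * n)) (Fin (2 * n)) ℝ :=
  Matrix.of fun i j => q (stdB i) (stdB j)

/-- The family dual to the standard basis with respect to a bilinear form. -/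
def dualOf (q : Model n →ₗ[ℝ] Model n →ₗ[ℝ] ℝ) (i : Fin (2 * n)) : Model n :=
  ∑ j, (gramOf q)⁻¹ i j • stdB j

lemma isUnit_det_gramOf {q : Model n →ₗ[ℝ] Model n →ₗ[ℝ] ℝ}
    (hpos : ∀ u, u ≠ 0 → 0 < q u u) : IsUnit (gramOf q).det := by
  rw [isUnit_iff_ne_zero]
  intro h0
  obtain ⟨v, hv, hv0⟩ := Matrix.exists_vecMul_eq_zero_iff.2 h0
  set u : Model n := ∑ i, v i • stdB i with hu
  have hne : u ≠ 0 := by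
    intro hu0
    exact hv (funext fun i => Fintype.linearIndependent_iff.1 linearIndependent_stdB v hu0 i)
  have h1 : ∀ j, q u (stdB j) = 0 := fun j => by
    have := congrFun hv0 j
    simpa [Matrix.vecMul, dotProduct, gramOf, hu] using this
  have h2 : q u u = 0 := by
    conv_lhs => rw [hu, map_sum]
    simp [← hu, h1]
  exact absurd h2 (hpos u hne).ne'

lemma dualOf_apply {q : Model n →ₗ[ℝ] Model n →ₗ[ℝ] ℝ}
    (hpos : ∀ u, u ≠ 0 → 0 < q u u) (i j : Fin (2 * n)) :
    q (dualOf q i) (stdB j) = if i = j then 1 else 0 := by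
  have h := congrFun (congrFun (Matrix.nonsing_inv_mul _ (isUnit_det_gramOf hpos)) i) j
  simpa [Matrix.mul_apply, gramOf, dualOf, Matrix.one_apply] using h

lemma isDualFrame_dualOf {q : Model n →ₗ[ℝ] Model n →ₗ[ℝ] ℝ}
    (hpos : ∀ u, u ≠ 0 → 0 < q u u) :
    IsDualFrame q stdB (dualOf q) := by
  have h1 : ∀ u i, q (dualOf q i) u = u i := fun u i => by
    conv_lhs => rw [← sum_coord_smul_stdB u, map_sum]
    simp [dualOf_apply hpos]
  refine ⟨fun u => ?_, fun u => ?_⟩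
  · simp only [h1]; exact sum_coord_smul_stdB u
  · have h2 : ∀ i, stdB i = ∑ k, q (stdB i) (stdB k) • dualOf q k := fun i => by
      simp only [dualOf, Finset.smul_sum, smul_smul]
      rw [Finset.sum_comm]
      simp only [← Finset.sum_smul]
      have h := congrFun (Matrix.mul_nonsing_inv _ (isUnit_det_gramOf hpos)) i
      have h' : ∀ j, ∑ k, q (stdB i) (stdB k) * (gramOf q)⁻¹ k j = if i = j then 1 else 0 :=
        fun j => by
          have := congrFun h j
          simpa [Matrix.mul_apply, gramOf, Matrix.one_apply] using this
      simp [h']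
    conv_rhs => rw [← sum_coord_smul_stdB u]
    conv_lhs => rw [← sum_coord_smul_stdB u]
    simp only [map_sum, map_smul, LinearMap.sum_apply, LinearMap.smul_apply, Finset.sum_smul,
      smul_eq_mul, mul_smul]
    rw [Finset.sum_comm]
    refine Finset.sum_congr rfl fun i _ => ?_
    rw [← Finset.smul_sum, ← h2]

end StdFrame

end PrimYM

end

noncomputable section

namespace PrimYM

/-! ### The Pfaffian -/

section Pfaffian

/-- The value on two symplectic basis vectors of the standard symplectic form. -/
def stdSymp {n : ℕ} (r s : Fin n × Fin 2) : ℝ :=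
  if r.1 = s.1 then (if r.2 = 0 ∧ s.2 = 1 then 1 else if r.2 = 1 ∧ s.2 = 0 then -1 else 0) else 0

lemma sign_perm_fin_two (a : Equiv.Perm (Fin 2)) :
    ((Equiv.Perm.sign a : ℤ) : ℝ) =
      if a 0 = 0 ∧ a 1 = 1 then 1 else if a 0 = 1 ∧ a 1 = 0 then -1 else 0 := by
  have h : ∀ a : Equiv.Perm (Fin 2), (Equiv.Perm.sign a : ℤ) =
      if a 0 = 0 ∧ a 1 = 1 then 1 else if a 0 = 1 ∧ a 1 = 0 then -1 else 0 := by decide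
  rw [h a]
  push_cast
  rfl

/-- The Pfaffian of the standard symplectic form: the permutations with a nonzero contribution
permute the symplectic pairs and the members of each pair, and each of them contributes `1`. -/
lemma sum_perm_stdSymp (n : ℕ) :
    ∑ τ : Equiv.Perm (Fin n × Fin 2), ((Equiv.Perm.sign τ : ℤ) : ℝ) *
      ∏ i : Fin n, stdSymp (τ (i, 0)) (τ (i, 1)) = 2 ^ n * (n.factorial : ℝ) := by
  let e : Equiv.Perm (Fin n) × (Fin n → Equiv.Perm (Fin 2)) → Equiv.Perm (Fin n × Fin 2) :=
    fun p => Equiv.prodCongrLeft (fun _ : Fin 2 => p.1) * Equiv.prodCongrRight p.2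
  have he : ∀ p i j, e p (i, j) = (p.1 i, p.2 i j) := fun p i j => rfl
  have hinj : Function.Injective e := by
    intro p p' h
    have h1 : ∀ i j, (p.1 i, p.2 i j) = (p'.1 i, p'.2 i j) := fun i j => by
      rw [← he, ← he, h]
    refine Prod.ext (Equiv.ext fun i => ?_) (funext fun i => Equiv.ext fun j => ?_)
    · exact (Prod.ext_iff.1 (h1 i 0)).1
    · exact (Prod.ext_iff.1 (h1 i j)).2
  rw [← Fintype.sum_of_injective e hinj (fun _ => (1 : ℝ))]
  · simp [Fintype.card_perm, mul_comm]
  · intro τ hτ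
    by_contra hne
    apply hτ
    have hne' := Finset.prod_ne_zero_iff.1 (right_ne_zero_of_mul hne)
    have h1 : ∀ i, (τ (i, 0)).1 = (τ (i, 1)).1 := fun i => by
      by_contra h
      exact hne' i (Finset.mem_univ i) (by simp [stdSymp, h])
    have h1' : ∀ i j, (τ (i, j)).1 = (τ (i, 0)).1 := fun i j => by
      fin_cases j
      · rfl
      · exact (h1 i).symm
    have hsurj : Function.Surjective fun i => (τ (i, 0)).1 := fun m => by
      refine ⟨(τ.symm (m, 0)).1, ?_⟩
      have h2 := h1' (τ.symm (m, 0)).1 (τ.symm (m, 0)).2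
      simp only [Prod.mk.eta, Equiv.apply_symm_apply] at h2
      exact h2.symm
    have hainj : ∀ i, Function.Injective fun j => (τ (i, j)).2 := fun i j j' hj => by
      have h3 : τ (i, j) = τ (i, j') := Prod.ext ((h1' i j).trans (h1' i j').symm) hj
      exact (Prod.ext_iff.1 (τ.injective h3)).2
    refine ⟨(Equiv.ofBijective _ (Finite.injective_iff_bijective.1
      (Finite.injective_iff_surjective.2 hsurj)), fun i => Equiv.ofBijective _
      (Finite.injective_iff_bijective.1 (hainj i))), ?_⟩
    ext ⟨i, j⟩ : 1
    rw [he]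
    exact Prod.ext (h1' i j).symm rfl
  · intro p
    have hs : Equiv.Perm.sign (e p) = ∏ i, Equiv.Perm.sign (p.2 i) := by
      simp only [e, Equiv.Perm.sign_mul, Equiv.Perm.sign_prodCongrLeft,
        Equiv.Perm.sign_prodCongrRight]
      simp
    rw [hs]
    push_cast
    rw [← Finset.prod_mul_distrib]
    symm
    apply Finset.prod_eq_one
    intro i _
    have h5 : stdSymp (e p (i, 0)) (e p (i, 1)) = ((Equiv.Perm.sign (p.2 i) : ℤ) : ℝ) := by
      rw [sign_perm_fin_two]
      simp [stdSymp, he]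
    rw [h5, ← Int.cast_mul, ← Units.val_mul, Int.units_mul_self]
    simp

variable {n : ℕ}

/-- The indices `2 i` and `2 i + 1` of the `i`-th pair. -/
def pairIdx (i : Fin n) (a : Fin 2) : Fin (2 * n) := ⟨2 * i + a, by omega⟩

/-- Pairs of indices. -/
def pairEquiv (n : ℕ) : Fin n × Fin 2 ≃ Fin (2 * n) :=
  finProdFinEquiv.trans (finCongr (mul_comm n 2))

lemma pairEquiv_apply (i : Fin n) (a : Fin 2) : pairEquiv n (i, a) = pairIdx i a := by
  apply Fin.ext
  simp [pairEquiv, pairIdx, finProdFinEquiv, add_comm]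

variable {E : Type*} [AddCommGroup E] [Module ℝ E]

lemma exists_linear_prod_update (ϖ : E →ₗ[ℝ] E →ₗ[ℝ] ℝ) (v : Fin (2 * n) → E) (j : Fin (2 * n)) :
    ∃ L : E →ₗ[ℝ] ℝ, ∀ a, ∏ i : Fin n, ϖ (Function.update v j a (pairIdx i 0))
      (Function.update v j a (pairIdx i 1)) = L a := by
  obtain ⟨⟨i₀, c⟩, rfl⟩ := (pairEquiv n).surjective j
  rw [pairEquiv_apply]
  set C := ∏ i ∈ Finset.univ.erase i₀, ϖ (v (pairIdx i 0)) (v (pairIdx i 1)) with hC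
  have hne : ∀ i a, i ≠ i₀ → pairIdx i a ≠ pairIdx i₀ c := fun i a hi h => by
    rw [← pairEquiv_apply, ← pairEquiv_apply] at h
    exact hi (Prod.ext_iff.1 ((pairEquiv n).injective h)).1
  have h1 : ∀ a, ∏ i : Fin n, ϖ (Function.update v (pairIdx i₀ c) a (pairIdx i 0))
      (Function.update v (pairIdx i₀ c) a (pairIdx i 1)) =
      ϖ (Function.update v (pairIdx i₀ c) a (pairIdx i₀ 0))
      (Function.update v (pairIdx i₀ c) a (pairIdx i₀ 1)) * C := fun a => by
    rw [← Finset.mul_prod_erase Finset.univ _ (Finset.mem_univ i₀), hC]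
    congr 1
    refine Finset.prod_congr rfl fun i hi => ?_
    rw [Function.update_of_ne (hne i 0 (Finset.ne_of_mem_erase hi)),
      Function.update_of_ne (hne i 1 (Finset.ne_of_mem_erase hi))]
  have h01 : pairIdx i₀ 0 ≠ pairIdx i₀ 1 := fun h => by simp [pairIdx] at h
  fin_cases c
  · refine ⟨C • ϖ.flip (v (pairIdx i₀ 1)), fun a => ?_⟩
    rw [h1]
    simp [Function.update_of_ne h01.symm, mul_comm]
  · refine ⟨C • ϖ (v (pairIdx i₀ 0)), fun a => ?_⟩
    rw [h1]
    simp [Function.update_of_ne h01, mul_comm]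

/-- The multilinear map whose alternatization is a multiple of the top power of `ϖ`. -/
def pairProd (ϖ : E →ₗ[ℝ] E →ₗ[ℝ] ℝ) : MultilinearMap ℝ (fun _ : Fin (2 * n) => E) ℝ where
  toFun v := ∏ i : Fin n, ϖ (v (pairIdx i 0)) (v (pairIdx i 1))
  map_update_add' v j a b := by
    rename_i inst
    obtain rfl : inst = instDecidableEqFin (2 * n) := Subsingleton.elim _ _
    obtain ⟨L, hL⟩ := exists_linear_prod_update ϖ v j
    simp only [hL, map_add]
  map_update_smul' v j c a := by
    rename_i inst
    obtain rfl : inst = instDecidableEqFin (2 * n) := Subsingleton.elim _ _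
    obtain ⟨L, hL⟩ := exists_linear_prod_update ϖ v j
    simp only [hL, map_smul]

lemma alternatization_pairProd_apply (ϖ : E →ₗ[ℝ] E →ₗ[ℝ] ℝ) (v : Fin (2 * n) → E) :
    MultilinearMap.alternatization (pairProd (n := n) ϖ) v =
      ∑ σ : Equiv.Perm (Fin (2 * n)), ((Equiv.Perm.sign σ : ℤ) : ℝ) *
        ∏ i : Fin n, ϖ (v (σ (pairIdx i 0))) (v (σ (pairIdx i 1))) := by
  rw [MultilinearMap.alternatization_apply]
  refine Finset.sum_congr rfl fun σ _ => ?_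
  simp [pairProd, Units.smul_def]

/-- The alternatization of the product takes the value `2 ^ n n!` on a symplectic basis. -/
lemma alternatization_pairProd_stdSymp (ϖ : E →ₗ[ℝ] E →ₗ[ℝ] ℝ) (b : Fin n × Fin 2 → E)
    (hb : ∀ r s, ϖ (b r) (b s) = stdSymp r s) :
    MultilinearMap.alternatization (pairProd (n := n) ϖ) (b ∘ (pairEquiv n).symm) =
      2 ^ n * (n.factorial : ℝ) := by
  rw [alternatization_pairProd_apply, ← sum_perm_stdSymp]
  refine Fintype.sum_equiv (pairEquiv n).permCongr.symm _ _ fun σ => ?_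
  rw [← Equiv.Perm.sign_permCongr (pairEquiv n) ((pairEquiv n).permCongr.symm σ),
    Equiv.apply_symm_apply]
  congr 1
  refine Finset.prod_congr rfl fun i _ => ?_
  simp [hb, Equiv.permCongr_symm, Equiv.permCongr_apply, ← pairEquiv_apply]

end Pfaffian

section VolumeForm

variable {n : ℕ} {M : Type*} [TopologicalSpace M] [ChartedSpace (Model n) M]
  [IsManifold 𝓘(ℝ, Model n) ∞ M]

lemma detForm_apply (v : Fin (2 * n) → Model n) :
    detForm n v = (EuclideanSpace.basisFun (Fin (2 * n)) ℝ).toBasis.det v := rfl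

/-- The determinant spans the forms of top degree. -/
lemma alternating_eq_smul_detForm (f : (Model n) [⋀^Fin (2 * n)]→ₗ[ℝ] ℝ)
    (v : Fin (2 * n) → Model n) : f v = f stdB * detForm n v := by
  have h := congrArg (fun g => g v)
    (f.eq_smul_basis_det (EuclideanSpace.basisFun (Fin (2 * n)) ℝ).toBasis)
  have h2 : ⇑(EuclideanSpace.basisFun (Fin (2 * n)) ℝ).toBasis = stdB :=
    (funext stdB_eq_basisFun).symm
  rw [h2] at h
  exact h

lemma detForm_stdB : detForm n stdB = 1 := by
  rw [detForm_apply, (funext stdB_eq_basisFun : (stdB : Fin (2 * n) → Model n) = _)]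
  exact Module.Basis.det_self _

/-- `Ω ^ n / n!` as an alternatization, which evaluates it on an arbitrary basis. -/
lemma volForm_apply (Ω : SymplecticForm n M) (x : M) (v : Fin (2 * n) → Model n) :
    volForm Ω x v = (1 / (2 ^ n * (n.factorial : ℝ))) *
      MultilinearMap.alternatization (pairProd (n := n) (twoFormBilin (Ω.form x))) v := by
  rw [alternating_eq_smul_detForm, alternatization_pairProd_apply, ← mul_assoc]
  rfl

lemma detForm_sq_mul_det_gramOf (q : Model n →ₗ[ℝ] Model n →ₗ[ℝ] ℝ) (v : Fin (2 * n) → Model n) :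
    (Matrix.of fun i j => q (v i) (v j)).det = detForm n v ^ 2 * (gramOf q).det := by
  set B := (EuclideanSpace.basisFun (Fin (2 * n)) ℝ).toBasis.toMatrix v with hB
  have hBv : ∀ i k, B k i = v i k := fun i k => by simp [hB, Module.Basis.toMatrix_apply]
  have h1 : (Matrix.of fun i j => q (v i) (v j)) = B.transpose * gramOf q * B := by
    ext i j
    have e : ∀ i, v i = ∑ k, B k i • stdB k := fun i => by
      simp only [hBv]; exact (sum_coord_smul_stdB (v i)).symm
    rw [Matrix.of_apply, e i, e j]
    simp only [map_sum, map_smul, LinearMap.sum_apply, LinearMap.smul_apply, smul_eq_mul,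
      Matrix.mul_apply, Matrix.transpose_apply, gramOf, Matrix.of_apply, Finset.sum_mul,
      Finset.mul_sum]
    refine Finset.sum_congr rfl fun k _ => Finset.sum_congr rfl fun l _ => ?_
    ring
  rw [h1, Matrix.det_mul, Matrix.det_mul, Matrix.det_transpose, detForm_apply,
    Module.Basis.det_apply]
  ring

/-- A compatible complex structure has a unitary basis: vectors `v` orthogonal to all `vᵢ` and
`J vᵢ` are added one by one. -/
lemma exists_unitary_basis (q ϖ : Model n →ₗ[ℝ] Model n →ₗ[ℝ] ℝ) (J : Model n → Model n)
    (hsymm : ∀ u v, q u v = q v u) (hpos : ∀ u, u ≠ 0 → 0 < q u u)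
    (hϖ : ∀ u v, ϖ u v = -ϖ v u) (hJ : ∀ u, J (J u) = -u) (hc : ∀ u v, q u v = ϖ u (J v)) :
    ∃ b : Fin n × Fin 2 → Model n, (∀ r s, ϖ (b r) (b s) = stdSymp r s) ∧
      ∀ r s, q (b r) (b s) = if r = s then 1 else 0 := by
  have hϖq : ∀ u v, ϖ u v = -q u (J v) := fun u v => by rw [hc, hJ]; simp
  have hJq : ∀ u v, q (J u) v = -q u (J v) := fun u v => by
    rw [hsymm, ← neg_eq_iff_eq_neg, ← hϖq v u, hϖ, hϖq, neg_neg]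
  have hJJ : ∀ u v, q (J u) (J v) = q u v := fun u v => by rw [hJq, hJ]; simp
  have hself : ∀ u, q u (J u) = 0 := fun u => by
    have h1 := hJq u u
    rw [hsymm] at h1
    linarith
  have key : ∀ m ≤ n, ∃ v : Fin m → Model n, (∀ i j, q (v i) (v j) = if i = j then 1 else 0) ∧
      ∀ i j, q (v i) (J (v j)) = 0 := by
    intro m
    induction m with
    | zero => exact fun _ => ⟨fun i => i.elim0, fun i => i.elim0, fun i => i.elim0⟩
    | succ m ih =>
      intro hm
      obtain ⟨v, hv1, hv2⟩ := ih (by omega)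
      let f : Model n →ₗ[ℝ] (Fin m ⊕ Fin m → ℝ) :=
        LinearMap.pi (Sum.elim (fun i => q (v i)) fun i => q (J (v i)))
      have hker : LinearMap.ker f ≠ ⊥ := by
        apply LinearMap.ker_ne_bot_of_finrank_lt
        simp
        omega
      obtain ⟨u, hu, hu0⟩ := Submodule.exists_mem_ne_zero_of_ne_bot hker
      have hfu : ∀ s, f u s = 0 := fun s => congrFun (LinearMap.mem_ker.1 hu) s
      have hu1 : ∀ i, q (v i) u = 0 := fun i => hfu (Sum.inl i)
      have hu2 : ∀ i, q (J (v i)) u = 0 := fun i => hfu (Sum.inr i)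
      set c := (Real.sqrt (q u u))⁻¹ with hc'
      have hcu : c * (c * q u u) = 1 := by
        have hp := hpos u hu0
        rw [hc', ← mul_assoc, ← mul_inv, Real.mul_self_sqrt hp.le, inv_mul_cancel₀ hp.ne']
      have hw1 : ∀ i, q (v i) (c • u) = 0 := fun i => by simp [hu1]
      have hw2 : ∀ i, q (J (v i)) (c • u) = 0 := fun i => by simp [hu2]
      have hww : q (c • u) (c • u) = 1 := by simpa using hcu
      refine ⟨Fin.snoc v (c • u), ?_, ?_⟩
      · intro i j
        refine Fin.lastCases ?_ (fun i => ?_) i <;> refine Fin.lastCases ?_ (fun j => ?_) j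
        · simpa using hcu
        · rw [Fin.snoc_last, Fin.snoc_castSucc, hsymm, hw1]
          simp [(Fin.castSucc_lt_last j).ne']
        · rw [Fin.snoc_last, Fin.snoc_castSucc, hw1]
          simp [(Fin.castSucc_lt_last i).ne]
        · simp [hv1]
      · intro i j
        refine Fin.lastCases ?_ (fun i => ?_) i <;> refine Fin.lastCases ?_ (fun j => ?_) j
        · rw [Fin.snoc_last, hself]
        · rw [Fin.snoc_last, Fin.snoc_castSucc, hsymm, hw2]
        · rw [Fin.snoc_last, Fin.snoc_castSucc, ← neg_eq_iff_eq_neg.2 (hJq _ _), hw2, neg_zero]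
        · simp [hv2]
  obtain ⟨v, hv1, hv2⟩ := key n le_rfl
  have hv3 : ∀ i j, q (J (v i)) (v j) = 0 := fun i j => by rw [hsymm, hv2]
  refine ⟨fun r => if r.2 = 0 then v r.1 else J (v r.1), ?_, ?_⟩
  · rintro ⟨i, a⟩ ⟨j, c⟩
    fin_cases a <;> fin_cases c <;> simp [stdSymp, hϖq, hv1, hv2, hv3, hJJ, hJ]
    split_ifs <;> simp
  · rintro ⟨i, a⟩ ⟨j, c⟩
    fin_cases a <;> fin_cases c <;> simp [hv1, hv2, hv3, hJJ]

end VolumeForm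

end PrimYM

end

noncomputable section

namespace PrimYM

/-! ### Pointwise metric and symplectic linear algebra -/

section DoubleContraction

variable {E : Type*} [AddCommGroup E] [Module ℝ E] {ι ι' : Type*} [Fintype ι] [Fintype ι']
  {X Y W : Type*} [AddCommGroup W] [Module ℝ W] [AddCommGroup X] [Module ℝ X]
  [AddCommGroup Y] [Module ℝ Y]

lemma IsDualFrame.symm {q : E →ₗ[ℝ] E →ₗ[ℝ] ℝ} (hq : ∀ u v, q u v = q v u) {a d : ι → E}
    (h : IsDualFrame q a d) : IsDualFrame q d a :=
  ⟨fun u => by simpa only [hq] using h.expand_dual u, fun u => by simpa only [hq] using h.expand u⟩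

/-- The full contraction of two bilinear maps does not depend on the dual frames. -/
lemma IsDualFrame.sum_sum_bilin {q : E →ₗ[ℝ] E →ₗ[ℝ] ℝ} {a d : ι → E} {a' d' : ι' → E}
    (h : IsDualFrame q a d) (h' : IsDualFrame q a' d') (β : X →ₗ[ℝ] Y →ₗ[ℝ] W)
    (f : E →ₗ[ℝ] E →ₗ[ℝ] X) (f' : E →ₗ[ℝ] E →ₗ[ℝ] Y) :
    ∑ i, ∑ j, β (f (a i) (a j)) (f' (d i) (d j)) =
      ∑ i, ∑ j, β (f (a' i) (a' j)) (f' (d' i) (d' j)) := by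
  let B₂ : E → E → E →ₗ[ℝ] E →ₗ[ℝ] W := fun u u' =>
    LinearMap.mk₂ ℝ (fun v v' => β (f u v) (f' u' v')) (by simp) (by simp) (by simp) (by simp)
  let B : E →ₗ[ℝ] E →ₗ[ℝ] E →ₗ[ℝ] E →ₗ[ℝ] W :=
    LinearMap.mk₂ ℝ B₂ (fun u u₁ u' => by ext v v'; simp [B₂])
      (fun c u u' => by ext v v'; simp [B₂])
      (fun u u' u₁ => by ext v v'; simp [B₂]) (fun c u u' => by ext v v'; simp [B₂])
  exact h.sum_sum_eq h' B

end DoubleContraction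

section Pointwise

variable {n : ℕ} {M : Type*} [TopologicalSpace M] [ChartedSpace (Model n) M]
  [IsManifold 𝓘(ℝ, Model n) ∞ M]
  {V : Type*} [NormedAddCommGroup V] [NormedSpace ℝ V]
  (Ω : SymplecticForm n M) (g : Metric n M)

/-- The scalar product of tangent vectors at `x`, as a bilinear form. -/
def metricBilin (x : M) : Model n →ₗ[ℝ] Model n →ₗ[ℝ] ℝ :=
  LinearMap.mk₂ ℝ (metricAt g x)
    (fun u u' v => congrArg (fun f : Model n →L[ℝ] ℝ => f v) ((g.inner x).map_add u u'))
    (fun c u v => congrArg (fun f : Model n →L[ℝ] ℝ => f v) ((g.inner x).map_smul c u))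
    (fun u v v' => ContinuousLinearMap.map_add (g.inner x u) v v')
    (fun c u v => ContinuousLinearMap.map_smul (g.inner x u) c v)

lemma metricBilin_apply (x : M) (u v : Model n) : metricBilin g x u v = metricAt g x u v := rfl

lemma metricBilin_symm (x : M) (u v : Model n) : metricBilin g x u v = metricBilin g x v u :=
  g.symm x u v

lemma metricBilin_pos (x : M) (u : Model n) (hu : u ≠ 0) : 0 < metricBilin g x u u :=
  g.pos x u hu

lemma isDualFrame_dualB (x : M) : IsDualFrame (metricBilin g x) stdB (dualB g x) :=
  isDualFrame_dualOf (metricBilin_pos g x)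

lemma gram_eq_gramOf (x : M) : gram g x = gramOf (metricBilin g x) := rfl

lemma metricBilin_dualB (x : M) (i j : Fin (2 * n)) :
    metricBilin g x (dualB g x i) (stdB j) = if i = j then 1 else 0 :=
  dualOf_apply (metricBilin_pos g x) i j

lemma sum_fin_two_fun {ι W : Type*} [Fintype ι] [AddCommMonoid W] (F : (Fin 2 → ι) → W) :
    ∑ f, F f = ∑ i, ∑ j, F ![i, j] := by
  rw [← Fintype.sum_prod_type', ← (finTwoArrowEquiv ι).symm.sum_comp]
  rfl

lemma sum_fin_one_fun {ι W : Type*} [Fintype ι] [AddCommMonoid W] (F : (Fin 1 → ι) → W) :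
    ∑ f, F f = ∑ i, F ![i] := by
  rw [← (Equiv.funUnique (Fin 1) ι).symm.sum_comp]
  refine Finset.sum_congr rfl fun i _ => congrArg F ?_
  ext a; fin_cases a; rfl

lemma comp_pair {X Y : Type*} (e : X → Y) (i j : X) :
    (fun a : Fin 2 => e ((![i, j] : Fin 2 → X) a)) = ![e i, e j] := by
  ext a; fin_cases a <;> rfl

lemma comp_single {X Y : Type*} (e : X → Y) (i : X) :
    (fun a : Fin 1 => e ((![i] : Fin 1 → X) a)) = ![e i] := by
  ext a; fin_cases a; rfl

lemma formInner_two (κ : V →L[ℝ] V →L[ℝ] ℝ) (x : M) (α β : (Model n) [⋀^Fin 2]→L[ℝ] V) :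
    formInner g κ x α β = (1 / 2) * ∑ i, ∑ j,
      κ (α ![stdB i, stdB j]) (β ![dualB g x i, dualB g x j]) := by
  rw [formInner, sum_fin_two_fun]
  simp only [comp_pair]
  norm_num

lemma formInner_one (κ : V →L[ℝ] V →L[ℝ] ℝ) (x : M) (α β : (Model n) [⋀^Fin 1]→L[ℝ] V) :
    formInner g κ x α β = ∑ i, κ (α ![stdB i]) (β ![dualB g x i]) := by
  rw [formInner, sum_fin_one_fun]
  simp only [comp_single]
  norm_num

/-- A continuous bilinear map as a bilinear map. -/
def bilinOf {X Y W : Type*} [NormedAddCommGroup X] [NormedSpace ℝ X] [NormedAddCommGroup Y]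
    [NormedSpace ℝ Y] [NormedAddCommGroup W] [NormedSpace ℝ W] (κ : X →L[ℝ] Y →L[ℝ] W) :
    X →ₗ[ℝ] Y →ₗ[ℝ] W :=
  LinearMap.mk₂ ℝ (fun u v => κ u v) (by simp) (by simp) (by simp) (by simp)

/-- The scalar product of 2-forms may be computed in any dual frames. -/
lemma formInner_two_of_isDualFrame {ι : Type*} [Fintype ι] (κ : V →L[ℝ] V →L[ℝ] ℝ) (x : M)
    {a d : ι → Model n} (h : IsDualFrame (metricBilin g x) a d)
    (α β : (Model n) [⋀^Fin 2]→L[ℝ] V) :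
    formInner g κ x α β = (1 / 2) * ∑ i, ∑ j, κ (α ![a i, a j]) (β ![d i, d j]) := by
  rw [formInner_two]
  congr 1
  exact (isDualFrame_dualB g x).sum_sum_bilin h (bilinOf κ) (twoFormBilin α) (twoFormBilin β)

lemma lefschetzDual_of_isDualFrame {ι : Type*} [Fintype ι] (x : M)
    {a d : ι → Model n} (h : IsDualFrame (metricBilin g x) a d)
    (α : (Model n) [⋀^Fin 2]→L[ℝ] V) :
    lefschetzDual Ω g x α = (1 / 2 : ℝ) • ∑ i, ∑ j, Ω.form x ![a i, a j] • α ![d i, d j] := by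
  rw [lefschetzDual]
  congr 1
  exact (isDualFrame_dualB g x).sum_sum_bilin h (LinearMap.lsmul ℝ V) (twoFormBilin (Ω.form x))
    (twoFormBilin α)

lemma formInner_two_symm {κ : V →L[ℝ] V →L[ℝ] ℝ} (hκ : ∀ u v, κ u v = κ v u) (x : M)
    (α β : (Model n) [⋀^Fin 2]→L[ℝ] V) : formInner g κ x α β = formInner g κ x β α := by
  rw [formInner_two, formInner_two_of_isDualFrame g κ x
    ((isDualFrame_dualB g x).symm (metricBilin_symm g x))]
  simp only [hκ]

lemma formInner_add_left (κ : V →L[ℝ] V →L[ℝ] ℝ) {k : ℕ} (x : M)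
    (α α' β : (Model n) [⋀^Fin k]→L[ℝ] V) :
    formInner g κ x (α + α') β = formInner g κ x α β + formInner g κ x α' β := by
  simp [formInner, Finset.sum_add_distrib, mul_add]

lemma formInner_add_right (κ : V →L[ℝ] V →L[ℝ] ℝ) {k : ℕ} (x : M)
    (α β β' : (Model n) [⋀^Fin k]→L[ℝ] V) :
    formInner g κ x α (β + β') = formInner g κ x α β + formInner g κ x α β' := by
  simp [formInner, Finset.sum_add_distrib, mul_add]

lemma formInner_smul_left (κ : V →L[ℝ] V →L[ℝ] ℝ) {k : ℕ} (x : M) (c : ℝ)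
    (α β : (Model n) [⋀^Fin k]→L[ℝ] V) :
    formInner g κ x (c • α) β = c * formInner g κ x α β := by
  simp only [formInner, ContinuousAlternatingMap.smul_apply, map_smul, smul_apply, smul_eq_mul,
    ← Finset.mul_sum]
  ring

lemma formInner_smul_right (κ : V →L[ℝ] V →L[ℝ] ℝ) {k : ℕ} (x : M) (c : ℝ)
    (α β : (Model n) [⋀^Fin k]→L[ℝ] V) :
    formInner g κ x α (c • β) = c * formInner g κ x α β := by
  simp only [formInner, ContinuousAlternatingMap.smul_apply, map_smul, smul_eq_mul,
    ← Finset.mul_sum]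
  ring

lemma formInner_zero_right (κ : V →L[ℝ] V →L[ℝ] ℝ) {k : ℕ} (x : M)
    (β : (Model n) [⋀^Fin k]→L[ℝ] V) : formInner g κ x β 0 = 0 := by
  simp [formInner]

lemma primPart_add (x : M) (α β : (Model n) [⋀^Fin 2]→L[ℝ] V) :
    primPart Ω g x (α + β) = primPart Ω g x α + primPart Ω g x β := by
  ext v
  simp [primPart, lefschetzComponent, lefschetzDual, Finset.sum_add_distrib]
  abel

lemma lefschetzComponent_smul (x : M) (c : ℝ) (α : (Model n) [⋀^Fin 2]→L[ℝ] V) :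
    lefschetzComponent Ω g x (c • α) = c • lefschetzComponent Ω g x α := by
  simp only [lefschetzComponent, lefschetzDual, ContinuousAlternatingMap.smul_apply]
  rw [smul_comm c, smul_comm c]
  simp only [Finset.smul_sum (r := c), smul_comm c]

lemma primPart_smul (x : M) (c : ℝ) (α : (Model n) [⋀^Fin 2]→L[ℝ] V) :
    primPart Ω g x (c • α) = c • primPart Ω g x α := by
  rw [primPart, primPart, lefschetzComponent_smul]
  ext v
  simp [smul_sub, smul_comm c]

lemma primPart_zero (x : M) : primPart Ω g x (0 : (Model n) [⋀^Fin 2]→L[ℝ] V) = 0 := by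
  simpa using primPart_smul Ω g x 0 (0 : (Model n) [⋀^Fin 2]→L[ℝ] V)

variable {Ω g}

lemma IsCompatible.exists_bilin (hg : IsCompatible Ω g) (x : M) : ∃ J : Model n → Model n,
    (∀ u, J (J u) = -u) ∧ ∀ u v, metricBilin g x u v = twoFormBilin (Ω.form x) u (J v) := by
  obtain ⟨J, h1, h2⟩ := hg
  exact ⟨J x, h1 x, h2 x⟩

/-- For a compatible metric, `Ω ^ n / n!` is the Riemannian volume form up to sign. -/
lemma IsCompatible.pfaffian_sq (hg : IsCompatible Ω g) (x : M) :
    pfaffian Ω x ^ 2 = (gram g x).det := by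
  obtain ⟨J, hJ, hc⟩ := hg.exists_bilin x
  obtain ⟨b, hb1, hb2⟩ := exists_unitary_basis (metricBilin g x) (twoFormBilin (Ω.form x)) J
    (metricBilin_symm g x) (metricBilin_pos g x) (fun u v => twoForm_swap _ _ _) hJ hc
  set b' := b ∘ (pairEquiv n).symm with hb'
  have h1 : pfaffian Ω x * detForm n b' = 1 := by
    have h := volForm_apply Ω x b'
    rw [alternatization_pairProd_stdSymp _ b hb1, one_div, inv_mul_cancel₀ (by positivity)] at h
    exact h
  have h2 := detForm_sq_mul_det_gramOf (metricBilin g x) b'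
  have h3 : (Matrix.of fun i j => metricBilin g x (b' i) (b' j)) = 1 := by
    ext i j
    simp [hb', hb2, Matrix.one_apply]
  rw [h3, Matrix.det_one, ← gram_eq_gramOf] at h2
  have h4 : detForm n b' ≠ 0 := right_ne_zero_of_mul_eq_one h1
  have h5 : pfaffian Ω x ^ 2 * detForm n b' ^ 2 = 1 := by rw [← mul_pow, h1, one_pow]
  have h6 : (detForm n b') ^ 2 ≠ 0 := pow_ne_zero 2 h4
  apply mul_right_cancel₀ h6
  rw [h5, h2, mul_comm]

lemma det_gram_ne_zero (x : M) : (gram g x).det ≠ 0 :=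
  (isUnit_det_gramOf (metricBilin_pos g x)).ne_zero

lemma IsCompatible.pfaffian_ne_zero (hg : IsCompatible Ω g) (x : M) : pfaffian Ω x ≠ 0 := by
  intro h
  have := hg.pfaffian_sq x
  rw [h] at this
  exact det_gram_ne_zero x (by simpa using this.symm)

/-- `Λ Ω = n` for a compatible metric. -/
lemma IsCompatible.lefschetzDual_form (hg : IsCompatible Ω g) (x : M) :
    lefschetzDual Ω g x (Ω.form x) = n := by
  obtain ⟨J, hJ, hc⟩ := hg.exists_bilin x
  have hd := isDualFrame_dualB g x
  have h1 : ∀ j, ∑ i, Ω.form x ![stdB i, stdB j] * Ω.form x ![dualB g x i, dualB g x j] =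
      metricBilin g x (dualB g x j) (stdB j) := fun j => by
    have h2 : ∀ i, Ω.form x ![dualB g x i, dualB g x j] =
        -metricBilin g x (dualB g x i) (J (dualB g x j)) := fun i => by
      rw [hc, hJ, map_neg, neg_neg]; rfl
    have h3 := congrArg (fun u => twoFormBilin (Ω.form x) u (stdB j)) (hd.expand (J (dualB g x j)))
    simp only [map_sum, map_smul, LinearMap.sum_apply, LinearMap.smul_apply, twoFormBilin_apply,
      smul_eq_mul] at h3
    rw [metricBilin_symm, hc, twoFormBilin_apply, twoForm_swap, ← h3, ← Finset.sum_neg_distrib]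
    refine Finset.sum_congr rfl fun i _ => ?_
    rw [h2]
    ring
  rw [lefschetzDual]
  simp only [smul_eq_mul]
  rw [Finset.sum_comm]
  simp only [h1, metricBilin_dualB]
  simp

lemma formInner_smulRight_right (κ : V →L[ℝ] V →L[ℝ] ℝ) (x : M)
    (α : (Model n) [⋀^Fin 2]→L[ℝ] V) (φ : V) :
    formInner g κ x α ((Ω.form x).smulRight φ) = κ (lefschetzDual Ω g x α) φ := by
  rw [formInner_two, lefschetzDual_of_isDualFrame Ω g x
    ((isDualFrame_dualB g x).symm (metricBilin_symm g x))]
  simp only [ContinuousAlternatingMap.smulRight_apply, map_smul, map_sum, smul_apply, sum_apply,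
    smul_eq_mul]

/-- The projection to the primitive part is orthogonal. -/
lemma IsCompatible.formInner_primPart_right (hn : n ≠ 0) (hg : IsCompatible Ω g)
    (κ : V →L[ℝ] V →L[ℝ] ℝ) (x : M) (α β : (Model n) [⋀^Fin 2]→L[ℝ] V) :
    formInner g κ x (primPart Ω g x α) (primPart Ω g x β) =
      formInner g κ x (primPart Ω g x α) β := by
  have h0 : lefschetzDual Ω g x (primPart Ω g x α) = 0 := by
    have h1 : lefschetzDual Ω g x (primPart Ω g x α) = lefschetzDual Ω g x α -
        lefschetzDual Ω g x (Ω.form x) • lefschetzComponent Ω g x α := by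
      simp only [lefschetzDual, primPart, ContinuousAlternatingMap.sub_apply,
        ContinuousAlternatingMap.smulRight_apply, smul_sub, Finset.sum_sub_distrib, smul_eq_mul,
        mul_smul, Finset.sum_smul]
    rw [h1, hg.lefschetzDual_form, lefschetzComponent, smul_smul, mul_one_div_cancel
      (Nat.cast_ne_zero.2 hn), one_smul, sub_self]
  have h2 : formInner g κ x (primPart Ω g x α) ((Ω.form x).smulRight (lefschetzComponent Ω g x β))
      = 0 := by
    rw [formInner_smulRight_right, h0]; simp
  have h3 : β = primPart Ω g x β + (Ω.form x).smulRight (lefschetzComponent Ω g x β) := by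
    simp [primPart]
  conv_rhs => rw [h3, formInner_add_right, h2, add_zero]

end Pointwise

end PrimYM

end

noncomputable section

namespace PrimYM

/-! ### The Hodge star on 2-forms and on forms of codegree one -/

section Insertion

variable {E : Type*} [NormedAddCommGroup E] [NormedSpace ℝ E]
  {V : Type*} [NormedAddCommGroup V] [NormedSpace ℝ V] {l m : ℕ}

lemma insertFirst_single (h : 1 + l = m) (θ : E [⋀^Fin m]→L[ℝ] ℝ) (u : E) (w : Fin l → E) :
    insertFirst h θ ![u] w =
      θ ((Fin.cons u w : Fin (l + 1) → E) ∘ Fin.cast (by omega : m = l + 1)) := by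
  subst h
  refine congrArg θ (funext fun i => ?_)
  rw [Fin.cons_eq_append]
  simp only [Function.comp_apply, Fin.cast_cast, Fin.cast_refl, id]
  congr 1

lemma insertFirst_pair (h : 2 + l = m) (θ : E [⋀^Fin m]→L[ℝ] ℝ) (u v : E) (w : Fin l → E) :
    insertFirst h θ ![u, v] w =
      θ ((Fin.cons u (Fin.cons v w : Fin (l + 1) → E) : Fin (l + 2) → E) ∘
        Fin.cast (by omega : m = l + 2)) := by
  subst h
  refine congrArg θ (funext fun i => ?_)
  refine Fin.addCases (fun j => ?_) (fun j => ?_) i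
  · fin_cases j
    · rfl
    · rfl
  · simp only [Function.comp_apply, Fin.cast_refl, id, Fin.append_right]
    have : Fin.cast (by omega : 2 + l = l + 2) (Fin.natAdd 2 j) = j.succ.succ := by
      ext; simp only [Fin.val_cast, Fin.val_natAdd, Fin.val_succ]; omega
    rw [this, Fin.cons_succ, Fin.cons_succ]

/-- The bilinear dependence of a form on its first two arguments. -/
def insertPair (h : 2 + l = m) (θ : E [⋀^Fin m]→L[ℝ] ℝ) (w : Fin l → E) : E →ₗ[ℝ] E →ₗ[ℝ] ℝ := by
  have hm : m = l + 2 := by omega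
  subst hm
  exact LinearMap.mk₂ ℝ (fun u v => θ (Fin.cons u (Fin.cons v w : Fin (l + 1) → E)))
    (fun u u' v => θ.cons_add _ u u') (fun c u v => θ.cons_smul _ c u)
    (fun u v v' => by
      have h := θ.map_update_add (Fin.cons u (Fin.cons 0 w : Fin (l + 1) → E) : Fin (l + 2) → E)
        1 v v'
      simpa [← Fin.succ_zero_eq_one, ← Fin.cons_update, -Fin.succ_zero_eq_one'] using h)
    (fun c u v => by
      have h := θ.map_update_smul (Fin.cons u (Fin.cons 0 w : Fin (l + 1) → E) : Fin (l + 2) → E)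
        1 c v
      simpa [← Fin.succ_zero_eq_one, ← Fin.cons_update, -Fin.succ_zero_eq_one'] using h)

lemma insertPair_apply (h : 2 + l = m) (θ : E [⋀^Fin m]→L[ℝ] ℝ) (w : Fin l → E) (u v : E) :
    insertPair h θ w u v = insertFirst h θ ![u, v] w := by
  rw [insertFirst_pair]
  have hm : m = l + 2 := by omega
  subst hm
  rfl

/-- The linear dependence of a form on its first argument. -/
def insertOne (h : 1 + l = m) (θ : E [⋀^Fin m]→L[ℝ] ℝ) (w : Fin l → E) : E →ₗ[ℝ] ℝ := by
  have hm : m = l + 1 := by omega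
  subst hm
  exact
    { toFun := fun u => θ (Fin.cons u w)
      map_add' := fun u v => θ.cons_add _ u v
      map_smul' := fun c u => θ.cons_smul _ c u }

lemma insertOne_apply (h : 1 + l = m) (θ : E [⋀^Fin m]→L[ℝ] ℝ) (w : Fin l → E) (u : E) :
    insertOne h θ w u = insertFirst h θ ![u] w := by
  rw [insertFirst_single]
  have hm : m = l + 1 := by omega
  subst hm
  rfl

/-- Moving an argument past an odd number of others changes the sign. -/
lemma insertFirst_last (h : l + 1 = m) (h' : 1 + l = m) (hl : Odd l) (θ : E [⋀^Fin m]→L[ℝ] ℝ)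
    (u : Fin l → E) (v : E) : insertFirst h θ u ![v] = -insertFirst h' θ ![v] u := by
  subst h
  rw [insertFirst_single]
  have h1 : (insertFirst rfl θ u) ![v] = θ (Fin.snoc u v : Fin (l + 1) → E) := by
    refine congrArg θ (funext fun i => ?_)
    exact congrFun (Fin.append_right_eq_snoc u ![v]) i
  have h2 : (Fin.snoc u v : Fin (l + 1) → E) =
      (Fin.cons v u : Fin (l + 1) → E) ∘ finRotate (l + 1) := by
    rw [Fin.snoc_eq_cons_rotate]
    rfl
  rw [h1, h2]
  have h3 := θ.toAlternatingMap.map_perm (Fin.cons v u) (finRotate (l + 1))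
  rw [sign_finRotate, Nat.add_sub_cancel, hl.neg_one_pow] at h3
  simpa using h3

/-- The alternatization of `θ ⊗ C` has degree larger than the dimension, hence vanishes. -/
lemma sum_removeNth_smul_eq_zero [FiniteDimensional ℝ E] (hm : Module.finrank ℝ E < m + 1)
    (θ : E [⋀^Fin m]→L[ℝ] ℝ) (C : E →ₗ[ℝ] V) (w : Fin (m + 1) → E) :
    ∑ k : Fin (m + 1), (-1 : ℤ) ^ (k : ℕ) • θ (k.removeNth w) • C (w k) = 0 := by
  let f : E →ₗ[ℝ] E [⋀^Fin m]→ₗ[ℝ] V :=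
    { toFun := fun u => (LinearMap.toSpanSingleton ℝ V (C u)).compAlternatingMap θ.toAlternatingMap
      map_add' := fun u v => by ext; simp
      map_smul' := fun c u => by ext; simp [smul_comm c] }
  have h1 : AlternatingMap.alternatizeUncurryFin f w = 0 := by
    refine AlternatingMap.map_linearDependent _ _ fun h => ?_
    have := h.fintype_card_le_finrank
    rw [Fintype.card_fin] at this
    omega
  rw [AlternatingMap.alternatizeUncurryFin_apply] at h1
  exact h1

lemma removeNth_succ_cons {X : Type*} (u : X) (w : Fin (l + 1) → X) (k : Fin (l + 1)) :
    (k.succ.removeNth (Fin.cons u w : Fin (l + 2) → X)) = Fin.cons u (k.removeNth w) := by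
  ext i
  refine Fin.cases ?_ (fun i => ?_) i
  · simp [Fin.removeNth]
  · simp [Fin.removeNth]

/-- Alternating `v ↦ θ(u, ·) C(v)` over `dim E` arguments. -/
lemma sum_insertFirst_single [FiniteDimensional ℝ E] (hm : Module.finrank ℝ E < m + 1)
    (h : 1 + l = m) (h' : l + 1 = m) (θ : E [⋀^Fin m]→L[ℝ] ℝ) (C : E →ₗ[ℝ] V) (u : E)
    (w : Fin (l + 1) → E) :
    ∑ k : Fin (l + 1), (-1 : ℤ) ^ (k : ℕ) • insertFirst h θ ![u] (k.removeNth w) • C (w k) =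
      θ (w ∘ Fin.cast h'.symm) • C u := by
  subst h'
  have h1 := sum_removeNth_smul_eq_zero hm θ C (Fin.cons u w)
  rw [Fin.sum_univ_succ] at h1
  simp only [removeNth_succ_cons, Fin.val_succ, pow_succ, Fin.cons_succ, Fin.cons_zero] at h1
  simp only [insertFirst_single, Fin.cast_refl, Function.comp_id]
  simp only [mul_neg, mul_one, neg_smul, Finset.sum_neg_distrib, Fin.val_zero, pow_zero, one_smul,
    Fin.removeNth_zero, Fin.tail_cons] at h1
  exact (eq_of_sub_eq_zero (by rw [sub_eq_add_neg]; exact h1)).symm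

/-- Alternating `v ↦ θ(u₁, u₂, ·) C(v)` over `dim E - 1` arguments. -/
lemma sum_insertFirst_pair [FiniteDimensional ℝ E] (hm : Module.finrank ℝ E < m + 1)
    (h : 2 + l = m) (h' : 1 + (l + 1) = m) (θ : E [⋀^Fin m]→L[ℝ] ℝ) (C : E →ₗ[ℝ] V) (u v : E)
    (w : Fin (l + 1) → E) :
    ∑ k : Fin (l + 1), (-1 : ℤ) ^ (k : ℕ) • insertFirst h θ ![u, v] (k.removeNth w) • C (w k) =
      insertFirst h' θ ![u] w • C v - insertFirst h' θ ![v] w • C u := by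
  have hl : m = l + 2 := by omega
  subst hl
  have h1 := sum_removeNth_smul_eq_zero hm θ C (Fin.cons u (Fin.cons v w : Fin (l + 2) → E))
  rw [Fin.sum_univ_succ, Fin.sum_univ_succ] at h1
  simp only [removeNth_succ_cons, Fin.val_succ, pow_succ, Fin.cons_succ, Fin.cons_zero] at h1
  simp only [insertFirst_single, insertFirst_pair, Fin.cast_refl, Function.comp_id]
  simp only [mul_neg, mul_one, neg_smul, neg_neg, Fin.val_zero, pow_zero,
    one_smul, Fin.removeNth_zero, Fin.tail_cons] at h1
  rw [← sub_eq_zero, ← h1]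
  abel

end Insertion

section Counting

lemma det_comp_sq {ι E : Type*} [Fintype ι] [DecidableEq ι] [AddCommGroup E] [Module ℝ E]
    (b : Module.Basis ι ℝ E) (f : ι → ι) [Decidable (Function.Injective f)] :
    b.det (b ∘ f) * b.det (b ∘ f) = if Function.Injective f then 1 else 0 := by
  split_ifs with hf
  · let σ : Equiv.Perm ι := Equiv.ofBijective f ((Finite.injective_iff_bijective).1 hf)
    have h : b.det (b ∘ f) = Equiv.Perm.sign σ • b.det b := b.det.map_perm b σ
    rw [h, b.det_self]
    rcases Int.units_eq_one_or (Equiv.Perm.sign σ) with h | h <;> simp [h]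
  · have : b.det (b ∘ f) = 0 := by
      rw [Function.not_injective_iff] at hf
      obtain ⟨i, j, hij, hne⟩ := hf
      exact b.det.map_eq_zero_of_eq _ (by simp [hij]) hne
    rw [this, zero_mul]

/-- There are `l!` injective extensions of a given first value to a self-map of `l + 1` elements. -/
lemma card_injective_cons (l : ℕ) (a : Fin (l + 1)) :
    Fintype.card {f : Fin l → Fin (l + 1) // Function.Injective (Fin.cons a f : Fin (l + 1) → _)} =
      l.factorial := by
  have e : {f : Fin l → Fin (l + 1) // Function.Injective (Fin.cons a f : Fin (l + 1) → _)} ≃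
      (Fin l ↪ {x : Fin (l + 1) // x ≠ a}) :=
    { toFun := fun f => ⟨fun i => ⟨f.1 i, fun h =>
          (Fin.cons_injective_iff.1 f.2).1 ⟨i, h⟩⟩,
        fun i j hij => (Fin.cons_injective_iff.1 f.2).2 (congrArg Subtype.val hij)⟩
      invFun := fun f => ⟨fun i => (f i).1, Fin.cons_injective_iff.2
        ⟨fun ⟨i, hi⟩ => (f i).2 hi, fun i j hij => f.injective (Subtype.ext hij)⟩⟩
      left_inv := fun f => rfl
      right_inv := fun f => rfl }
  rw [Fintype.card_congr e, Fintype.card_embedding_eq]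
  simp [Nat.descFactorial_self]

lemma sum_det_cons_mul_det_cons {E : Type*} [AddCommGroup E] [Module ℝ E] {l : ℕ}
    (b : Module.Basis (Fin (l + 1)) ℝ E) (i j : Fin (l + 1)) :
    ∑ f : Fin l → Fin (l + 1), b.det (b ∘ (Fin.cons i f : Fin (l + 1) → Fin (l + 1))) *
      b.det (b ∘ (Fin.cons j f : Fin (l + 1) → Fin (l + 1))) =
      if i = j then (l.factorial : ℝ) else 0 := by
  classical
  split_ifs with hij
  · subst hij
    simp only [det_comp_sq]
    rw [Finset.sum_boole, ← card_injective_cons l i, Fintype.card_subtype]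
  · refine Finset.sum_eq_zero fun f _ => ?_
    by_contra h
    have inj : ∀ i, b.det (b ∘ (Fin.cons i f : Fin (l + 1) → Fin (l + 1))) ≠ 0 →
        Function.Injective (Fin.cons i f : Fin (l + 1) → Fin (l + 1)) := fun i hi => by
      by_contra hn
      have := det_comp_sq b (Fin.cons i f : Fin (l + 1) → Fin (l + 1))
      rw [if_neg hn] at this
      exact hi (mul_self_eq_zero.1 this)
    have hi := inj i (left_ne_zero_of_mul h)
    have hj := inj j (right_ne_zero_of_mul h)
    obtain ⟨k, hk⟩ := (Finite.injective_iff_surjective.1 hi) j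
    refine Fin.cases ?_ (fun k => ?_) k hk
    · intro hk
      exact hij hk
    · intro hk
      exact (Fin.cons_injective_iff.1 hj).1 ⟨k, hk⟩

lemma sum_insertFirst_detForm {n l : ℕ} (h : 1 + l = 2 * n) (i j : Fin (2 * n)) :
    ∑ f : Fin l → Fin (2 * n), insertFirst h (detForm n) ![stdB i] (stdB ∘ f) *
      insertFirst h (detForm n) ![stdB j] (stdB ∘ f) =
      if i = j then (l.factorial : ℝ) else 0 := by
  have h' : 2 * n = l + 1 := by omega
  let b := (EuclideanSpace.basisFun (Fin (2 * n)) ℝ).toBasis.reindex (finCongr h')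
  have hb : ∀ k, b (finCongr h' k) = stdB k := fun k => by
    rw [stdB_eq_basisFun]; simp [b]
  have h1 : ∀ (k : Fin (2 * n)) (f : Fin l → Fin (2 * n)),
      insertFirst h (detForm n) ![stdB k] (stdB ∘ f) =
        b.det (b ∘ (Fin.cons (finCongr h' k) (finCongr h' ∘ f) : Fin (l + 1) → Fin (l + 1))) := by
    intro k f
    rw [insertFirst_single, detForm_apply, Module.Basis.det_reindex]
    congr 1
    funext s
    simp only [Function.comp_apply]
    have : ∀ r : Fin (l + 1), (Fin.cons (stdB k) (stdB ∘ f) : Fin (l + 1) → Model n) r =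
        b ((Fin.cons (finCongr h' k) (finCongr h' ∘ f) : Fin (l + 1) → Fin (l + 1)) r) := by
      intro r
      refine Fin.cases ?_ (fun r => ?_) r
      · simp only [Fin.cons_zero, hb]
      · simp only [Fin.cons_succ, Function.comp_apply, hb]
    exact this _
  simp only [h1]
  have h2 : ∀ F : (Fin l → Fin (l + 1)) → ℝ, ∑ f : Fin l → Fin (2 * n), F (finCongr h' ∘ f) =
      ∑ f, F f := ((Equiv.refl (Fin l)).arrowCongr (finCongr h')).sum_comp
  rw [h2 fun f => b.det (b ∘ (Fin.cons (finCongr h' i) f : Fin (l + 1) → Fin (l + 1))) *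
    b.det (b ∘ (Fin.cons (finCongr h' j) f : Fin (l + 1) → Fin (l + 1)))]
  rw [sum_det_cons_mul_det_cons]
  simp

end Counting

section Hodge

variable {n : ℕ} {M : Type*} [TopologicalSpace M] [ChartedSpace (Model n) M]
  [IsManifold 𝓘(ℝ, Model n) ∞ M]
  {V : Type*} [NormedAddCommGroup V] [NormedSpace ℝ V]
  {Ω : SymplecticForm n M} {g : Metric n M}

/-- The Hodge star of a 2-form may be computed in any dual frames. -/
lemma hodge_two_of_isDualFrame {ι : Type*} [Fintype ι] {l : ℕ} (h : 2 + l = 2 * n) (x : M)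
    {a d : ι → Model n} (hf : IsDualFrame (metricBilin g x) a d)
    (α : (Model n) [⋀^Fin 2]→L[ℝ] V) (w : Fin l → Model n) :
    hodge Ω g h x α w = (1 / 2 : ℝ) • ∑ i, ∑ j,
      insertFirst h (volForm Ω x) ![a i, a j] w • α ![d i, d j] := by
  have h1 : hodge Ω g h x α w = (1 / 2 : ℝ) • ∑ i, ∑ j,
      insertFirst h (volForm Ω x) ![dualB g x i, dualB g x j] w • α ![stdB i, stdB j] := by
    simp only [hodge, ContinuousAlternatingMap.smul_apply, ContinuousAlternatingMap.sum_apply,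
      ContinuousAlternatingMap.smulRight_apply]
    rw [sum_fin_two_fun]
    simp only [comp_pair]
    norm_num
  rw [h1]
  congr 1
  have h2 := ((isDualFrame_dualB g x).symm (metricBilin_symm g x)).sum_sum_bilin
    hf (LinearMap.lsmul ℝ V) (insertPair h (volForm Ω x) w) (twoFormBilin α)
  simpa only [insertPair_apply, LinearMap.lsmul_apply, twoFormBilin_apply] using h2

/-- The Hodge star of a 2-form in terms of the forms `det(e_i, e_j, ·)`. -/
lemma hodge_two {l : ℕ} (h : 2 + l = 2 * n) (x : M) (α : (Model n) [⋀^Fin 2]→L[ℝ] V)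
    (w : Fin l → Model n) :
    hodge Ω g h x α w = (1 / 2 : ℝ) • ∑ i, ∑ j, insertFirst h (detForm n) ![stdB i, stdB j] w •
      pfaffian Ω x • α ![dualB g x i, dualB g x j] := by
  rw [hodge_two_of_isDualFrame h x (isDualFrame_dualB g x)]
  congr 1
  refine Finset.sum_congr rfl fun i _ => Finset.sum_congr rfl fun j _ => ?_
  rw [smul_smul]
  congr 1
  exact mul_comm _ _

lemma detForm_dualB (x : M) : detForm n (dualB g x) = (gram g x).det⁻¹ := by
  rw [detForm_apply, Module.Basis.det_apply, ← Ring.inverse_eq_inv', ← Matrix.det_nonsing_inv,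
    ← Matrix.det_transpose]
  congr 1
  ext i j
  simp [Module.Basis.toMatrix_apply, dualB, stdB]

lemma detForm_comp_linearMap (S : Model n →ₗ[ℝ] Model n) (v : Fin (2 * n) → Model n) :
    detForm n (S ∘ v) = detForm n (S ∘ stdB) * detForm n v :=
  alternating_eq_smul_detForm ((detForm n).toAlternatingMap.compLinearMap S) v

/-- The Hodge star of a form `∑ₐ det(eₐ, ·) Wₐ` of codegree one. -/
lemma IsCompatible.hodge_codegree_one (hg : IsCompatible Ω g) {l : ℕ} (h : l + 1 = 2 * n)
    (h' : 1 + l = 2 * n) (x : M) (ζ : (Model n) [⋀^Fin l]→L[ℝ] V) (W : Fin (2 * n) → V)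
    (hζ : ∀ w, ζ w = ∑ a, insertFirst h' (detForm n) ![stdB a] w • W a) (v : Model n) :
    hodge Ω g h x ζ ![v] = -(pfaffian Ω x)⁻¹ • ∑ a, metricAt g x (stdB a) v • W a := by
  -- `S` maps the standard basis to its dual basis; its determinant is `(det g)⁻¹ = pf⁻²`.
  let S : Model n →ₗ[ℝ] Model n :=
    (EuclideanSpace.basisFun (Fin (2 * n)) ℝ).toBasis.constr ℝ (dualB g x)
  have hS : ∀ i, S (stdB i) = dualB g x i := fun i => by
    rw [stdB_eq_basisFun, Module.Basis.constr_basis]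
  have hpf := hg.pfaffian_ne_zero x
  set c := (pfaffian Ω x)⁻¹ with hc
  have hdet : detForm n (S ∘ stdB) = c ^ 2 := by
    rw [show S ∘ stdB = dualB g x from funext hS, detForm_dualB, ← hg.pfaffian_sq, inv_pow]
  have hv : S (∑ b, metricAt g x (stdB b) v • stdB b) = v := by
    rw [map_sum]
    simp only [map_smul, hS]
    simpa only [metricBilin_symm g x v, metricBilin_apply] using
      (isDualFrame_dualB g x).expand_dual v
  have hodd : Odd l := by
    rw [← Nat.not_even_iff_odd]; intro h3; rw [Nat.even_iff] at h3; omega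
  have hS' : ∀ f : Fin l → Fin (2 * n), S ∘ (stdB ∘ f) = fun a => dualB g x (f a) :=
    fun f => funext fun a => hS _
  have key : ∀ f : Fin l → Fin (2 * n),
      insertFirst h (volForm Ω x) (fun a => dualB g x (f a)) ![v] =
        -c * ∑ b, metricAt g x (stdB b) v * insertFirst h' (detForm n) ![stdB b] (stdB ∘ f) := by
    intro f
    have h1 : insertFirst h (volForm Ω x) (fun a => dualB g x (f a)) ![v] =
        -(pfaffian Ω x * insertFirst h' (detForm n) ![v] (S ∘ (stdB ∘ f))) := by
      rw [insertFirst_last h h' hodd, ← hS']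
      rfl
    have h2 : ∀ u, insertFirst h' (detForm n) ![S u] (S ∘ (stdB ∘ f)) =
        c ^ 2 * insertFirst h' (detForm n) ![u] (stdB ∘ f) := by
      intro u
      rw [insertFirst_single, insertFirst_single, ← hdet, ← detForm_comp_linearMap]
      congr 1
      funext i
      simp only [Function.comp_apply]
      refine Fin.cases ?_ (fun k => ?_) (Fin.cast (by omega : 2 * n = l + 1) i)
      · simp
      · simp
    have h3 : ∀ u : Fin (2 * n) → ℝ, insertFirst h' (detForm n) ![∑ b, u b • stdB b] (stdB ∘ f) =
        ∑ b, u b * insertFirst h' (detForm n) ![stdB b] (stdB ∘ f) := by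
      intro u
      simp only [← insertOne_apply, map_sum, map_smul, smul_eq_mul]
    rw [h1]
    conv_lhs => rw [← hv, h2, h3]
    have : pfaffian Ω x * c ^ 2 = c := by rw [hc]; field_simp
    rw [← mul_assoc, this, neg_mul]
  have hl : (l.factorial : ℝ) ≠ 0 := Nat.cast_ne_zero.2 l.factorial_ne_zero
  simp only [hodge, ContinuousAlternatingMap.smul_apply, ContinuousAlternatingMap.sum_apply,
    ContinuousAlternatingMap.smulRight_apply, key]
  have h4 : ∑ f : Fin l → Fin (2 * n), (-c * ∑ b, metricAt g x (stdB b) v *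
        insertFirst h' (detForm n) ![stdB b] (stdB ∘ f)) • ζ (fun a => stdB (f a)) =
      ∑ a, ∑ b, (-c * metricAt g x (stdB b) v * ∑ f : Fin l → Fin (2 * n),
        insertFirst h' (detForm n) ![stdB b] (stdB ∘ f) *
        insertFirst h' (detForm n) ![stdB a] (stdB ∘ f)) • W a := by
    simp only [hζ, Finset.smul_sum, Finset.mul_sum, Finset.sum_smul, smul_smul, Finset.sum_mul]
    rw [Finset.sum_comm]
    refine Finset.sum_congr rfl fun a _ => ?_
    rw [Finset.sum_comm]
    refine Finset.sum_congr rfl fun b _ => Finset.sum_congr rfl fun f _ => ?_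
    congr 1
    rw [mul_assoc (-c), mul_assoc (-c), mul_assoc]
    rfl
  rw [h4]
  simp only [sum_insertFirst_detForm, mul_ite, mul_zero, ite_smul, zero_smul, Finset.sum_ite_eq',
    Finset.mem_univ, if_true, Finset.smul_sum, smul_smul]
  refine Finset.sum_congr rfl fun a _ => ?_
  congr 1
  field_simp

/-- The scalar product of a 1-form with `⋆ζ`, when `ζ` is obtained by alternating
`½ ∑ det(eᵢ, eⱼ, ·) ⊗ C_ij`. Both `d⋆β` and `[α, ⋆β]` are of this form, for a 2-form `β`: in the
first case `C_ij` is the differential of the coefficients of `⋆β`, in the second their bracket with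
`α`. -/
lemma IsCompatible.formInner_hodge (hg : IsCompatible Ω g) (κ : V →L[ℝ] V →L[ℝ] ℝ) {l : ℕ}
    (h : l + 1 + 1 = 2 * n) (h' : 2 + l = 2 * n) (x : M) (ζ : (Model n) [⋀^Fin (l + 1)]→L[ℝ] V)
    (C : Fin (2 * n) → Fin (2 * n) → Model n →ₗ[ℝ] V) (hC : ∀ i j, C j i = -C i j)
    (hζ : ∀ w, ζ w = ∑ k : Fin (l + 1), (-1 : ℤ) ^ (k : ℕ) • (1 / 2 : ℝ) • ∑ i, ∑ j,
      insertFirst h' (detForm n) ![stdB i, stdB j] (k.removeNth w) • C i j (w k))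
    (η : (Model n) [⋀^Fin 1]→L[ℝ] V) :
    formInner g κ x (hodge Ω g h x ζ) η =
      -(pfaffian Ω x)⁻¹ * ∑ i, ∑ j, κ (C i j (stdB j)) (η ![stdB i]) := by
  have h1 : 1 + (l + 1) = 2 * n := by omega
  have hm : Module.finrank ℝ (Model n) < 2 * n + 1 := by simp
  have hζ' : ∀ w, ζ w = ∑ i, insertFirst h1 (detForm n) ![stdB i] w • ∑ j, C i j (stdB j) := by
    intro w
    have h2 : ζ w = (1 / 2 : ℝ) • ∑ i, ∑ j, ∑ k : Fin (l + 1), (-1 : ℤ) ^ (k : ℕ) •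
        insertFirst h' (detForm n) ![stdB i, stdB j] (k.removeNth w) • C i j (w k) := by
      rw [hζ]
      simp only [smul_comm _ (1 / 2 : ℝ), ← Finset.smul_sum (r := (1 / 2 : ℝ))]
      congr 1
      simp only [Finset.smul_sum]
      rw [Finset.sum_comm]
      exact Finset.sum_congr rfl fun i _ => Finset.sum_comm
    simp only [sum_insertFirst_pair hm h' h1, Finset.sum_sub_distrib] at h2
    have h3 : ∑ i, ∑ j, insertFirst h1 (detForm n) ![stdB j] w • C i j (stdB i) =
        -∑ i, ∑ j, insertFirst h1 (detForm n) ![stdB i] w • C i j (stdB j) := by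
      rw [Finset.sum_comm, ← Finset.sum_neg_distrib]
      refine Finset.sum_congr rfl fun i _ => ?_
      rw [← Finset.sum_neg_distrib]
      refine Finset.sum_congr rfl fun j _ => ?_
      rw [hC i j, LinearMap.neg_apply, smul_neg]
    rw [h2, h3, sub_neg_eq_add, ← two_smul ℝ, smul_smul]
    norm_num [Finset.smul_sum]
  rw [formInner_one]
  simp only [hg.hodge_codegree_one h h1 x ζ _ hζ', map_smul, map_sum, smul_apply, sum_apply,
    smul_eq_mul, ← Finset.mul_sum]
  congr 1
  rw [Finset.sum_comm]
  refine Finset.sum_congr rfl fun i _ => ?_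
  have h4 := congrArg (oneFormLin η) ((isDualFrame_dualB g x).expand_dual (stdB i))
  simp only [map_sum, map_smul, metricBilin_apply] at h4
  have h5 := congrArg (κ (∑ j, C i j (stdB j))) h4
  simp only [map_sum, map_smul, sum_apply, smul_eq_mul] at h5
  exact h5

end Hodge

end PrimYM

end

noncomputable section

namespace PrimYM

/-! ### Pointwise adjoints of brackets -/

section BracketAdjoint

variable {n : ℕ} {M : Type*} [TopologicalSpace M] [ChartedSpace (Model n) M]
  [IsManifold 𝓘(ℝ, Model n) ∞ M]
  {𝔤 : Type*} [NormedAddCommGroup 𝔤] [NormedSpace ℝ 𝔤] [FiniteDimensional ℝ 𝔤]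
  {G : Type*} [TopologicalSpace G] [ChartedSpace 𝔤 G] [Group G] [LieGroup 𝓘(ℝ, 𝔤) ∞ G]
  {Ω : SymplecticForm n M} {g : Metric n M}

lemma bracketRight_apply {E : Type*} [NormedAddCommGroup E] [NormedSpace ℝ E]
    [FiniteDimensional ℝ E] {k : ℕ} (β : E [⋀^Fin k]→L[ℝ] 𝔤) (α : E [⋀^Fin 1]→L[ℝ] 𝔤)
    (v : Fin (k + 1) → E) :
    bracketRight G β α v = (-1 : ℝ) ^ k •
      ∑ i : Fin (k + 1), (-1 : ℤ) ^ (i : ℕ) • lieBr G (β (Fin.removeNth i v)) (α ![v i]) := by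
  rw [bracketRight, ContinuousAlternatingMap.smul_apply,
    ContinuousAlternatingMap.alternatizeUncurryFin_apply]
  rfl

lemma formInner_bracketLeft_right (κ : 𝔤 →L[ℝ] 𝔤 →L[ℝ] ℝ) (x : M)
    (β : (Model n) [⋀^Fin 2]→L[ℝ] 𝔤) (α η : (Model n) [⋀^Fin 1]→L[ℝ] 𝔤) :
    formInner g κ x β (bracketLeft G α η) =
      ∑ i, ∑ j, κ (β ![dualB g x i, dualB g x j]) (lieBr G (α ![stdB i]) (η ![stdB j])) := by
  rw [formInner_two_of_isDualFrame g κ x ((isDualFrame_dualB g x).symm (metricBilin_symm g x))]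
  simp only [bracketLeft_apply_two, map_sub, Finset.sum_sub_distrib]
  have h : ∑ i, ∑ j, κ (β ![dualB g x i, dualB g x j]) (lieBr G (α ![stdB j]) (η ![stdB i])) =
      -∑ i, ∑ j, κ (β ![dualB g x i, dualB g x j]) (lieBr G (α ![stdB i]) (η ![stdB j])) := by
    rw [Finset.sum_comm, ← Finset.sum_neg_distrib]
    refine Finset.sum_congr rfl fun i _ => ?_
    rw [← Finset.sum_neg_distrib]
    refine Finset.sum_congr rfl fun j _ => ?_
    rw [twoForm_swap, map_neg, neg_apply]
  rw [h]
  ring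

/-- The pointwise adjoint of `η ↦ [α, η]` is `β ↦ -⋆[α, ⋆β]`. -/
lemma formInner_hodge_bracketLeft (hg : IsCompatible Ω g) (κ : InvariantInner 𝔤 G) {l : ℕ}
    (h : l + 1 + 1 = 2 * n) (h' : 2 + l = 2 * n) (x : M)
    (β : (Model n) [⋀^Fin 2]→L[ℝ] 𝔤) (α η : (Model n) [⋀^Fin 1]→L[ℝ] 𝔤) :
    formInner g κ.form x (hodge Ω g h x (bracketLeft G α (hodge Ω g h' x β))) η =
      -formInner g κ.form x β (bracketLeft G α η) := by
  have hpf := hg.pfaffian_ne_zero x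
  rw [hg.formInner_hodge κ.form h h' x _ (fun i j => pfaffian Ω x •
    ((lieBr G).flip (β ![dualB g x i, dualB g x j])).toLinearMap ∘ₗ oneFormLin α),
    formInner_bracketLeft_right, Finset.sum_comm]
  · rw [Finset.mul_sum, ← Finset.sum_neg_distrib]
    refine Finset.sum_congr rfl fun j _ => ?_
    rw [Finset.mul_sum, ← Finset.sum_neg_distrib]
    refine Finset.sum_congr rfl fun i _ => ?_
    rw [twoForm_swap]
    simp [κ.form_lieBr]
    field_simp
  · intro i j
    rw [twoForm_swap]
    ext v
    simp
  · intro w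
    rw [bracketLeft_apply]
    refine Finset.sum_congr rfl fun k _ => ?_
    congr 1
    rw [hodge_two]
    simp only [map_smul, map_sum]
    simp

/-- The pointwise scalar product of `⋆[⋆β, η]` with `η` is that of `β` with `[η, η]`, because
`[⋆β, η] = -[η, ⋆β]` for the form `⋆β` of even degree. -/
lemma formInner_hodge_bracketRight (hg : IsCompatible Ω g) (κ : InvariantInner 𝔤 G) {l : ℕ}
    (h : l + 1 + 1 = 2 * n) (h' : 2 + l = 2 * n) (x : M)
    (β : (Model n) [⋀^Fin 2]→L[ℝ] 𝔤) (η : (Model n) [⋀^Fin 1]→L[ℝ] 𝔤) :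
    formInner g κ.form x (hodge Ω g h x (bracketRight G (hodge Ω g h' x β) η)) η =
      formInner g κ.form x β (bracketLeft G η η) := by
  have heven : Even l := by
    rw [Nat.even_iff]; omega
  have h1 : bracketRight G (hodge Ω g h' x β) η = -bracketLeft G η (hodge Ω g h' x β) := by
    ext w
    rw [bracketRight_apply, heven.neg_one_pow, one_smul, ContinuousAlternatingMap.neg_apply,
      bracketLeft_apply, ← Finset.sum_neg_distrib]
    refine Finset.sum_congr rfl fun k _ => ?_
    rw [lieBr_skew, smul_neg]
  have h2 : ∀ ζ : (Model n) [⋀^Fin (l + 1)]→L[ℝ] 𝔤,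
      formInner g κ.form x (hodge Ω g h x (-ζ)) η = -formInner g κ.form x (hodge Ω g h x ζ) η := by
    intro ζ
    have : hodge Ω g h x (-ζ) = (-1 : ℝ) • hodge Ω g h x ζ := by
      ext w
      simp [hodge, Finset.sum_neg_distrib]
    rw [this, formInner_smul_left, neg_one_mul]
  rw [h1, h2, formInner_hodge_bracketLeft hg, neg_neg]

end BracketAdjoint

end PrimYM

end

noncomputable section

namespace PrimYM

/-! ### Metric and volume form in charts -/

section CoordMetric

variable {n : ℕ} {M : Type*} [TopologicalSpace M] [ChartedSpace (Model n) M]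
  [IsManifold 𝓘(ℝ, Model n) ∞ M]
  {V : Type*} [NormedAddCommGroup V] [NormedSpace ℝ V]
  (Ω : SymplecticForm n M) (g : Metric n M)

/-- Coordinate vector fields are smooth. -/
lemma contMDiffAt_chartSymmDeriv (x₀ : M) {y : Model n} (hy : y ∈ (chartAt (Model n) x₀).target)
    (u : Model n) :
    ContMDiffAt 𝓘(ℝ, Model n) (𝓘(ℝ, Model n).prod 𝓘(ℝ, Model n)) ∞
      (fun z => (Bundle.TotalSpace.mk' (Model n) ((chartAt (Model n) x₀).symm z)
        (chartSymmDeriv x₀ z u) : TangentBundle 𝓘(ℝ, Model n) M)) y := by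
  have ho := (chartAt (Model n) x₀).open_target
  have h1 := (contMDiffOn_chart_symm (I := 𝓘(ℝ, Model n)) (n := ∞)
    (x := x₀)).contMDiffOn_tangentMapWithin (m := ∞) (by simp) ho.uniqueMDiffOn
  have h2 : ContMDiffAt 𝓘(ℝ, Model n) (𝓘(ℝ, Model n).prod 𝓘(ℝ, Model n)) ∞
      (fun z : Model n => (Bundle.TotalSpace.mk' (Model n) z u :
        TangentBundle 𝓘(ℝ, Model n) (Model n))) y := by
    rw [Bundle.contMDiffAt_totalSpace]
    refine ⟨contMDiffAt_id, ?_⟩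
    simpa using contMDiffAt_const
  have h3 := (h1.contMDiffAt (x := Bundle.TotalSpace.mk' (Model n) y u)
    ((ho.preimage (FiberBundle.continuous_proj (Model n)
      (TangentSpace 𝓘(ℝ, Model n)))).mem_nhds hy)).comp y h2
  refine h3.congr_of_eventuallyEq ?_
  filter_upwards [ho.mem_nhds hy] with z hz
  simp only [Function.comp_apply, tangentMapWithin, mfderivWithin_of_isOpen ho hz]
  rfl

lemma contDiffAt_metricAt (x₀ : M) {y : Model n} (hy : y ∈ (chartAt (Model n) x₀).target)
    (u v : Model n) :
    ContDiffAt ℝ ∞ (fun z => metricAt g ((chartAt (Model n) x₀).symm z) (chartSymmDeriv x₀ z u)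
      (chartSymmDeriv x₀ z v)) y := by
  have hb : ContMDiffAt 𝓘(ℝ, Model n) 𝓘(ℝ, Model n) ∞
      ((chartAt (Model n) x₀).symm : Model n → M) y :=
    (contMDiffOn_chart_symm (I := 𝓘(ℝ, Model n)) (n := ∞)).contMDiffAt
      ((chartAt (Model n) x₀).open_target.mem_nhds hy)
  have h : ContMDiffAt 𝓘(ℝ, Model n) (𝓘(ℝ, Model n).prod 𝓘(ℝ)) ∞
      (fun z ↦ Bundle.TotalSpace.mk' ℝ (E := Bundle.Trivial M ℝ) ((chartAt (Model n) x₀).symm z)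
        (g.inner ((chartAt (Model n) x₀).symm z) (chartSymmDeriv x₀ z u)
          (chartSymmDeriv x₀ z v))) y := by
    apply ContMDiffAt.clm_bundle_apply₂ (F₁ := Model n) (F₂ := Model n)
    · exact ContMDiffAt.comp y (g.contMDiff.contMDiffAt) hb
    · exact contMDiffAt_chartSymmDeriv x₀ hy u
    · exact contMDiffAt_chartSymmDeriv x₀ hy v
  rw [Bundle.contMDiffAt_totalSpace] at h
  exact h.2.contDiffAt

/-- The metric at a coordinate point of the chart at `x₀`, as a bilinear form on coordinate
vectors. -/
def coordBilin (x₀ : M) (y : Model n) : Model n →ₗ[ℝ] Model n →ₗ[ℝ] ℝ :=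
  (metricBilin g ((chartAt (Model n) x₀).symm y)).compl₁₂ (chartSymmDeriv x₀ y).toLinearMap
    (chartSymmDeriv x₀ y).toLinearMap

lemma coordBilin_apply (x₀ : M) (y u v : Model n) : coordBilin g x₀ y u v =
    metricBilin g ((chartAt (Model n) x₀).symm y) (chartSymmDeriv x₀ y u)
      (chartSymmDeriv x₀ y v) := rfl

lemma coordGram_eq_gramOf (x₀ : M) (y : Model n) :
    coordGram g x₀ y = gramOf (coordBilin g x₀ y) := rfl

/-- The coordinate frame `g`-dual to the coordinate vector fields. -/
def coordDual (x₀ : M) (y : Model n) (i : Fin (2 * n)) : Model n :=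
  dualOf (coordBilin g x₀ y) i

lemma coordDual_eq (x₀ : M) (y : Model n) (i : Fin (2 * n)) :
    coordDual g x₀ y i = ∑ j, (coordGram g x₀ y)⁻¹ i j • stdB j := rfl

lemma coordBilin_pos (x₀ : M) {y : Model n} (hy : y ∈ (chartAt (Model n) x₀).target)
    (u : Model n) (hu : u ≠ 0) : 0 < coordBilin g x₀ y u u := by
  obtain ⟨S, -, hS⟩ := exists_inverse_chartSymmDeriv x₀ hy
  refine metricBilin_pos g _ _ fun h => hu ?_
  have h1 := congrArg (fun f : Model n →L[ℝ] Model n => f u) hS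
  simp only [ContinuousLinearMap.comp_apply, ContinuousLinearMap.id_apply] at h1
  exact (h1.symm.trans (congrArg S h)).trans (map_zero S)

lemma isDualFrame_coordDual (x₀ : M) {y : Model n} (hy : y ∈ (chartAt (Model n) x₀).target) :
    IsDualFrame (metricBilin g ((chartAt (Model n) x₀).symm y))
      (fun i => chartSymmDeriv x₀ y (stdB i))
      (fun i => chartSymmDeriv x₀ y (coordDual g x₀ y i)) := by
  obtain ⟨S, hS, -⟩ := exists_inverse_chartSymmDeriv x₀ hy
  exact (isDualFrame_dualOf (coordBilin_pos g x₀ hy)).map (chartSymmDeriv x₀ y).toLinearMap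
    S.toLinearMap (fun v => congrArg (fun f : Model n →L[ℝ] Model n => f v) hS) fun _ _ => rfl

lemma coordDual_self (x : M) (i : Fin (2 * n)) :
    coordDual g x (chartAt (Model n) x x) i = dualB g x i := by
  have h : coordBilin g x (chartAt (Model n) x x) = metricBilin g x := by
    ext u v
    simp only [coordBilin_apply]
    rw [chartSymmDeriv_self, (chartAt (Model n) x).left_inv (mem_chart_source _ x)]
    rfl
  rw [coordDual, h]
  rfl

lemma det_coordGram_ne_zero (x₀ : M) {y : Model n} (hy : y ∈ (chartAt (Model n) x₀).target) :
    (coordGram g x₀ y).det ≠ 0 :=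
  (isUnit_det_gramOf (coordBilin_pos g x₀ hy)).ne_zero

lemma contDiffAt_coordGram (x₀ : M) {y : Model n} (hy : y ∈ (chartAt (Model n) x₀).target) :
    ContDiffAt ℝ ∞ (fun z => (fun i j => coordGram g x₀ z i j : Fin (2 * n) → Fin (2 * n) → ℝ)) y :=
  contDiffAt_pi.2 fun i => contDiffAt_pi.2 fun j => contDiffAt_metricAt g x₀ hy (stdB i) (stdB j)

lemma contDiff_det {ι : Type*} [Fintype ι] [DecidableEq ι] :
    ContDiff ℝ ∞ (fun A : ι → ι → ℝ => (Matrix.of A).det) := by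
  simp only [Matrix.det_apply']
  refine ContDiff.sum fun σ _ => contDiff_const.mul (contDiff_prod fun i _ => ?_)
  exact contDiff_apply_apply ℝ ℝ (σ i) i

lemma contDiffAt_coordGram_inv (x₀ : M) {y : Model n} (hy : y ∈ (chartAt (Model n) x₀).target)
    (i j : Fin (2 * n)) : ContDiffAt ℝ ∞ (fun z => (coordGram g x₀ z)⁻¹ i j) y := by
  have hG := contDiffAt_coordGram g x₀ hy
  have hdet : ContDiffAt ℝ ∞ (fun z => (coordGram g x₀ z).det) y :=
    contDiff_det.contDiffAt.comp y hG
  simp only [Matrix.inv_def, Ring.inverse_eq_inv', Matrix.smul_apply, smul_eq_mul]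
  refine (hdet.inv (det_coordGram_ne_zero g x₀ hy)).mul ?_
  simp only [Matrix.adjugate_apply]
  have hrow : ∀ a b, ContDiffAt ℝ ∞
      (fun z => (coordGram g x₀ z).updateRow j (Pi.single i 1) a b) y := fun a b => by
    by_cases ha : a = j
    · subst ha
      simp only [Matrix.updateRow_self]
      exact contDiffAt_const
    · simpa only [Matrix.updateRow_ne ha] using contDiffAt_pi.1 (contDiffAt_pi.1 hG a) b
  exact contDiff_det.contDiffAt.comp y (contDiffAt_pi.2 fun a => contDiffAt_pi.2 fun b => hrow a b)

/-- The value of `Ω ^ n / n!` on the coordinate vector fields of the chart at `x₀`. -/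
def coordPf (x₀ : M) (y : Model n) : ℝ :=
  volForm Ω ((chartAt (Model n) x₀).symm y) fun i => chartSymmDeriv x₀ y (stdB i)

lemma coordForm_volForm (x₀ : M) (y : Model n) :
    coordForm (volForm Ω) x₀ y = coordPf Ω x₀ y • detForm n := by
  ext v
  exact alternating_eq_smul_detForm (coordForm (volForm Ω) x₀ y).toAlternatingMap v

lemma coordPf_self (x : M) : coordPf Ω x (chartAt (Model n) x x) = pfaffian Ω x := by
  rw [coordPf, chartSymmDeriv_self, (chartAt (Model n) x).left_inv (mem_chart_source _ x)]
  change pfaffian Ω x * detForm n stdB = _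
  rw [detForm_stdB, mul_one]

/-- The volume form is `± √(det g_ij)` in coordinates. -/
lemma coordPf_sq (hg : IsCompatible Ω g) (x₀ : M) (y : Model n) :
    coordPf Ω x₀ y ^ 2 = (coordGram g x₀ y).det := by
  have h := detForm_sq_mul_det_gramOf (metricBilin g ((chartAt (Model n) x₀).symm y))
    fun i => chartSymmDeriv x₀ y (stdB i)
  rw [← gram_eq_gramOf, ← hg.pfaffian_sq, ← mul_pow] at h
  exact (congrArg (fun c : ℝ => c ^ 2) (mul_comm _ _)).trans h.symm

lemma contDiffAt_coordPf (x₀ : M) {y : Model n} (hy : y ∈ (chartAt (Model n) x₀).target) :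
    ContDiffAt ℝ ∞ (coordPf Ω x₀) y := by
  have hΩ := Ω.smooth.contDiffAt isOpen_univ x₀ hy (Set.mem_univ _)
  have h : coordPf Ω x₀ = fun z => (1 / (2 ^ n * (n.factorial : ℝ))) *
      ∑ σ : Equiv.Perm (Fin (2 * n)), ((Equiv.Perm.sign σ : ℤ) : ℝ) * ∏ i : Fin n,
        coordForm Ω.form x₀ z ![stdB (σ ⟨2 * (i : ℕ), by omega⟩),
          stdB (σ ⟨2 * (i : ℕ) + 1, by omega⟩)] := by
    funext z
    rw [coordPf, volForm_apply, alternatization_pairProd_apply]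
    refine congrArg _ (Finset.sum_congr rfl fun σ _ => congrArg _
      (Finset.prod_congr rfl fun i _ => ?_))
    rw [coordForm_apply, comp_pair]
    rfl
  rw [h]
  refine contDiffAt_const.mul (ContDiffAt.sum fun σ _ => contDiffAt_const.mul
    (contDiffAt_prod fun i _ => hΩ.apply_form _))

end CoordMetric

end PrimYM

end

noncomputable section

namespace PrimYM

/-! ### Scalar products and primitive parts of smooth forms -/

section CoordForms

variable {n : ℕ} {M : Type*} [TopologicalSpace M] [ChartedSpace (Model n) M]
  [IsManifold 𝓘(ℝ, Model n) ∞ M]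
  {V : Type*} [NormedAddCommGroup V] [NormedSpace ℝ V]
  (Ω : SymplecticForm n M) (g : Metric n M)

lemma coordForm_pair (α : M → (Model n) [⋀^Fin 2]→L[ℝ] V) (x₀ : M) (y u v : Model n) :
    coordForm α x₀ y ![u, v] =
      α ((chartAt (Model n) x₀).symm y) ![chartSymmDeriv x₀ y u, chartSymmDeriv x₀ y v] := by
  rw [coordForm_apply, comp_pair]

lemma coordForm_single (α : M → (Model n) [⋀^Fin 1]→L[ℝ] V) (x₀ : M) (y u : Model n) :
    coordForm α x₀ y ![u] =
      α ((chartAt (Model n) x₀).symm y) ![chartSymmDeriv x₀ y u] := by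
  rw [coordForm_apply, comp_single]

lemma formInner_chart (κ : V →L[ℝ] V →L[ℝ] ℝ) (α β : M → (Model n) [⋀^Fin 2]→L[ℝ] V) (x₀ : M)
    {y : Model n} (hy : y ∈ (chartAt (Model n) x₀).target) :
    formInner g κ ((chartAt (Model n) x₀).symm y) (α ((chartAt (Model n) x₀).symm y))
        (β ((chartAt (Model n) x₀).symm y)) =
      (1 / 2) * ∑ i, ∑ j, κ (coordForm α x₀ y ![stdB i, stdB j])
        (coordForm β x₀ y ![coordDual g x₀ y i, coordDual g x₀ y j]) := by
  rw [formInner_two_of_isDualFrame g κ _ (isDualFrame_coordDual g x₀ hy)]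
  simp only [coordForm_pair]

lemma lefschetzDual_chart (α : M → (Model n) [⋀^Fin 2]→L[ℝ] V) (x₀ : M)
    {y : Model n} (hy : y ∈ (chartAt (Model n) x₀).target) :
    lefschetzDual Ω g ((chartAt (Model n) x₀).symm y) (α ((chartAt (Model n) x₀).symm y)) =
      (1 / 2 : ℝ) • ∑ i, ∑ j, coordForm Ω.form x₀ y ![stdB i, stdB j] •
        coordForm α x₀ y ![coordDual g x₀ y i, coordDual g x₀ y j] := by
  rw [lefschetzDual_of_isDualFrame Ω g _ (isDualFrame_coordDual g x₀ hy)]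
  simp only [coordForm_pair]

lemma contDiffAt_apply_coordDual (x₀ : M) {y : Model n} (hy : y ∈ (chartAt (Model n) x₀).target)
    {α : Model n → (Model n) [⋀^Fin 2]→L[ℝ] V} (hα : ContDiffAt ℝ ∞ α y) (i j : Fin (2 * n)) :
    ContDiffAt ℝ ∞ (fun z => α z ![coordDual g x₀ z i, coordDual g x₀ z j]) y := by
  simp only [← twoFormBilin_apply, coordDual_eq, map_sum, map_smul, LinearMap.sum_apply,
    LinearMap.smul_apply, Finset.smul_sum]
  exact ContDiffAt.sum fun a _ => ContDiffAt.sum fun b _ =>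
    (contDiffAt_coordGram_inv g x₀ hy _ _).smul
      ((contDiffAt_coordGram_inv g x₀ hy _ _).smul (hα.apply_form _))

lemma SmoothFormOn.continuousAt_formInner {U : Set M} (hU : IsOpen U) (κ : V →L[ℝ] V →L[ℝ] ℝ)
    {α β : M → (Model n) [⋀^Fin 2]→L[ℝ] V} (hα : SmoothFormOn α U) (hβ : SmoothFormOn β U)
    {x : M} (hx : x ∈ U) : ContinuousAt (fun x => formInner g κ x (α x) (β x)) x := by
  have hy := mem_chart_target (Model n) x
  have hU' : (chartAt (Model n) x).symm (chartAt (Model n) x x) ∈ U := by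
    rwa [(chartAt (Model n) x).left_inv (mem_chart_source _ x)]
  have h1 : ContDiffAt ℝ ∞ (fun y => (1 / 2 : ℝ) * ∑ i, ∑ j,
      κ (coordForm α x y ![stdB i, stdB j])
        (coordForm β x y ![coordDual g x y i, coordDual g x y j])) (chartAt (Model n) x x) :=
    contDiffAt_const.mul <| ContDiffAt.sum fun i _ => ContDiffAt.sum fun j _ =>
      (κ.contDiff.contDiffAt.comp _ ((hα.contDiffAt hU x hy hU').apply_form _)).clm_apply
        (contDiffAt_apply_coordDual g x hy (hβ.contDiffAt hU x hy hU') i j)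
  have h2 := h1.continuousAt.comp
    ((chartAt (Model n) x).continuousAt (mem_chart_source (Model n) x))
  refine h2.congr ?_
  filter_upwards [(chartAt (Model n) x).open_source.mem_nhds (mem_chart_source (Model n) x)]
    with z hz
  have h3 := formInner_chart g κ α β x ((chartAt (Model n) x).map_source hz)
  rw [(chartAt (Model n) x).left_inv hz] at h3
  exact h3.symm

lemma SmoothFormOn.primPart [FiniteDimensional ℝ V] {U : Set M} (hU : IsOpen U)
    {α : M → (Model n) [⋀^Fin 2]→L[ℝ] V} (hα : SmoothFormOn α U) :
    SmoothFormOn (fun x => primPart Ω g x (α x)) U := by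
  refine smoothFormOn_of_contDiffAt fun x₀ y hy hyU => contDiffAt_form fun m => ?_
  have hα' := hα.contDiffAt hU x₀ hy hyU
  have hΩ := Ω.smooth.contDiffAt isOpen_univ x₀ hy (Set.mem_univ _)
  have h1 : ContDiffAt ℝ ∞ (fun z => coordForm α x₀ z m - coordForm Ω.form x₀ z m •
      (1 / (n : ℝ)) • (1 / 2 : ℝ) • ∑ i, ∑ j, coordForm Ω.form x₀ z ![stdB i, stdB j] •
        coordForm α x₀ z ![coordDual g x₀ z i, coordDual g x₀ z j]) y :=
    (hα'.apply_form m).sub <| (hΩ.apply_form m).smul <| contDiffAt_const.smul <|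
      contDiffAt_const.smul <| ContDiffAt.sum fun i _ => ContDiffAt.sum fun j _ =>
        (hΩ.apply_form _).smul (contDiffAt_apply_coordDual g x₀ hy hα' i j)
  refine h1.congr_of_eventuallyEq ?_
  filter_upwards [(chartAt (Model n) x₀).open_target.mem_nhds hy] with z hz
  rw [← lefschetzDual_chart Ω g α x₀ hz]
  rfl

end CoordForms

namespace PrincipalBundle

variable {n : ℕ} {M : Type*} [TopologicalSpace M] [ChartedSpace (Model n) M]
  [IsManifold 𝓘(ℝ, Model n) ∞ M]
  {ι : Type*} {𝔤 : Type*} [NormedAddCommGroup 𝔤] [NormedSpace ℝ 𝔤]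
  {G : Type*} [TopologicalSpace G] [ChartedSpace 𝔤 G] [Group G]
  {P : PrincipalBundle ι (Model n) M 𝔤 G} {Ω : SymplecticForm n M} {g : Metric n M}
  {κ : InvariantInner 𝔤 G}

/-- The primitive part commutes with linear maps of the coefficients. -/
lemma primPart_comp {V W : Type*} [NormedAddCommGroup V] [NormedSpace ℝ V] [NormedAddCommGroup W]
    [NormedSpace ℝ W] (L : V →L[ℝ] W) (x : M) {α : (Model n) [⋀^Fin 2]→L[ℝ] V}
    {β : (Model n) [⋀^Fin 2]→L[ℝ] W} (h : ∀ v, β v = L (α v)) (v : Fin 2 → Model n) :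
    primPart Ω g x β v = L (primPart Ω g x α v) := by
  simp [primPart, lefschetzComponent, lefschetzDual, h]

lemma IsAdForm.prim [FiniteDimensional ℝ 𝔤] {α : P.LocalForms 2} (hα : P.IsAdForm α) :
    P.IsAdForm (P.prim Ω g α) :=
  ⟨fun i => (hα.1 i).primPart Ω g (P.isOpen_baseSet i),
    fun i j x hx v => primPart_comp _ x (hα.2 i j x hx) v⟩

/-- The pointwise scalar product may be computed in any trivialization. -/
lemma IsAdForm.innerAt_eq {k : ℕ} {α β : P.LocalForms k} (hα : P.IsAdForm α) (hβ : P.IsAdForm β)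
    {i : ι} {x : M} (hx : x ∈ P.baseSet i) :
    P.innerAt g κ α β x = formInner g κ.form x (α i x) (β i x) := by
  have hx' : x ∈ P.baseSet i ∩ P.baseSet (P.indexAt x) := ⟨hx, P.mem_baseSet_at x⟩
  rw [innerAt, formInner, formInner]
  congr 1
  refine Finset.sum_congr rfl fun f _ => ?_
  rw [hα.2 i _ x hx', hβ.2 i _ x hx', κ.invariant]

lemma IsAdForm.continuous_innerAt {α β : P.LocalForms 2} (hα : P.IsAdForm α)
    (hβ : P.IsAdForm β) : Continuous (P.innerAt g κ α β) := by
  rw [continuous_iff_continuousAt]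
  intro x
  refine (SmoothFormOn.continuousAt_formInner g (P.isOpen_baseSet (P.indexAt x)) κ.form
    (hα.1 (P.indexAt x)) (hβ.1 (P.indexAt x)) (P.mem_baseSet_at x)).congr ?_
  filter_upwards [(P.isOpen_baseSet (P.indexAt x)).mem_nhds (P.mem_baseSet_at x)] with z hz
  exact (hα.innerAt_eq hβ hz).symm

end PrincipalBundle

end PrimYM

end

noncomputable section

namespace PrimYM

/-! ### The Riemannian measure in charts -/

section RiemannianMeasure

variable {n : ℕ} {M : Type*} [TopologicalSpace M] [ChartedSpace (Model n) M]
  [IsManifold 𝓘(ℝ, Model n) ∞ M]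
  (Ω : SymplecticForm n M) (g : Metric n M)

lemma detForm_linearMap_stdB (L : Model n →ₗ[ℝ] Model n) :
    detForm n (fun i => L (stdB i)) = LinearMap.det L := by
  have h := Module.Basis.det_comp (EuclideanSpace.basisFun (Fin (2 * n)) ℝ).toBasis L stdB
  rw [← detForm_apply, ← detForm_apply, detForm_stdB, mul_one] at h
  exact h

/-- The change of variables formula for the determinant of the metric. -/
lemma det_coordGram_transition (x₀ x₁ : M) {y : Model n}
    (hy : y ∈ (chartAt (Model n) x₀).target)
    (hy' : (chartAt (Model n) x₀).symm y ∈ (chartAt (Model n) x₁).source) :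
    (coordGram g x₀ y).det =
      (fderiv ℝ (fun z => chartAt (Model n) x₁ ((chartAt (Model n) x₀).symm z)) y).det ^ 2 *
        (coordGram g x₁ (chartAt (Model n) x₁ ((chartAt (Model n) x₀).symm y))).det := by
  set L := fderiv ℝ (fun z => chartAt (Model n) x₁ ((chartAt (Model n) x₀).symm z)) y
  set y₁ := chartAt (Model n) x₁ ((chartAt (Model n) x₀).symm y) with hy₁
  have h1 : (chartAt (Model n) x₁).symm y₁ = (chartAt (Model n) x₀).symm y :=
    (chartAt (Model n) x₁).left_inv hy'
  have h2 := detForm_sq_mul_det_gramOf (coordBilin g x₁ y₁) fun i => L (stdB i)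
  have h3 : detForm n (fun i => L (stdB i)) = L.det := detForm_linearMap_stdB L.toLinearMap
  rw [h3, ← coordGram_eq_gramOf] at h2
  rw [← h2]
  congr 1
  ext i j
  simp only [coordGram, Matrix.of_apply, coordBilin_apply, h1, metricBilin_apply]
  rw [chartSymmDeriv_comp_transition x₀ x₁ hy hy']
  rfl

lemma continuousOn_density (x₀ : M) :
    ContinuousOn (fun y => Real.sqrt (coordGram g x₀ y).det) (chartAt (Model n) x₀).target :=
  fun y hy => (Real.continuous_sqrt.continuousAt.comp
    (contDiff_det.contDiffAt.comp y (contDiffAt_coordGram g x₀ hy)).continuousAt).continuousWithinAt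

variable [MeasurableSpace M] [BorelSpace M]

lemma measurableSet_target (x₀ : M) : MeasurableSet (chartAt (Model n) x₀).target :=
  (chartAt (Model n) x₀).open_target.measurableSet

lemma measurableSet_source (x₀ : M) : MeasurableSet (chartAt (Model n) x₀).source :=
  (chartAt (Model n) x₀).open_source.measurableSet

lemma aemeasurable_chart_symm (x₀ : M) : AEMeasurable ((chartAt (Model n) x₀).symm : Model n → M)
    ((volume : Measure (Model n)).restrict (chartAt (Model n) x₀).target) :=
  (chartAt (Model n) x₀).continuousOn_symm.aemeasurable (measurableSet_target (n := n) x₀)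

lemma aemeasurable_density (x₀ : M) :
    AEMeasurable (fun y => ENNReal.ofReal (Real.sqrt (coordGram g x₀ y).det))
      ((volume : Measure (Model n)).restrict (chartAt (Model n) x₀).target) :=
  ((continuousOn_density g x₀).aemeasurable (measurableSet_target (n := n) x₀)).ennreal_ofReal

lemma chartVolume_apply (x₀ : M) {A : Set M} (hA : MeasurableSet A) :
    chartVolume g x₀ A = ∫⁻ y in (chartAt (Model n) x₀).target ∩ (chartAt (Model n) x₀).symm ⁻¹' A,
      ENNReal.ofReal (Real.sqrt (coordGram g x₀ y).det) := by
  have h1 := aemeasurable_chart_symm (n := n) x₀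
  have hac : (((volume : Measure (Model n)).restrict (chartAt (Model n) x₀).target).withDensity
      fun y => ENNReal.ofReal (Real.sqrt (coordGram g x₀ y).det)) ≪
      (volume : Measure (Model n)).restrict (chartAt (Model n) x₀).target :=
    withDensity_absolutelyContinuous _ _
  have hnull := h1.nullMeasurableSet_preimage hA
  rw [chartVolume, Measure.map_apply_of_aemeasurable (h1.mono_ac hac) hA,
    withDensity_apply₀ _ hnull, Measure.restrict_restrict₀ hnull, Set.inter_comm]

lemma chartVolume_apply_source_compl (x₀ : M) :
    chartVolume g x₀ (chartAt (Model n) x₀).sourceᶜ = 0 := by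
  rw [chartVolume_apply g x₀ (measurableSet_source (n := n) x₀).compl]
  have : (chartAt (Model n) x₀).target ∩
      (chartAt (Model n) x₀).symm ⁻¹' (chartAt (Model n) x₀).sourceᶜ = ∅ := by
    ext y
    simp only [Set.mem_inter_iff, Set.mem_preimage, Set.mem_compl_iff, Set.mem_empty_iff_false,
      iff_false, not_and, not_not]
    exact fun hy => (chartAt (Model n) x₀).map_target hy
  rw [this]
  simp

/-- The measures defined by two charts agree where both charts are defined. -/
lemma chartVolume_eq_of_subset (x₀ x₁ : M) {A : Set M} (hA : MeasurableSet A)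
    (h0 : A ⊆ (chartAt (Model n) x₀).source) (h1 : A ⊆ (chartAt (Model n) x₁).source) :
    chartVolume g x₁ A = chartVolume g x₀ A := by
  set e₀ := chartAt (Model n) x₀ with he₀
  set e₁ := chartAt (Model n) x₁ with he₁
  rw [chartVolume_apply g x₁ hA, chartVolume_apply g x₀ hA]
  set B := e₀.target ∩ e₀.symm ⁻¹' A with hB
  have hBm : MeasurableSet B := by
    have hr : Measurable (e₀.target.domRestrict e₀.symm) :=
      e₀.continuousOn_symm.domRestrict.measurable
    have h2 := (measurableSet_target (n := n) x₀).subtype_image (hr hA)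
    rwa [show (Subtype.val '' (e₀.target.domRestrict e₀.symm ⁻¹' A)) = B by
      ext y; simp [hB, Set.domRestrict, and_comm]] at h2
  have himage : e₁.target ∩ e₁.symm ⁻¹' A = (fun z => e₁ (e₀.symm z)) '' B := by
    ext y
    constructor
    · rintro ⟨hy, hyA⟩
      refine ⟨e₀ (e₁.symm y), ⟨e₀.map_source (h0 hyA), ?_⟩, ?_⟩
      · simpa [e₀.left_inv (h0 hyA)] using hyA
      · simp [e₀.left_inv (h0 hyA), e₁.right_inv hy]
    · rintro ⟨z, ⟨hz, hzA⟩, rfl⟩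
      refine ⟨e₁.map_source (h1 hzA), ?_⟩
      simpa [e₁.left_inv (h1 hzA)] using hzA
  have hinj : Set.InjOn (fun z => e₁ (e₀.symm z)) B := by
    intro z hz w hw hzw
    have := e₁.injOn (h1 hz.2) (h1 hw.2) hzw
    exact e₀.symm.injOn hz.1 hw.1 this
  rw [himage, lintegral_image_eq_lintegral_abs_det_fderiv_mul volume hBm
    (fun z hz => ((contDiffAt_chart_transition x₀ x₁ hz.1 (h1 hz.2)).differentiableAt
      (by simp)).hasFDerivAt.hasFDerivWithinAt) hinj]
  refine setLIntegral_congr_fun hBm fun z hz => ?_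
  rw [← ENNReal.ofReal_mul (abs_nonneg _), det_coordGram_transition g x₀ x₁ hz.1 (h1 hz.2),
    Real.sqrt_mul (sq_nonneg _), Real.sqrt_sq_eq_abs]

lemma restrict_chartVolume_self (x₀ : M) :
    (chartVolume g x₀).restrict (chartAt (Model n) x₀).source = chartVolume g x₀ :=
  Measure.restrict_eq_self_of_ae_mem (chartVolume_apply_source_compl g x₀)

lemma restrict_chartVolume_le (x₀ x₁ : M) :
    (chartVolume g x₁).restrict (chartAt (Model n) x₀).source ≤ chartVolume g x₀ := by
  refine Measure.le_iff.2 fun A hA => ?_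
  rw [Measure.restrict_apply hA]
  have h2 : chartVolume g x₁ (A ∩ (chartAt (Model n) x₀).source) =
      chartVolume g x₁ (A ∩ (chartAt (Model n) x₀).source ∩ (chartAt (Model n) x₁).source) := by
    conv_lhs => rw [← restrict_chartVolume_self g x₁]
    rw [Measure.restrict_apply (hA.inter (measurableSet_source (n := n) x₀))]
  rw [h2, chartVolume_eq_of_subset g x₀ x₁
    ((hA.inter (measurableSet_source (n := n) x₀)).inter (measurableSet_source (n := n) x₁))
    (fun x hx => hx.1.2) (fun x hx => hx.2)]
  exact measure_mono fun x hx => hx.1.1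

/-- On the domain of a chart the Riemannian measure has the density `√(det g_ij)`. -/
lemma restrict_riemVolume (x₀ : M) :
    (riemVolume g).restrict (chartAt (Model n) x₀).source = chartVolume g x₀ := by
  have hS := measurableSet_source (n := n) x₀
  apply le_antisymm
  · have h1 : riemVolume g ≤ chartVolume g x₀ +
        (riemVolume g).restrict (chartAt (Model n) x₀).sourceᶜ := by
      refine iSup_le fun x₁ => ?_
      rw [← Measure.restrict_add_restrict_compl (μ := chartVolume g x₁) hS]
      exact add_le_add (restrict_chartVolume_le g x₀ x₁)
        (Measure.restrict_mono le_rfl (le_iSup (chartVolume g) x₁))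
    refine (Measure.restrict_mono le_rfl h1).trans ?_
    rw [Measure.restrict_add, Measure.restrict_restrict hS, Set.inter_compl_self,
      Measure.restrict_empty, add_zero, restrict_chartVolume_self]
  · rw [← restrict_chartVolume_self]
    exact Measure.restrict_mono le_rfl (le_iSup (chartVolume g) x₀)

instance isLocallyFiniteMeasure_riemVolume : IsLocallyFiniteMeasure (riemVolume g) := by
  refine ⟨fun x => ?_⟩
  set e := chartAt (Model n) x with he
  obtain ⟨K, ⟨hKn, hKc⟩, hKs⟩ := (compact_basis_nhds (e x)).mem_iff.1
    (e.open_target.mem_nhds (mem_chart_target (Model n) x))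
  set U := e.source ∩ e ⁻¹' interior K with hU
  have hUo : IsOpen U := e.isOpen_inter_preimage isOpen_interior
  refine ⟨U, hUo.mem_nhds ⟨mem_chart_source (Model n) x, mem_interior_iff_mem_nhds.2 hKn⟩, ?_⟩
  have h1 : riemVolume g U = chartVolume g x U := by
    rw [← restrict_riemVolume, Measure.restrict_apply hUo.measurableSet,
      Set.inter_eq_left.2 fun z hz => hz.1]
  rw [h1, chartVolume_apply g x hUo.measurableSet]
  refine lt_of_le_of_lt (lintegral_mono_set (t := K) ?_)
    (((continuousOn_density g x).mono hKs).integrableOn_compact hKc).lintegral_lt_top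
  rintro y ⟨hy, hyU⟩
  have : e (e.symm y) ∈ interior K := hyU.2
  rw [e.right_inv hy] at this
  exact interior_subset this

end RiemannianMeasure

end PrimYM

end

noncomputable section

namespace PrimYM

/-! ### Stokes' theorem for compactly supported forms -/

section Stokes

lemma integral_fderiv_apply_eq_zero {E : Type*} [NormedAddCommGroup E] [NormedSpace ℝ E]
    [FiniteDimensional ℝ E] [MeasurableSpace E] [BorelSpace E] (μ : Measure E)
    [μ.IsAddHaarMeasure] {f : E → ℝ} (hf : ContDiff ℝ ∞ f) (hc : HasCompactSupport f) (v : E) :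
    ∫ y, fderiv ℝ f y v ∂μ = 0 := by
  have h1 : Continuous fun y => fderiv ℝ f y v :=
    (hf.continuous_fderiv (by simp)).clm_apply continuous_const
  have h2 : HasCompactSupport fun y => fderiv ℝ f y v := hc.fderiv_apply (𝕜 := ℝ) v
  have h := integral_mul_fderiv_eq_neg_fderiv_mul_of_integrable (μ := μ) (f := fun _ : E => (1 : ℝ))
    (g := f) (v := v) (by simp) (by simpa using h1.integrable_of_hasCompactSupport h2)
    (by simpa using hf.continuous.integrable_of_hasCompactSupport hc)
    (fun _ _ => differentiableAt_const _) (fun y _ => hf.differentiable (by simp) y)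
  simpa using h

lemma integral_extDeriv_eq_zero {E : Type*} [NormedAddCommGroup E] [NormedSpace ℝ E]
    [FiniteDimensional ℝ E] [MeasurableSpace E] [BorelSpace E] (μ : Measure E)
    [μ.IsAddHaarMeasure] {l : ℕ} {Θ : E → E [⋀^Fin l]→L[ℝ] ℝ} (hΘ : ContDiff ℝ ∞ Θ)
    (hc : HasCompactSupport Θ) (v : Fin (l + 1) → E) : ∫ y, extDeriv Θ y v ∂μ = 0 := by
  have h0 : ∀ m : Fin l → E, ContDiff ℝ ∞ fun y => Θ y m := fun m =>
    contDiff_iff_contDiffAt.2 fun y => hΘ.contDiffAt.apply_form m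
  have h1 : ∀ m : Fin l → E, HasCompactSupport fun y => Θ y m := fun m =>
    hc.comp_left (g := fun α : E [⋀^Fin l]→L[ℝ] ℝ => α m) rfl
  have h2 : ∀ y, extDeriv Θ y v = ∑ k : Fin (l + 1), (((-1 : ℤ) ^ (k : ℕ) : ℤ) : ℝ) *
      fderiv ℝ (fun z => Θ z (k.removeNth v)) y (v k) := fun y => by
    rw [extDeriv, ContinuousAlternatingMap.alternatizeUncurryFin_apply]
    refine Finset.sum_congr rfl fun k _ => ?_
    rw [fderiv_apply_form (hΘ.differentiable (by simp) y), zsmul_eq_mul]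
  simp only [h2]
  rw [integral_finsetSum]
  · refine Finset.sum_eq_zero fun k _ => ?_
    rw [integral_const_mul, integral_fderiv_apply_eq_zero μ (h0 _) (h1 _), mul_zero]
  · intro k _
    refine Integrable.const_mul ?_ _
    exact (((h0 _).continuous_fderiv (by simp)).clm_apply
      continuous_const).integrable_of_hasCompactSupport ((h1 _).fderiv_apply (𝕜 := ℝ) (v k))

variable {n : ℕ} {M : Type*} [TopologicalSpace M] [ChartedSpace (Model n) M]
  [IsManifold 𝓘(ℝ, Model n) ∞ M]
  (Ω : SymplecticForm n M) {g : Metric n M} {l : ℕ} (h : l + 1 = 2 * n)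

/-- The function `f` with `dθ = f vol`, for a form `θ` of codegree one. -/
def topDiv (θ : M → (Model n) [⋀^Fin l]→L[ℝ] ℝ) (x : M) : ℝ :=
  extD θ x (stdB ∘ Fin.cast h) / pfaffian Ω x

lemma topDiv_add {θ θ' : M → (Model n) [⋀^Fin l]→L[ℝ] ℝ} (hθ : SmoothFormOn θ Set.univ)
    (hθ' : SmoothFormOn θ' Set.univ) (x : M) :
    topDiv Ω h (θ + θ') x = topDiv Ω h θ x + topDiv Ω h θ' x := by
  rw [topDiv, extD_add hθ hθ' isOpen_univ (Set.mem_univ x), ContinuousAlternatingMap.add_apply,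
    add_div]
  rfl

lemma topDiv_eq_zero {θ : M → (Model n) [⋀^Fin l]→L[ℝ] ℝ} {K : Set M} (hK : IsClosed K)
    (h0 : ∀ x ∉ K, θ x = 0) {x : M} (hx : x ∉ K) : topDiv Ω h θ x = 0 := by
  have h1 : θ =ᶠ[𝓝 x] 0 := by
    filter_upwards [hK.isOpen_compl.mem_nhds hx] with z hz using h0 z hz
  rw [topDiv, extD_congr_of_eventuallyEq h1, extD_zero]
  simp

lemma topDiv_mul_coordPf (hg : IsCompatible Ω g) {θ : M → (Model n) [⋀^Fin l]→L[ℝ] ℝ}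
    (hθ : SmoothFormOn θ Set.univ) (x₀ : M) {y : Model n}
    (hy : y ∈ (chartAt (Model n) x₀).target) :
    topDiv Ω h θ ((chartAt (Model n) x₀).symm y) * coordPf Ω x₀ y =
      extDeriv (coordForm θ x₀) y (stdB ∘ Fin.cast h) := by
  rw [← hθ.coordForm_extD isOpen_univ x₀ hy (Set.mem_univ _), coordForm_apply]
  set p := (chartAt (Model n) x₀).symm y with hp
  have h1 := alternating_eq_smul_detForm
    ((extD θ p).toAlternatingMap.domDomCongr (finCongr h)) fun i => chartSymmDeriv x₀ y (stdB i)
  have h2 : extD θ p (fun a => chartSymmDeriv x₀ y ((stdB ∘ Fin.cast h) a)) =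
      extD θ p (stdB ∘ Fin.cast h) * detForm n (fun i => chartSymmDeriv x₀ y (stdB i)) := h1
  have h3 : coordPf Ω x₀ y = pfaffian Ω p * detForm n (fun i => chartSymmDeriv x₀ y (stdB i)) := rfl
  have hpf := hg.pfaffian_ne_zero p
  rw [h2, h3, topDiv]
  field_simp

lemma coordPf_ne_zero (hg : IsCompatible Ω g) (x₀ : M) {y : Model n}
    (hy : y ∈ (chartAt (Model n) x₀).target) : coordPf Ω x₀ y ≠ 0 := by
  intro h0
  have h1 := coordPf_sq Ω g hg x₀ y
  rw [h0] at h1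
  exact det_coordGram_ne_zero g x₀ hy (by simpa using h1.symm)

lemma continuous_topDiv (hg : IsCompatible Ω g) {θ : M → (Model n) [⋀^Fin l]→L[ℝ] ℝ}
    (hθ : SmoothFormOn θ Set.univ) : Continuous (topDiv Ω h θ) := by
  rw [continuous_iff_continuousAt]
  intro x
  have hy := mem_chart_target (Model n) x
  have h1 : ContinuousAt (fun y => extDeriv (coordForm θ x) y (stdB ∘ Fin.cast h) /
      coordPf Ω x y) (chartAt (Model n) x x) :=
    ((contDiffAt_extDeriv (hθ.contDiffAt isOpen_univ x hy
      (Set.mem_univ _))).apply_form _).continuousAt.div (contDiffAt_coordPf Ω x hy).continuousAt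
      (coordPf_ne_zero Ω hg x hy)
  refine (h1.comp ((chartAt (Model n) x).continuousAt (mem_chart_source (Model n) x))).congr ?_
  filter_upwards [(chartAt (Model n) x).open_source.mem_nhds (mem_chart_source (Model n) x)]
    with z hz
  have hz' := (chartAt (Model n) x).map_source hz
  rw [Function.comp_apply, div_eq_iff (coordPf_ne_zero Ω hg x hz'),
    ← topDiv_mul_coordPf Ω h hg hθ x hz', (chartAt (Model n) x).left_inv hz]

variable [T2Space M] [MeasurableSpace M] [BorelSpace M]

lemma integrable_topDiv (hg : IsCompatible Ω g) {θ : M → (Model n) [⋀^Fin l]→L[ℝ] ℝ}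
    (hθ : SmoothFormOn θ Set.univ) {K : Set M} (hK : IsCompact K) (h0 : ∀ x ∉ K, θ x = 0) :
    Integrable (topDiv Ω h θ) (riemVolume g) :=
  (continuous_topDiv Ω h hg hθ).integrable_of_hasCompactSupport
    (HasCompactSupport.intro hK fun _ hx => topDiv_eq_zero Ω h hK.isClosed h0 hx)

/-- Stokes' theorem for a form supported in the domain of a chart. -/
lemma integral_topDiv_of_subset_source (hg : IsCompatible Ω g)
    {θ : M → (Model n) [⋀^Fin l]→L[ℝ] ℝ} (hθ : SmoothFormOn θ Set.univ) {K : Set M}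
    (hK : IsCompact K) (h0 : ∀ x ∉ K, θ x = 0) (x₀ : M)
    (hKs : K ⊆ (chartAt (Model n) x₀).source) : ∫ x, topDiv Ω h θ x ∂(riemVolume g) = 0 := by
  classical
  set e := chartAt (Model n) x₀ with he
  set K' := e '' K with hK'
  have hK'c : IsCompact K' := hK.image_of_continuousOn (e.continuousOn.mono hKs)
  have hK't : K' ⊆ e.target := by
    rintro _ ⟨x, hx, rfl⟩
    exact e.map_source (hKs hx)
  -- The sign of the orientation of the chart is locally constant.
  let s : Model n → ℝ := fun y => SignType.sign (coordPf Ω x₀ y)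
  have hs : ∀ y ∈ e.target, s =ᶠ[𝓝 y] fun _ => s y := fun y hy => by
    have h1 : ContinuousAt (fun z => SignType.sign (coordPf Ω x₀ z)) y :=
      (continuousAt_sign_of_ne_zero (coordPf_ne_zero Ω hg x₀ hy)).comp
        (contDiffAt_coordPf Ω x₀ hy).continuousAt
    have h2 : ∀ᶠ z in 𝓝 y, SignType.sign (coordPf Ω x₀ z) ∈
      ({SignType.sign (coordPf Ω x₀ y)} : Set SignType) :=
      h1.eventually_mem ((isOpen_discrete _).mem_nhds rfl)
    filter_upwards [h2] with z hz
    simp only [s]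
    rw [hz]
  let Θ : Model n → (Model n) [⋀^Fin l]→L[ℝ] ℝ := fun y =>
    if y ∈ e.target then s y • coordForm θ x₀ y else 0
  have hΘ0 : ∀ y ∉ K', Θ y = 0 := fun y hy => by
    by_cases hyt : y ∈ e.target
    · have h1 : e.symm y ∉ K := fun hk => hy ⟨_, hk, e.right_inv hyt⟩
      simp only [Θ, if_pos hyt, coordForm]
      rw [← he, h0 _ h1]
      ext; simp
    · simp only [Θ, if_neg hyt]
  have hΘt : ∀ y ∈ e.target, Θ =ᶠ[𝓝 y] s y • coordForm θ x₀ := fun y hy => by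
    filter_upwards [e.open_target.mem_nhds hy, hs y hy] with z hz hsz
    simp only [Θ, if_pos hz, hsz]
    rfl
  have hΘ : ContDiff ℝ ∞ Θ := contDiff_iff_contDiffAt.2 fun y => by
    by_cases hy : y ∈ K'
    · exact ((hθ.contDiffAt isOpen_univ x₀ (hK't hy) (Set.mem_univ _)).const_smul
        (s y)).congr_of_eventuallyEq (hΘt y (hK't hy))
    · refine contDiffAt_const (c := 0) |>.congr_of_eventuallyEq ?_
      filter_upwards [hK'c.isClosed.isOpen_compl.mem_nhds hy] with z hz using hΘ0 z hz
  have hint := integral_extDeriv_eq_zero volume hΘ (HasCompactSupport.intro hK'c hΘ0)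
    (stdB ∘ Fin.cast h)
  have hf0 : ∀ x ∉ e.source, topDiv Ω h θ x = 0 := fun x hx =>
    topDiv_eq_zero Ω h hK.isClosed h0 fun hk => hx (hKs hk)
  have hcont := continuous_topDiv Ω h hg hθ
  have hac : (((volume : Measure (Model n)).restrict e.target).withDensity
      fun y => ENNReal.ofReal (Real.sqrt (coordGram g x₀ y).det)) ≪
      (volume : Measure (Model n)).restrict e.target :=
    withDensity_absolutelyContinuous _ _
  rw [← setIntegral_eq_integral_of_forall_compl_eq_zero hf0, restrict_riemVolume, chartVolume,
    integral_map ((aemeasurable_chart_symm (n := n) x₀).mono_ac hac)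
      hcont.aestronglyMeasurable,
    integral_withDensity_eq_integral_toReal_smul₀ (aemeasurable_density g x₀) (by simp), ← hint,
    ← setIntegral_eq_integral_of_forall_compl_eq_zero (s := e.target)
      (f := fun y => extDeriv Θ y (stdB ∘ Fin.cast h))]
  · refine setIntegral_congr_fun (measurableSet_target (n := n) x₀) fun y hy => ?_
    have h1 : extDeriv Θ y = s y • extDeriv (coordForm θ x₀) y := by
      rw [(hΘt y hy).extDeriv_eq, extDeriv_smul]
    simp only [h1, ContinuousAlternatingMap.smul_apply, smul_eq_mul]
    rw [← topDiv_mul_coordPf Ω h hg hθ x₀ hy, ENNReal.toReal_ofReal (Real.sqrt_nonneg _),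
      ← coordPf_sq Ω g hg x₀ y, Real.sqrt_sq_eq_abs, ← sign_mul_self]
    simp only [s]
    ring
  · intro y hy
    have h1 : Θ =ᶠ[𝓝 y] fun _ => 0 := by
      filter_upwards [hK'c.isClosed.isOpen_compl.mem_nhds fun hk => hy (hK't hk)] with z hz
        using hΘ0 z hz
    rw [h1.extDeriv_eq, extDeriv, fderiv_const_apply,
      ← ContinuousAlternatingMap.alternatizeUncurryFinCLM_apply, map_zero]
    rfl

variable [SecondCountableTopology M]

/-- Stokes' theorem for compactly supported forms of codegree one. -/
lemma integral_topDiv_eq_zero (hg : IsCompatible Ω g) {θ : M → (Model n) [⋀^Fin l]→L[ℝ] ℝ}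
    (hθ : SmoothFormOn θ Set.univ) {K : Set M} (hK : IsCompact K) (h0 : ∀ x ∉ K, θ x = 0) :
    ∫ x, topDiv Ω h θ x ∂(riemVolume g) = 0 := by
  have : LocallyCompactSpace M := ChartedSpace.locallyCompactSpace (Model n) M
  obtain ⟨f, hf⟩ := SmoothPartitionOfUnity.exists_isSubordinate_chartAt_source_of_isClosed
    (I := 𝓘(ℝ, Model n)) hK.isClosed
  have hfin := f.locallyFinite.finite_nonempty_inter_compact hK
  have hsum : θ = ∑ i ∈ hfin.toFinset, (f i : M → ℝ) • θ := by
    funext x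
    rw [Finset.sum_apply]
    by_cases hx : x ∈ K
    · have h1 : ∑ i ∈ hfin.toFinset, f i x = 1 := by
        rw [← f.sum_eq_one hx, finsum_eq_sum_of_support_subset]
        intro i hi
        simp only [Set.Finite.coe_toFinset, Set.mem_ofPred_eq]
        exact ⟨x, hi, hx⟩
      simp only [Pi.smul_apply', ← Finset.sum_smul, h1, one_smul]
    · simp [h0 x hx]
  have hsm : ∀ i, SmoothFormOn ((f i : M → ℝ) • θ) Set.univ := fun i => by
    refine smoothFormOn_of_contDiffAt fun x₀ y hy _ => ?_
    have h1 : ContDiffAt ℝ ∞ (fun z => f i ((chartAt (Model n) x₀).symm z)) y := by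
      rw [← contMDiffAt_iff_contDiffAt]
      exact (f i).contMDiff.contMDiffAt.comp y
        ((contMDiffOn_chart_symm (I := 𝓘(ℝ, Model n)) (n := ∞)).contMDiffAt
          ((chartAt (Model n) x₀).open_target.mem_nhds hy))
    exact h1.smul (hθ.contDiffAt isOpen_univ x₀ hy (Set.mem_univ _))
  have key : ∀ S : Finset K, SmoothFormOn (∑ i ∈ S, (f i : M → ℝ) • θ) Set.univ ∧
      (∀ x ∉ K, (∑ i ∈ S, (f i : M → ℝ) • θ) x = 0) ∧
      ∫ x, topDiv Ω h (∑ i ∈ S, (f i : M → ℝ) • θ) x ∂(riemVolume g) = 0 := by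
    classical
    intro S
    induction S using Finset.induction_on with
    | empty =>
      refine ⟨?_, by simp, ?_⟩
      · rw [Finset.sum_empty]
        intro x₀
        exact contDiffOn_const (c := 0)
      · simp [topDiv, extD_zero]
    | insert i S hi ih =>
      obtain ⟨h1, h2, h3⟩ := ih
      rw [Finset.sum_insert hi]
      have h4 : ∀ x ∉ K, ((f i : M → ℝ) • θ) x = 0 := fun x hx => by simp [h0 x hx]
      refine ⟨(hsm i).add h1, fun x hx => ?_, ?_⟩
      · rw [Pi.add_apply, h4 x hx, h2 x hx, add_zero]
      · simp only [topDiv_add Ω h (hsm i) h1]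
        rw [integral_add (integrable_topDiv Ω h hg (hsm i) hK h4)
          (integrable_topDiv Ω h hg h1 hK h2), h3, add_zero]
        refine integral_topDiv_of_subset_source Ω h hg (hsm i)
          (hK.inter_right (isClosed_tsupport (f i))) (fun x hx => ?_) i
          fun x hx => hf i hx.2
        by_cases hxK : x ∈ K
        · have : f i x = 0 := image_eq_zero_of_notMem_tsupport fun ht => hx ⟨hxK, ht⟩
          simp [this]
        · exact h4 x hxK
  rw [hsum]
  exact (key _).2.2

end Stokes

end PrimYM

end

noncomputable section

namespace PrimYM

/-! ### The formal adjoint of the covariant derivative -/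

section ExteriorHodge

variable {n : ℕ} {M : Type*} [TopologicalSpace M] [ChartedSpace (Model n) M]
  [IsManifold 𝓘(ℝ, Model n) ∞ M]
  {V : Type*} [NormedAddCommGroup V] [NormedSpace ℝ V]
  (Ω : SymplecticForm n M) (g : Metric n M)

/-- The coefficients of the Hodge star of a 2-form in the chart at `x₀`. -/
def coordStar (α : M → (Model n) [⋀^Fin 2]→L[ℝ] V) (x₀ : M) (i j : Fin (2 * n)) (y : Model n) : V :=
  coordPf Ω x₀ y • coordForm α x₀ y ![coordDual g x₀ y i, coordDual g x₀ y j]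

lemma coordStar_swap (α : M → (Model n) [⋀^Fin 2]→L[ℝ] V) (x₀ : M) (i j : Fin (2 * n)) :
    coordStar Ω g α x₀ j i = -coordStar Ω g α x₀ i j := by
  funext y
  rw [coordStar, twoForm_swap, smul_neg]
  rfl

lemma coordStar_self (α : M → (Model n) [⋀^Fin 2]→L[ℝ] V) (x : M) (i j : Fin (2 * n)) :
    coordStar Ω g α x i j (chartAt (Model n) x x) =
      pfaffian Ω x • α x ![dualB g x i, dualB g x j] := by
  rw [coordStar, coordPf_self, coordForm_self, coordDual_self, coordDual_self]

lemma contDiffAt_coordStar {U : Set M} (hU : IsOpen U) {α : M → (Model n) [⋀^Fin 2]→L[ℝ] V}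
    (hα : SmoothFormOn α U) (x₀ : M) {y : Model n} (hy : y ∈ (chartAt (Model n) x₀).target)
    (hyU : (chartAt (Model n) x₀).symm y ∈ U) (i j : Fin (2 * n)) :
    ContDiffAt ℝ ∞ (coordStar Ω g α x₀ i j) y :=
  (contDiffAt_coordPf Ω x₀ hy).smul
    (contDiffAt_apply_coordDual g x₀ hy (hα.contDiffAt hU x₀ hy hyU) i j)

lemma insertFirst_volForm_single {l : ℕ} (h : 1 + l = 2 * n) (x₀ : M) (y u : Model n)
    (w : Fin l → Model n) :
    insertFirst h (volForm Ω ((chartAt (Model n) x₀).symm y)) ![chartSymmDeriv x₀ y u]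
        (fun a => chartSymmDeriv x₀ y (w a)) =
      coordPf Ω x₀ y * insertFirst h (detForm n) ![u] w := by
  have h1 := congrArg (fun f : (Model n) [⋀^Fin (2 * n)]→L[ℝ] ℝ =>
    f ((Fin.cons u w : Fin (l + 1) → Model n) ∘ Fin.cast (by omega : 2 * n = l + 1)))
    (coordForm_volForm Ω x₀ y)
  rw [insertFirst_single, insertFirst_single]
  refine Eq.trans ?_ h1
  refine congrArg (volForm Ω _) (funext fun i => ?_)
  simp only [Function.comp_apply]
  generalize (Fin.cast (by omega : 2 * n = l + 1) i) = k
  refine Fin.cases ?_ (fun k => ?_) k <;> simp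

lemma insertFirst_volForm_pair {l : ℕ} (h : 2 + l = 2 * n) (x₀ : M) (y u v : Model n)
    (w : Fin l → Model n) :
    insertFirst h (volForm Ω ((chartAt (Model n) x₀).symm y))
        ![chartSymmDeriv x₀ y u, chartSymmDeriv x₀ y v] (fun a => chartSymmDeriv x₀ y (w a)) =
      coordPf Ω x₀ y * insertFirst h (detForm n) ![u, v] w := by
  have h1 := congrArg (fun f : (Model n) [⋀^Fin (2 * n)]→L[ℝ] ℝ =>
    f ((Fin.cons u (Fin.cons v w : Fin (l + 1) → Model n) : Fin (l + 2) → Model n) ∘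
      Fin.cast (by omega : 2 * n = l + 2))) (coordForm_volForm Ω x₀ y)
  rw [insertFirst_pair, insertFirst_pair]
  refine Eq.trans ?_ h1
  refine congrArg (volForm Ω _) (funext fun i => ?_)
  simp only [Function.comp_apply]
  generalize (Fin.cast (by omega : 2 * n = l + 2) i) = k
  refine Fin.cases ?_ (fun k => Fin.cases ?_ (fun k => ?_) k) k <;> simp

/-- The Hodge star of a 2-form in coordinates. -/
lemma coordForm_hodge {l : ℕ} (h : 2 + l = 2 * n) (α : M → (Model n) [⋀^Fin 2]→L[ℝ] V) (x₀ : M)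
    {y : Model n} (hy : y ∈ (chartAt (Model n) x₀).target) (w : Fin l → Model n) :
    coordForm (fun x => hodge Ω g h x (α x)) x₀ y w = (1 / 2 : ℝ) • ∑ i, ∑ j,
      insertFirst h (detForm n) ![stdB i, stdB j] w • coordStar Ω g α x₀ i j y := by
  rw [coordForm_apply, hodge_two_of_isDualFrame h _ (isDualFrame_coordDual g x₀ hy)]
  simp only [insertFirst_volForm_pair, coordStar, coordForm_pair, smul_smul]
  congr 1
  refine Finset.sum_congr rfl fun i _ => Finset.sum_congr rfl fun j _ => ?_
  congr 1
  exact mul_comm _ _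

variable [FiniteDimensional ℝ V]

/-- The exterior derivative of the Hodge star of a 2-form, written as an alternatization to which
`IsCompatible.formInner_hodge` applies. -/
lemma extD_hodge_apply {U : Set M} (hU : IsOpen U) {α : M → (Model n) [⋀^Fin 2]→L[ℝ] V}
    (hα : SmoothFormOn α U) {l : ℕ} (h : 2 + l = 2 * n) {x : M} (hx : x ∈ U)
    (w : Fin (l + 1) → Model n) :
    extD (fun x => hodge Ω g h x (α x)) x w = ∑ k : Fin (l + 1), (-1 : ℤ) ^ (k : ℕ) •
      (1 / 2 : ℝ) • ∑ i, ∑ j, insertFirst h (detForm n) ![stdB i, stdB j] (k.removeNth w) •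
        (fderiv ℝ (coordStar Ω g α x i j) (chartAt (Model n) x x)).toLinearMap (w k) := by
  set y := chartAt (Model n) x x with hy
  have hyt := mem_chart_target (Model n) x
  have hyU : (chartAt (Model n) x).symm y ∈ U := by
    rwa [hy, (chartAt (Model n) x).left_inv (mem_chart_source _ x)]
  have hs : ∀ i j, ContDiffAt ℝ ∞ (coordStar Ω g α x i j) y :=
    contDiffAt_coordStar Ω g hU hα x hyt hyU
  have hev : ∀ m : Fin l → Model n, (fun z => coordForm (fun x => hodge Ω g h x (α x)) x z m)
      =ᶠ[𝓝 y] fun z => (1 / 2 : ℝ) • ∑ i, ∑ j,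
        insertFirst h (detForm n) ![stdB i, stdB j] m • coordStar Ω g α x i j z := fun m => by
    filter_upwards [(chartAt (Model n) x).open_target.mem_nhds hyt] with z hz
    exact coordForm_hodge Ω g h α x hz m
  have hd : DifferentiableAt ℝ (coordForm (fun x => hodge Ω g h x (α x)) x) y := by
    refine (contDiffAt_form (r := ∞) fun m => ?_).differentiableAt (by simp)
    refine ContDiffAt.congr_of_eventuallyEq ?_ (hev m)
    exact contDiffAt_const.smul (ContDiffAt.sum fun i _ => ContDiffAt.sum fun j _ =>
      contDiffAt_const.smul (hs i j))
  rw [extD_eq_extDeriv, extDeriv, ContinuousAlternatingMap.alternatizeUncurryFin_apply]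
  refine Finset.sum_congr rfl fun k _ => ?_
  rw [fderiv_apply_form hd, (hev _).fderiv_eq]
  have hf : HasFDerivAt (fun z => (1 / 2 : ℝ) • ∑ i, ∑ j,
      insertFirst h (detForm n) ![stdB i, stdB j] (k.removeNth w) • coordStar Ω g α x i j z)
      ((1 / 2 : ℝ) • ∑ i, ∑ j, insertFirst h (detForm n) ![stdB i, stdB j] (k.removeNth w) •
        fderiv ℝ (coordStar Ω g α x i j) y) y :=
    HasFDerivAt.const_smul (HasFDerivAt.fun_sum fun i _ => HasFDerivAt.fun_sum fun j _ =>
      (((hs i j).differentiableAt (by simp)).hasFDerivAt).const_smul _) _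
  rw [hf.fderiv]
  simp

end ExteriorHodge

end PrimYM

end

noncomputable section

namespace PrimYM

section Flux

variable {n : ℕ} {M : Type*} [TopologicalSpace M] [ChartedSpace (Model n) M]
  [IsManifold 𝓘(ℝ, Model n) ∞ M]
  {V : Type*} [NormedAddCommGroup V] [NormedSpace ℝ V]
  (Ω : SymplecticForm n M) (g : Metric n M)

/-- The tangent vector obtained by contracting a 2-form with a 1-form; its divergence is the
difference of the two sides of the adjunction between `d` and `d^*`. -/
def flux (κ : V →L[ℝ] V →L[ℝ] ℝ) (x : M) (β : (Model n) [⋀^Fin 2]→L[ℝ] V)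
    (η : (Model n) [⋀^Fin 1]→L[ℝ] V) : Model n :=
  ∑ i, ∑ j, κ (β ![dualB g x i, dualB g x j]) (η ![stdB i]) • stdB j

lemma flux_of_isDualFrame {ι : Type*} [Fintype ι] (κ : V →L[ℝ] V →L[ℝ] ℝ) (x : M)
    {a d : ι → Model n} (h : IsDualFrame (metricBilin g x) a d)
    (β : (Model n) [⋀^Fin 2]→L[ℝ] V) (η : (Model n) [⋀^Fin 1]→L[ℝ] V) :
    flux g κ x β η = ∑ i, ∑ j, κ (β ![d i, d j]) (η ![a i]) • a j := by
  let f : Model n →ₗ[ℝ] Model n →ₗ[ℝ] (V →ₗ[ℝ] Model n) :=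
    LinearMap.mk₂ ℝ (fun u v => ((bilinOf κ).flip (η ![u])).smulRight v)
      (fun u u' v => by ext1 z; simp [oneForm_add, add_smul])
      (fun c u v => by ext1 z; simp [oneForm_smul, mul_smul])
      (fun u v v' => by ext1 z; simp)
      (fun c u v => by ext1 z; simp [smul_smul, mul_comm])
  exact (isDualFrame_dualB g x).sum_sum_bilin h LinearMap.id f (twoFormBilin β)

end Flux

namespace PrincipalBundle

variable {n : ℕ} {M : Type*} [TopologicalSpace M] [ChartedSpace (Model n) M]
  [IsManifold 𝓘(ℝ, Model n) ∞ M]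
  {ι : Type*} {𝔤 : Type*} [NormedAddCommGroup 𝔤] [NormedSpace ℝ 𝔤]
  {G : Type*} [TopologicalSpace G] [ChartedSpace 𝔤 G] [Group G]
  (P : PrincipalBundle ι (Model n) M 𝔤 G) (Ω : SymplecticForm n M) (g : Metric n M)
  (κ : InvariantInner 𝔤 G)

/-- The contraction of the volume form with the flux vector field of `β` and `η`. -/
def fluxForm {l : ℕ} (h : 1 + l = 2 * n) (β : P.LocalForms 2) (η : P.LocalForms 1) (x : M) :
    (Model n) [⋀^Fin l]→L[ℝ] ℝ :=
  insertFirst h (volForm Ω x) ![flux g κ.form x (β (P.indexAt x) x) (η (P.indexAt x) x)]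

/-- The coordinates of `fluxForm` in the chart at `x₀`, computed in the `k`-th trivialization. -/
def fluxCoord (β : P.LocalForms 2) (η : P.LocalForms 1) (k : ι) (x₀ : M) (j : Fin (2 * n))
    (y : Model n) : ℝ :=
  ∑ i, κ.form (coordStar Ω g (β k) x₀ i j y) (coordForm (η k) x₀ y ![stdB i])

variable {P Ω g κ}

lemma coordForm_fluxForm {l : ℕ} (h : 1 + l = 2 * n) {β : P.LocalForms 2} {η : P.LocalForms 1}
    (hβ : P.IsAdForm β) (hη : P.IsAdForm η) (k : ι) (x₀ : M) {y : Model n}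
    (hy : y ∈ (chartAt (Model n) x₀).target) (hk : (chartAt (Model n) x₀).symm y ∈ P.baseSet k)
    (w : Fin l → Model n) : coordForm (P.fluxForm Ω g κ h β η) x₀ y w =
      ∑ j, insertFirst h (detForm n) ![stdB j] w * P.fluxCoord Ω g κ β η k x₀ j y := by
  set p := (chartAt (Model n) x₀).symm y with hp
  have h1 : flux g κ.form p (β (P.indexAt p) p) (η (P.indexAt p) p) =
      flux g κ.form p (β k p) (η k p) := by
    have hx : p ∈ P.baseSet k ∩ P.baseSet (P.indexAt p) := ⟨hk, P.mem_baseSet_at p⟩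
    simp only [flux, hβ.2 k _ p hx, hη.2 k _ p hx, κ.invariant]
  have h2 : flux g κ.form p (β k p) (η k p) = chartSymmDeriv x₀ y (∑ i, ∑ j,
      κ.form (coordForm (β k) x₀ y ![coordDual g x₀ y i, coordDual g x₀ y j])
        (coordForm (η k) x₀ y ![stdB i]) • stdB j) := by
    rw [flux_of_isDualFrame g κ.form p (isDualFrame_coordDual g x₀ hy)]
    simp only [map_sum, map_smul, coordForm_pair, coordForm_single]
    rfl
  rw [coordForm_apply, fluxForm, ← hp, h1, h2, hp, insertFirst_volForm_single, ← insertOne_apply]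
  simp only [map_sum, map_smul, insertOne_apply, fluxCoord, coordStar, smul_apply, smul_eq_mul,
    Finset.mul_sum]
  rw [Finset.sum_comm]
  refine Finset.sum_congr rfl fun j _ => Finset.sum_congr rfl fun i _ => ?_
  ring

lemma contDiffAt_fluxCoord {β : P.LocalForms 2} {η : P.LocalForms 1}
    (hβ : P.IsAdForm β) (hη : P.IsAdForm η) (k : ι) (x₀ : M) {y : Model n}
    (hy : y ∈ (chartAt (Model n) x₀).target) (hk : (chartAt (Model n) x₀).symm y ∈ P.baseSet k)
    (j : Fin (2 * n)) : ContDiffAt ℝ ∞ (P.fluxCoord Ω g κ β η k x₀ j) y :=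
  ContDiffAt.sum fun i _ => (κ.form.contDiff.contDiffAt.comp y
    (contDiffAt_coordStar Ω g (P.isOpen_baseSet k) (hβ.1 k) x₀ hy hk i j)).clm_apply
      (((hη.1 k).contDiffAt (P.isOpen_baseSet k) x₀ hy hk).apply_form _)

lemma coordForm_fluxForm_eventuallyEq {l : ℕ} (h : 1 + l = 2 * n) {β : P.LocalForms 2}
    {η : P.LocalForms 1} (hβ : P.IsAdForm β) (hη : P.IsAdForm η) (k : ι) (x₀ : M) {y : Model n}
    (hy : y ∈ (chartAt (Model n) x₀).target) (hk : (chartAt (Model n) x₀).symm y ∈ P.baseSet k)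
    (w : Fin l → Model n) : (fun z => coordForm (P.fluxForm Ω g κ h β η) x₀ z w) =ᶠ[𝓝 y]
      fun z => ∑ j, insertFirst h (detForm n) ![stdB j] w * P.fluxCoord Ω g κ β η k x₀ j z := by
  filter_upwards [(chartAt (Model n) x₀).open_target.mem_nhds hy,
    ((chartAt (Model n) x₀).continuousAt_symm hy).preimage_mem_nhds
      ((P.isOpen_baseSet k).mem_nhds hk)] with z hz hzk
  exact coordForm_fluxForm h hβ hη k x₀ hz hzk w

lemma smoothFormOn_fluxForm {l : ℕ} (h : 1 + l = 2 * n) {β : P.LocalForms 2}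
    {η : P.LocalForms 1} (hβ : P.IsAdForm β) (hη : P.IsAdForm η) :
    SmoothFormOn (P.fluxForm Ω g κ h β η) Set.univ :=
  smoothFormOn_of_contDiffAt fun x₀ _ hy _ => contDiffAt_form fun w =>
    ContDiffAt.congr_of_eventuallyEq
      (ContDiffAt.sum fun j _ => contDiffAt_const.mul
        (contDiffAt_fluxCoord hβ hη _ x₀ hy (P.mem_baseSet_at _) j))
      (coordForm_fluxForm_eventuallyEq h hβ hη _ x₀ hy (P.mem_baseSet_at _) w)

/-- The divergence of the flux vector field is the sum of the derivatives of the components of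
`fluxForm`. -/
lemma topDiv_fluxForm {l : ℕ} (h : 1 + l = 2 * n) (h' : l + 1 = 2 * n) {β : P.LocalForms 2}
    {η : P.LocalForms 1} (hβ : P.IsAdForm β) (hη : P.IsAdForm η) (x : M) :
    topDiv Ω h' (P.fluxForm Ω g κ h β η) x = (pfaffian Ω x)⁻¹ * ∑ j,
      fderiv ℝ (P.fluxCoord Ω g κ β η (P.indexAt x) x j) (chartAt (Model n) x x) (stdB j) := by
  set y := chartAt (Model n) x x with hy
  have hyt := mem_chart_target (Model n) x
  have hk : (chartAt (Model n) x).symm y ∈ P.baseSet (P.indexAt x) := by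
    rw [hy, (chartAt (Model n) x).left_inv (mem_chart_source _ x)]
    exact P.mem_baseSet_at x
  have hd := (smoothFormOn_fluxForm (Ω := Ω) (g := g) (κ := κ) h hβ hη).contDiffAt isOpen_univ x hyt
    (Set.mem_univ _)
  have hm : Module.finrank ℝ (Model n) < 2 * n + 1 := by simp
  rw [topDiv, div_eq_inv_mul, extD_eq_extDeriv, extDeriv,
    ContinuousAlternatingMap.alternatizeUncurryFin_apply]
  congr 1
  have h1 : ∀ k : Fin (l + 1), (-1 : ℤ) ^ (k : ℕ) •
      fderiv ℝ (coordForm (P.fluxForm Ω g κ h β η) x) (chartAt (Model n) x x)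
        ((stdB ∘ Fin.cast h') k) (k.removeNth (stdB ∘ Fin.cast h')) =
      ∑ j, (-1 : ℤ) ^ (k : ℕ) •
        insertFirst h (detForm n) ![stdB j] (k.removeNth (stdB ∘ Fin.cast h')) •
          (fderiv ℝ (P.fluxCoord Ω g κ β η (P.indexAt x) x j) y).toLinearMap
            ((stdB ∘ Fin.cast h') k) := fun k => by
    rw [fderiv_apply_form (hd.differentiableAt (by simp)),
      (coordForm_fluxForm_eventuallyEq h hβ hη (P.indexAt x) x hyt hk _).fderiv_eq,
      ← Finset.smul_sum]
    have hf : HasFDerivAt (fun z => ∑ j, insertFirst h (detForm n) ![stdB j]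
        (k.removeNth (stdB ∘ Fin.cast h')) * P.fluxCoord Ω g κ β η (P.indexAt x) x j z)
        (∑ j, insertFirst h (detForm n) ![stdB j] (k.removeNth (stdB ∘ Fin.cast h')) •
          fderiv ℝ (P.fluxCoord Ω g κ β η (P.indexAt x) x j) y) y :=
      HasFDerivAt.fun_sum fun j _ => ((contDiffAt_fluxCoord hβ hη _ x hyt hk
        j).differentiableAt (by simp)).hasFDerivAt.const_mul _
    rw [hf.fderiv]
    simp
  simp only [h1]
  rw [Finset.sum_comm]
  refine Finset.sum_congr rfl fun j _ => ?_
  rw [sum_insertFirst_single hm h h']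
  have h2 : (stdB ∘ Fin.cast h') ∘ Fin.cast h'.symm = (stdB : Fin (2 * n) → Model n) := rfl
  rw [h2, detForm_stdB, one_smul]
  rfl

end PrincipalBundle

end PrimYM

end

noncomputable section

namespace PrimYM

section HodgeLinear

variable {n : ℕ} {M : Type*} [TopologicalSpace M] [ChartedSpace (Model n) M]
  [IsManifold 𝓘(ℝ, Model n) ∞ M]
  {V : Type*} [NormedAddCommGroup V] [NormedSpace ℝ V]
  (Ω : SymplecticForm n M) (g : Metric n M)

lemma hodge_add {k l : ℕ} (h : k + l = 2 * n) (x : M) (α β : (Model n) [⋀^Fin k]→L[ℝ] V) :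
    hodge Ω g h x (α + β) = hodge Ω g h x α + hodge Ω g h x β := by
  ext v
  simp [hodge, Finset.sum_add_distrib, smul_add]

lemma formInner_neg_left (κ : V →L[ℝ] V →L[ℝ] ℝ) {k : ℕ} (x : M)
    (α β : (Model n) [⋀^Fin k]→L[ℝ] V) :
    formInner g κ x (-α) β = -formInner g κ x α β := by
  simpa using formInner_smul_left g κ x (-1) α β

end HodgeLinear

namespace PrincipalBundle

variable {n : ℕ} {M : Type*} [TopologicalSpace M] [ChartedSpace (Model n) M]
  [IsManifold 𝓘(ℝ, Model n) ∞ M]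
  {ι : Type*} {𝔤 : Type*} [NormedAddCommGroup 𝔤] [NormedSpace ℝ 𝔤] [FiniteDimensional ℝ 𝔤]
  {G : Type*} [TopologicalSpace G] [ChartedSpace 𝔤 G] [Group G] [LieGroup 𝓘(ℝ, 𝔤) ∞ G]
  {P : PrincipalBundle ι (Model n) M 𝔤 G} {Ω : SymplecticForm n M} {g : Metric n M}
  {κ : InvariantInner 𝔤 G}

/-- The pointwise scalar product with an exact 2-form. -/
lemma formInner_extD_right (κ : 𝔤 →L[ℝ] 𝔤 →L[ℝ] ℝ) {U : Set M} (hU : IsOpen U)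
    {η : M → (Model n) [⋀^Fin 1]→L[ℝ] 𝔤} (hη : SmoothFormOn η U) {x : M} (hx : x ∈ U)
    (β : (Model n) [⋀^Fin 2]→L[ℝ] 𝔤) :
    formInner g κ x β (extD η x) = -∑ i, ∑ j, κ (β ![dualB g x i, dualB g x j])
      (fderiv ℝ (fun y => coordForm η x y ![stdB i]) (chartAt (Model n) x x) (stdB j)) := by
  have hd := hη.differentiableAt_coordForm_self hU hx
  rw [formInner_two_of_isDualFrame g κ x ((isDualFrame_dualB g x).symm (metricBilin_symm g x)),
    extD_eq_extDeriv]
  simp only [extDeriv_one, fderiv_apply_form hd, map_sub, Finset.sum_sub_distrib]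
  have h : ∑ i, ∑ j, κ (β ![dualB g x i, dualB g x j])
        (fderiv ℝ (fun y => coordForm η x y ![stdB j]) (chartAt (Model n) x x) (stdB i)) =
      -∑ i, ∑ j, κ (β ![dualB g x i, dualB g x j])
        (fderiv ℝ (fun y => coordForm η x y ![stdB i]) (chartAt (Model n) x x) (stdB j)) := by
    rw [Finset.sum_comm, ← Finset.sum_neg_distrib]
    refine Finset.sum_congr rfl fun i _ => ?_
    rw [← Finset.sum_neg_distrib]
    refine Finset.sum_congr rfl fun j _ => ?_
    rw [twoForm_swap, map_neg, neg_apply]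
  rw [h]
  ring

/-- The covariant codifferential is adjoint to the covariant derivative up to a divergence. -/
lemma innerAt_covCodiff (hg : IsCompatible Ω g) {l : ℕ} (h : 1 + 1 + l = 2 * n)
    (h₁ : 1 + (l + 1) = 2 * n) (h₂ : l + 1 + 1 = 2 * n) (A : P.LocalForms 1) {β : P.LocalForms 2}
    {η : P.LocalForms 1} (hβ : P.IsAdForm β) (hη : P.IsAdForm η) (x : M) :
    P.innerAt g κ (P.covCodiff Ω g h A β) η x = P.innerAt g κ β (P.covD A η) x +
      topDiv Ω h₂ (P.fluxForm Ω g κ h₁ β η) x := by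
  set k := P.indexAt x with hk
  set y := chartAt (Model n) x x with hy
  have hxk : x ∈ P.baseSet k := P.mem_baseSet_at x
  have hyt := mem_chart_target (Model n) x
  have hyk : (chartAt (Model n) x).symm y ∈ P.baseSet k := by
    rwa [hy, (chartAt (Model n) x).left_inv (mem_chart_source _ x)]
  have hpf := hg.pfaffian_ne_zero x
  have hs := fun i j => (contDiffAt_coordStar Ω g (P.isOpen_baseSet k) (hβ.1 k) x hyt hyk i
    j).differentiableAt (n := ∞) (by simp)
  have he := fun i : Fin (2 * n) => (((hη.1 k).contDiffAt (P.isOpen_baseSet k) x hyt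
    hyk).apply_form ![stdB i]).differentiableAt (n := ∞) (by simp)
  have h1 : formInner g κ.form x (hodge Ω g h₂ x (extD (fun x => hodge Ω g h x (β k x)) x))
      (η k x) = -(pfaffian Ω x)⁻¹ * ∑ i, ∑ j,
        κ.form (fderiv ℝ (coordStar Ω g (β k) x i j) y (stdB j)) (η k x ![stdB i]) := by
    refine hg.formInner_hodge κ.form h₂ h x _ (fun i j =>
      (fderiv ℝ (coordStar Ω g (β k) x i j) y).toLinearMap) (fun i j => ?_)
      (extD_hodge_apply Ω g (P.isOpen_baseSet k) (hβ.1 k) h hxk) (η k x)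
    rw [coordStar_swap, fderiv_neg]
    rfl
  have h2 := formInner_hodge_bracketLeft hg κ h₂ h x (β k x) (A k x) (η k x)
  -- The Leibniz rule for the divergence; its two parts are `⋆d⋆β` against `η` and `β` against `dη`.
  have h3 : ∑ j, fderiv ℝ (P.fluxCoord Ω g κ β η k x j) y (stdB j) =
      ∑ i, ∑ j, κ.form (fderiv ℝ (coordStar Ω g (β k) x i j) y (stdB j)) (η k x ![stdB i]) +
      pfaffian Ω x * ∑ i, ∑ j, κ.form (β k x ![dualB g x i, dualB g x j])
        (fderiv ℝ (fun z => coordForm (η k) x z ![stdB i]) y (stdB j)) := by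
    have h4 : ∀ j, fderiv ℝ (P.fluxCoord Ω g κ β η k x j) y (stdB j) =
        ∑ i, (κ.form (fderiv ℝ (coordStar Ω g (β k) x i j) y (stdB j)) (η k x ![stdB i]) +
          pfaffian Ω x * κ.form (β k x ![dualB g x i, dualB g x j])
            (fderiv ℝ (fun z => coordForm (η k) x z ![stdB i]) y (stdB j))) := fun j => by
      have hf : ∀ i, HasFDerivAt (fun z => κ.form (coordStar Ω g (β k) x i j z)
          (coordForm (η k) x z ![stdB i])) _ y := fun i =>
        (κ.form.hasFDerivAt.comp y (hs i j).hasFDerivAt).clm_apply (he i).hasFDerivAt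
      have hf' := (HasFDerivAt.fun_sum (u := Finset.univ) fun i _ => hf i).fderiv
      refine (congrArg (fun L : Model n →L[ℝ] ℝ => L (stdB j)) hf').trans ?_
      simp only [sum_apply]
      refine Finset.sum_congr rfl fun i _ => ?_
      simp only [Function.comp_apply, hy, coordStar_self, coordForm_self]
      simp [add_comm]
    simp only [h4, Finset.sum_add_distrib, ← Finset.mul_sum]
    rw [Finset.sum_comm]
    congr 2
    rw [Finset.sum_comm]
  have h5 : P.innerAt g κ (P.covCodiff Ω g h A β) η x =
      -formInner g κ.form x (hodge Ω g h₂ x (extD (fun x => hodge Ω g h x (β k x)) x +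
        bracketLeft G (A k x) (hodge Ω g h x (β k x)))) (η k x) := by
    rw [← formInner_neg_left]
    rfl
  have h6 : P.innerAt g κ β (P.covD A η) x = formInner g κ.form x (β k x) (extD (η k) x) +
      formInner g κ.form x (β k x) (bracketLeft G (A k x) (η k x)) :=
    formInner_add_right g κ.form x _ _ _
  rw [h5, hodge_add, formInner_add_left, h1, h2, h6, topDiv_fluxForm h₁ h₂ hβ hη, h3,
    formInner_extD_right κ.form (P.isOpen_baseSet k) (hη.1 k) hxk]
  field_simp
  ring

end PrincipalBundle

end PrimYM

end

noncomputable section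

namespace PrimYM

/-! ### The action along a line of connections -/

namespace PrincipalBundle

section Variation

variable {E : Type*} [NormedAddCommGroup E] [NormedSpace ℝ E] [FiniteDimensional ℝ E]
  {M : Type*} [TopologicalSpace M] [ChartedSpace E M] [IsManifold 𝓘(ℝ, E) ∞ M]
  {ι : Type*} {𝔤 : Type*} [NormedAddCommGroup 𝔤] [NormedSpace ℝ 𝔤] [FiniteDimensional ℝ 𝔤]
  {G : Type*} [TopologicalSpace G] [ChartedSpace 𝔤 G] [Group G] [LieGroup 𝓘(ℝ, 𝔤) ∞ G]
  {P : PrincipalBundle ι E M 𝔤 G} {A η : P.LocalForms 1}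

/-- The 2-form `½ [η, η]`. -/
def halfBracket (P : PrincipalBundle ι E M 𝔤 G) (η : P.LocalForms 1) : P.LocalForms 2 :=
  fun i x => (1 / 2 : ℝ) • bracketLeft G (η i x) (η i x)

lemma half_bracketLeft_add_smul (α β : E [⋀^Fin 1]→L[ℝ] 𝔤) (t : ℝ) :
    (1 / 2 : ℝ) • bracketLeft G (α + t • β) (α + t • β) =
      (1 / 2 : ℝ) • bracketLeft G α α + t • bracketLeft G α β +
        t ^ 2 • (1 / 2 : ℝ) • bracketLeft G β β := by
  refine twoForm_ext fun u v => ?_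
  simp only [ContinuousAlternatingMap.add_apply, ContinuousAlternatingMap.smul_apply,
    bracketLeft_apply_two, map_add, map_smul, add_apply, smul_apply]
  rw [lieBr_skew (β ![u]) (α ![v]), lieBr_skew (β ![v]) (α ![u])]
  module

/-- `F(A + t η) = F(A) + t d_A η + t² ½ [η, η]`. -/
lemma IsConnection.curvature_add_smul (hA : P.IsConnection A) (hη : P.IsAdForm η) (t : ℝ) {i : ι}
    {x : M} (hx : x ∈ P.baseSet i) : P.curvature (A + t • η) i x =
      P.curvature A i x + t • P.covD A η i x + t ^ 2 • P.halfBracket η i x := by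
  have h1 : extD ((A + t • η) i) x = extD (A i) x + t • extD (η i) x := by
    have := extD_add (hA.1 i) ((hη.1 i).const_smul t) (P.isOpen_baseSet i) hx
    rwa [extD_const_smul] at this
  have h2 := half_bracketLeft_add_smul (G := G) (A i x) (η i x) t
  change extD ((A + t • η) i) x + (1 / 2 : ℝ) • bracketLeft G (A i x + t • η i x)
    (A i x + t • η i x) = _
  rw [h1, h2]
  simp only [curvature, covD, halfBracket]
  module

/-- The covariant derivative `d_A η` is the odd part of `t ↦ F(A + t η)` at `t = 1`, hence a form
with values in `Ad P`. -/
lemma IsConnection.isAdForm_covD (hA : P.IsConnection A) (hη : P.IsAdForm η) :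
    P.IsAdForm (P.covD A η) := by
  refine (((hA.add_smul hη 1).isAdForm_curvature.const_smul (1 / 2)).add
    ((hA.add_smul hη (-1)).isAdForm_curvature.const_smul (-(1 / 2)))).congr fun i x hx => ?_
  simp only [Pi.add_apply, Pi.smul_apply, hA.curvature_add_smul hη _ hx]
  module

lemma IsConnection.isAdForm_halfBracket (hA : P.IsConnection A) (hη : P.IsAdForm η) :
    P.IsAdForm (P.halfBracket η) := by
  refine ((((hA.add_smul hη 1).isAdForm_curvature.const_smul (1 / 2)).add
    ((hA.add_smul hη (-1)).isAdForm_curvature.const_smul (1 / 2))).add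
    (hA.isAdForm_curvature.const_smul (-1))).congr fun i x hx => ?_
  simp only [Pi.add_apply, Pi.smul_apply, hA.curvature_add_smul hη _ hx]
  module

lemma bracketLeft_zero_right (α : E [⋀^Fin 1]→L[ℝ] 𝔤) :
    bracketLeft G α (0 : E [⋀^Fin 1]→L[ℝ] 𝔤) = 0 :=
  twoForm_ext fun u v => by rw [bracketLeft_apply_two]; simp

lemma covD_eq_zero {K : Set M} (hK : IsClosed K)
    (h0 : ∀ x ∉ K, ∀ i, x ∈ P.baseSet i → η i x = 0) {i : ι} {x : M} (hx : x ∈ P.baseSet i)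
    (hxK : x ∉ K) : P.covD A η i x = 0 := by
  have h1 : η i =ᶠ[𝓝 x] 0 := by
    filter_upwards [hK.isOpen_compl.mem_nhds hxK, (P.isOpen_baseSet i).mem_nhds hx] with z hz hz'
    exact h0 z hz i hz'
  simp only [covD]
  rw [extD_congr_of_eventuallyEq h1, extD_zero, h0 x hxK i hx, bracketLeft_zero_right, add_zero]

lemma halfBracket_eq_zero {i : ι} {x : M} (h : η i x = 0) : P.halfBracket η i x = 0 := by
  rw [halfBracket, h, bracketLeft_zero_right, smul_zero]

end Variation

variable {n : ℕ} {M : Type*} [TopologicalSpace M] [ChartedSpace (Model n) M]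
  [IsManifold 𝓘(ℝ, Model n) ∞ M]
  {ι : Type*} {𝔤 : Type*} [NormedAddCommGroup 𝔤] [NormedSpace ℝ 𝔤] [FiniteDimensional ℝ 𝔤]
  {G : Type*} [TopologicalSpace G] [ChartedSpace 𝔤 G] [Group G] [LieGroup 𝓘(ℝ, 𝔤) ∞ G]
  {P : PrincipalBundle ι (Model n) M 𝔤 G} {Ω : SymplecticForm n M} {g : Metric n M}
  {κ : InvariantInner 𝔤 G} {A η : P.LocalForms 1}

lemma IsConnection.isAdForm_dPlus (hA : P.IsConnection A) (hη : P.IsAdForm η) :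
    P.IsAdForm (P.dPlus Ω g A η) :=
  (hA.isAdForm_covD hη).prim

lemma IsConnection.isAdForm_curvaturePrim (hA : P.IsConnection A) :
    P.IsAdForm (P.curvaturePrim Ω g A) :=
  hA.isAdForm_curvature.prim

/-- The density of the action along `A + t η` is a polynomial of degree four in `t`. -/
lemma innerAt_curvaturePrim_add_smul (hA : P.IsConnection A) (hη : P.IsAdForm η) (t : ℝ) (x : M) :
    P.innerAt g κ (P.curvaturePrim Ω g (A + t • η)) (P.curvaturePrim Ω g (A + t • η)) x =
      P.innerAt g κ (P.curvaturePrim Ω g A) (P.curvaturePrim Ω g A) x +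
      2 * t * P.innerAt g κ (P.curvaturePrim Ω g A) (P.dPlus Ω g A η) x +
      t ^ 2 * (P.innerAt g κ (P.dPlus Ω g A η) (P.dPlus Ω g A η) x +
        2 * P.innerAt g κ (P.curvaturePrim Ω g A) (P.prim Ω g (P.halfBracket η)) x) +
      2 * t ^ 3 * P.innerAt g κ (P.dPlus Ω g A η) (P.prim Ω g (P.halfBracket η)) x +
      t ^ 4 * P.innerAt g κ (P.prim Ω g (P.halfBracket η)) (P.prim Ω g (P.halfBracket η)) x := by
  set i := P.indexAt x with hi
  have h1 : P.curvaturePrim Ω g (A + t • η) i x = P.curvaturePrim Ω g A i x +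
      t • P.dPlus Ω g A η i x + t ^ 2 • P.prim Ω g (P.halfBracket η) i x := by
    change primPart Ω g x (P.curvature (A + t • η) i x) = _
    rw [hA.curvature_add_smul hη t (P.mem_baseSet_at x), primPart_add, primPart_add, primPart_smul,
      primPart_smul]
    rfl
  have hs := formInner_two_symm g κ.symm x
  simp only [innerAt, ← hi, h1]
  simp only [formInner_add_left, formInner_add_right, formInner_smul_left, formInner_smul_right]
  rw [hs (P.dPlus Ω g A η i x) (P.curvaturePrim Ω g A i x),
    hs (P.prim Ω g (P.halfBracket η) i x) (P.curvaturePrim Ω g A i x),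
    hs (P.prim Ω g (P.halfBracket η) i x) (P.dPlus Ω g A η i x)]
  ring

/-- Pointwise, the Hessian operator gives the second order term of the density of the action up to
a divergence. -/
lemma innerAt_hessianOp (hn : 2 ≤ n) (hg : IsCompatible Ω g) (hA : P.IsConnection A)
    (hη : P.IsAdForm η) (x : M) :
    P.innerAt g κ (P.hessianOp Ω g hn A η) η x =
      (P.innerAt g κ (P.dPlus Ω g A η) (P.dPlus Ω g A η) x +
        2 * P.innerAt g κ (P.curvaturePrim Ω g A) (P.prim Ω g (P.halfBracket η)) x) +
      topDiv Ω (show 2 * n - 2 + 1 + 1 = 2 * n by omega)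
        (P.fluxForm Ω g κ (show 1 + (2 * n - 2 + 1) = 2 * n by omega) (P.dPlus Ω g A η) η) x := by
  have hn0 : n ≠ 0 := by omega
  set i := P.indexAt x with hi
  have h1 := innerAt_covCodiff (Ω := Ω) (g := g) (κ := κ) hg
    (show 1 + 1 + (2 * n - 2) = 2 * n by omega)
    (show 1 + (2 * n - 2 + 1) = 2 * n by omega) (show 2 * n - 2 + 1 + 1 = 2 * n by omega) A
    (hA.isAdForm_dPlus (Ω := Ω) (g := g) hη) hη x
  have h2 := formInner_hodge_bracketRight hg κ (show 2 * n - 2 + 1 + 1 = 2 * n by omega)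
    (show 2 + (2 * n - 2) = 2 * n by omega) x (P.curvaturePrim Ω g A i x) (η i x)
  have h3 : P.innerAt g κ (P.hessianOp Ω g hn A η) η x =
      P.innerAt g κ (P.covCodiff Ω g (show 1 + 1 + (2 * n - 2) = 2 * n by omega) A
        (P.dPlus Ω g A η)) η x +
      formInner g κ.form x (hodge Ω g (show 2 * n - 2 + 1 + 1 = 2 * n by omega) x
        (bracketRight G (hodge Ω g (show 2 + (2 * n - 2) = 2 * n by omega) x
          (P.curvaturePrim Ω g A i x)) (η i x))) (η i x) :=
    formInner_add_left g κ.form x _ _ _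
  have h4 : P.innerAt g κ (P.dPlus Ω g A η) (P.covD A η) x =
      P.innerAt g κ (P.dPlus Ω g A η) (P.dPlus Ω g A η) x :=
    (hg.formInner_primPart_right hn0 κ.form x (P.covD A η i x) (P.covD A η i x)).symm
  have h5 : formInner g κ.form x (P.curvaturePrim Ω g A i x) (bracketLeft G (η i x) (η i x)) =
      2 * P.innerAt g κ (P.curvaturePrim Ω g A) (P.prim Ω g (P.halfBracket η)) x := by
    have h6 : P.innerAt g κ (P.curvaturePrim Ω g A) (P.prim Ω g (P.halfBracket η)) x =
        formInner g κ.form x (P.curvaturePrim Ω g A i x) (P.halfBracket η i x) :=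
      hg.formInner_primPart_right hn0 κ.form x (P.curvature A i x) (P.halfBracket η i x)
    rw [h6, halfBracket, formInner_smul_right]
    ring
  rw [h3, h2, h5, h1, h4]
  ring

lemma fluxForm_eq_zero {l : ℕ} (h : 1 + l = 2 * n) {β : P.LocalForms 2} {x : M}
    (h0 : η (P.indexAt x) x = 0) : P.fluxForm Ω g κ h β η x = 0 := by
  have h1 : flux g κ.form x (β (P.indexAt x) x) (η (P.indexAt x) x) = 0 := by
    simp [flux, h0]
  ext w
  rw [fluxForm, h1, ← insertOne_apply, map_zero]
  rfl

variable [T2Space M] [MeasurableSpace M] [BorelSpace M]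

lemma integrable_innerAt_of_eq_zero {α β : P.LocalForms 2} (hα : P.IsAdForm α) (hβ : P.IsAdForm β)
    {K : Set M} (hK : IsCompact K) (h0 : ∀ x ∉ K, ∀ i, x ∈ P.baseSet i → β i x = 0) :
    Integrable (P.innerAt g κ α β) (riemVolume g) :=
  (hα.continuous_innerAt hβ).integrable_of_hasCompactSupport <|
    HasCompactSupport.intro hK fun x hx => by
      rw [innerAt, h0 x hx _ (P.mem_baseSet_at x), formInner_zero_right]

end PrincipalBundle

/-- The second derivative of a polynomial of degree four at zero. -/
lemma iteratedDeriv_quartic (a b c d e : ℝ) :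
    iteratedDeriv 2 (fun t : ℝ => a + b * t + c * t ^ 2 + d * t ^ 3 + e * t ^ 4) 0 = 2 * c := by
  have h1 : deriv (fun t : ℝ => a + b * t + c * t ^ 2 + d * t ^ 3 + e * t ^ 4) =
      fun t => b + 2 * c * t + 3 * d * t ^ 2 + 4 * e * t ^ 3 := by
    funext t
    refine HasDerivAt.deriv (HasDerivAt.congr_deriv
      (((((hasDerivAt_const t a).add ((hasDerivAt_id t).const_mul b)).add
      (((hasDerivAt_pow 2 t)).const_mul c)).add ((hasDerivAt_pow 3 t).const_mul d)).add
      ((hasDerivAt_pow 4 t).const_mul e)) ?_)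
    norm_num
    ring
  have h2 : HasDerivAt (fun t : ℝ => b + 2 * c * t + 3 * d * t ^ 2 + 4 * e * t ^ 3) (2 * c) 0 := by
    refine HasDerivAt.congr_deriv
      ((((hasDerivAt_const (0 : ℝ) b).add ((hasDerivAt_id (0 : ℝ)).const_mul (2 * c))).add
      ((hasDerivAt_pow 2 (0 : ℝ)).const_mul (3 * d))).add
      ((hasDerivAt_pow 3 (0 : ℝ)).const_mul (4 * e))) ?_
    norm_num
  rw [iteratedDeriv_succ, iteratedDeriv_one, h1, h2.deriv]

lemma integral_quartic {X : Type*} [MeasurableSpace X] {μ : Measure X} {f₀ f₁ f₂ f₃ f₄ : X → ℝ}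
    (h₀ : Integrable f₀ μ) (h₁ : Integrable f₁ μ) (h₂ : Integrable f₂ μ) (h₃ : Integrable f₃ μ)
    (h₄ : Integrable f₄ μ) (t : ℝ) :
    Integrable (fun x => f₀ x + 2 * t * f₁ x + t ^ 2 * f₂ x + 2 * t ^ 3 * f₃ x + t ^ 4 * f₄ x) μ ∧
    ∫ x, (f₀ x + 2 * t * f₁ x + t ^ 2 * f₂ x + 2 * t ^ 3 * f₃ x + t ^ 4 * f₄ x) ∂μ =
      (∫ x, f₀ x ∂μ) + 2 * (∫ x, f₁ x ∂μ) * t + (∫ x, f₂ x ∂μ) * t ^ 2 +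
        2 * (∫ x, f₃ x ∂μ) * t ^ 3 + (∫ x, f₄ x ∂μ) * t ^ 4 := by
  have i₁ : Integrable (fun x => f₀ x + 2 * t * f₁ x) μ := h₀.add (h₁.const_mul _)
  have i₂ : Integrable (fun x => f₀ x + 2 * t * f₁ x + t ^ 2 * f₂ x) μ := i₁.add (h₂.const_mul _)
  have i₃ : Integrable (fun x => f₀ x + 2 * t * f₁ x + t ^ 2 * f₂ x + 2 * t ^ 3 * f₃ x) μ :=
    i₂.add (h₃.const_mul _)
  refine ⟨i₃.add (h₄.const_mul _), ?_⟩
  rw [integral_add i₃ (h₄.const_mul _), integral_add i₂ (h₃.const_mul _),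
    integral_add i₁ (h₂.const_mul _), integral_add h₀ (h₁.const_mul _), integral_const_mul,
    integral_const_mul, integral_const_mul, integral_const_mul]
  ring

end PrimYM

end

theorem mainTheorem9 {n : ℕ} (hn : 2 ≤ n)
    {M : Type*} [TopologicalSpace M] [T2Space M] [SecondCountableTopology M]
    [ChartedSpace (Model n) M] [IsManifold 𝓘(ℝ, Model n) ∞ M]
    [MeasurableSpace M] [BorelSpace M]
    {𝔤 : Type*} [NormedAddCommGroup 𝔤] [NormedSpace ℝ 𝔤] [FiniteDimensional ℝ 𝔤]
    {G : Type*} [TopologicalSpace G] [ChartedSpace 𝔤 G] [Group G] [LieGroup 𝓘(ℝ, 𝔤) ∞ G]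
    (Ω : SymplecticForm n M) (g : Metric n M) (hg : IsCompatible Ω g)
    (κ : InvariantInner 𝔤 G)
    {ι : Type*} (P : PrincipalBundle ι (Model n) M 𝔤 G)
    (A : P.LocalForms 1) (hA : P.IsConnection A) (hfin : P.FiniteAction Ω g κ A)
    (hcrit : P.IsCriticalPoint Ω g κ A)
    (η : P.LocalForms 1) (hη : P.IsAdForm η) (hsupp : P.HasCompactSupport η) :
    (∀ t : ℝ, P.FiniteAction Ω g κ (A + t • η)) ∧
    ContDiff ℝ 2 (fun t : ℝ => P.action Ω g κ (A + t • η)) ∧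
    Integrable (P.innerAt g κ (P.hessianOp Ω g hn A η) η) (riemVolume g) ∧
    P.hessianForm Ω g κ A η = P.innerL2 g κ (P.hessianOp Ω g hn A η) η := by
  obtain ⟨K, hK, h0⟩ := hsupp
  have hF := hA.isAdForm_curvaturePrim (Ω := Ω) (g := g)
  have hX := hA.isAdForm_dPlus (Ω := Ω) (g := g) hη
  have hY := (hA.isAdForm_halfBracket hη).prim (Ω := Ω) (g := g)
  have hX0 : ∀ x ∉ K, ∀ i, x ∈ P.baseSet i → P.dPlus Ω g A η i x = 0 := fun x hx i hi => by
    simp only [PrincipalBundle.dPlus, PrincipalBundle.prim]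
    rw [PrincipalBundle.covD_eq_zero hK.isClosed h0 hi hx, primPart_zero]
  have hY0 : ∀ x ∉ K, ∀ i, x ∈ P.baseSet i → P.prim Ω g (P.halfBracket η) i x = 0 :=
    fun x hx i hi => by
      simp only [PrincipalBundle.prim]
      rw [PrincipalBundle.halfBracket_eq_zero (h0 x hx i hi), primPart_zero]
  have hFX := PrincipalBundle.integrable_innerAt_of_eq_zero (κ := κ) (g := g) hF hX hK hX0
  have hFY := PrincipalBundle.integrable_innerAt_of_eq_zero (κ := κ) (g := g) hF hY hK hY0
  have hXX := PrincipalBundle.integrable_innerAt_of_eq_zero (κ := κ) (g := g) hX hX hK hX0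
  have hXY := PrincipalBundle.integrable_innerAt_of_eq_zero (κ := κ) (g := g) hX hY hK hY0
  have hYY := PrincipalBundle.integrable_innerAt_of_eq_zero (κ := κ) (g := g) hY hY hK hY0
  have hFF : Integrable (P.innerAt g κ (P.curvaturePrim Ω g A) (P.curvaturePrim Ω g A))
      (riemVolume g) := hfin
  have hQ : Integrable (fun x => P.innerAt g κ (P.dPlus Ω g A η) (P.dPlus Ω g A η) x +
      2 * P.innerAt g κ (P.curvaturePrim Ω g A) (P.prim Ω g (P.halfBracket η)) x)
      (riemVolume g) := hXX.add (hFY.const_mul 2)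
  -- The density of the action is a polynomial in `t` with integrable coefficients.
  have hpoly := fun t : ℝ => funext fun x =>
    PrincipalBundle.innerAt_curvaturePrim_add_smul (Ω := Ω) (g := g) (κ := κ) hA hη t x
  have hquartic := fun t : ℝ => integral_quartic hFF hFX hQ hXY hYY t
  have hfinite : ∀ t : ℝ, P.FiniteAction Ω g κ (A + t • η) := fun t => by
    rw [PrincipalBundle.FiniteAction, hpoly t]
    exact (hquartic t).1
  have hS : ∀ t : ℝ, P.action Ω g κ (A + t • η) = ∫ x, P.innerAt g κ
      (P.curvaturePrim Ω g (A + t • η)) (P.curvaturePrim Ω g (A + t • η)) x ∂(riemVolume g) :=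
    fun _ => rfl
  have hact := funext fun t : ℝ => (hS t).trans
    ((congrArg (fun f : M → ℝ => ∫ x, f x ∂(riemVolume g)) (hpoly t)).trans (hquartic t).2)
  -- Pointwise, `⟨Hη, η⟩` is the coefficient of `t ^ 2` up to the exact form `dθ`.
  set θ := P.fluxForm Ω g κ (show 1 + (2 * n - 2 + 1) = 2 * n by omega) (P.dPlus Ω g A η) η with hθ
  have hθs : SmoothFormOn θ Set.univ := PrincipalBundle.smoothFormOn_fluxForm _ hX hη
  have hθ0 : ∀ x ∉ K, θ x = 0 := fun x hx => PrincipalBundle.fluxForm_eq_zero _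
    (h0 x hx _ (P.mem_baseSet_at x))
  have hhess := funext fun x =>
    PrincipalBundle.innerAt_hessianOp (Ω := Ω) (g := g) (κ := κ) hn hg hA hη x
  have hdiv := integrable_topDiv Ω (show 2 * n - 2 + 1 + 1 = 2 * n by omega) hg hθs hK hθ0
  refine ⟨hfinite, ?_, ?_, ?_⟩
  · rw [hact]
    fun_prop
  · rw [hhess]
    exact hQ.add hdiv
  · rw [PrincipalBundle.hessianForm, hact, PrincipalBundle.innerL2, hhess, integral_add hQ hdiv,
      integral_topDiv_eq_zero Ω _ hg hθs hK hθ0, add_zero, iteratedDeriv_quartic]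
    ring
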